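/- Costs are numbers of operations on real numbers, in the algebraic computation tree model: arithmetic operations, copies, square roots, comparisons, and evaluations of a given function $f:\mathbb{R}\to\mathbb{R}$ each cost one step, on a memory of real registers that persists between calls; the programs may depend on the dimensions $d$ and $n$. Let $\omega$ be such that two $n\times n$ matrices can be multiplied in $O(n^{\omega})$ arithmetic operations, and let $\alpha$ be the dual matrix exponent, that is, the largest $b$ such that an $n\times n$ matrix can be multiplied with an $n\times \lceil n^{b}\rceil$ matrix in $n^{2+o(1)}$ arithmetic operations. **Theorem.** Let $0<a\le\alpha$. There is a deterministic data structure with the following operations, for all $n\ge d\ge 1$, every $A\in\mathbb{R}^{d\times n}$ of rank $d$, every $f:\mathbb{R}\to\mathbb{R}$ (write $f(v)_i:=f(v_i)$) and every accuracy parameter $0<\varepsilon_{mp}<1/4$. * Initialize$(A,u,f,v,\varepsilon_{mp})$: preprocesses $A$, $f$ and two vectors $u,v\in\mathbb{R}^n$ with positive entries in $O(n^2d^{\omega-2})$ time. * Update$(u,v)$: given two vectors $u,v\in\mathbb{R}^n$ with positive entries, returns four vectors $$\tilde u,\qquad \tilde v,\qquad f(\tilde v),\qquad \sqrt{\tilde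 U}A^\top(A\tilde UA^\top)^{-1}A\sqrt{\tilde U}\,f(\tilde v),$$ where $\tilde U=\operatorname{diag}(\tilde u)$ and, for all $i$, $$(1-\varepsilon_{mp})\tilde u_i\le u_i\le(1+\varepsilon_{mp})\tilde u_i,\qquad (1-\varepsilon_{mp})\tilde v_i\le v_i\le(1+\varepsilon_{mp})\tilde v_i .$$ Let $u^{(0)},v^{(0)}$ be the vectors given to Initialize and $(u^{(1)},v^{(1)}),\dots,(u^{(T)},v^{(T)})$ the arguments of the first $T$ updates, and let $C\ge 0$. If $$\sum_{i=1}^n\left(\frac{u^{(k+1)}_i-u^{(k)}_i}{u^{(k)}_i}\right)^2\le C^2\quad\text{and}\quad\left|\frac{u^{(k+1)}_i-u^{(k)}_i}{u^{(k)}_i}\right|\le\frac14\ \text{ for all } i,$$ for all $0\le k<T$, and likewise for the $v^{(k)}$, then the total time of these $T$ updates is $$O\!\left(T\cdot\left(\frac{C}{\varepsilon_{mp}}\left(n^{\omega-1/2}+n^{2-a/2+o(1)}\right)\log n+n^{1+a}\right)\right).$$ The constants in $O(\cdot)$ and the $o(1)$ term, which tends to $0$ as $n\to\infty$, depend only on $\omega$,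 $\alpha$ and $a$. -/

import Mathlib

open Filter Topology

namespace ProjMaint

/-! ### Machine model

A memory assigns a real number to every register of a register set `ρ`.  A program is a finite
computation tree over such a memory: every node executes one unit-cost instruction (a ring
operation, a copy or a constant, a division, a square root, one evaluation of the given function
`f`, or one comparison of two registers followed by a jump).  Registers are overwritten in place,
so moving a number costs one step as well, and the memory persists between programs. -/

/-- Branch-free, division-free instructions; the first argument is the register written to. -/
inductive RingInstr (ρ : Type) : Type where
  | const (dst : ρ) (c : ℝ) : RingInstr ρ
  | copy (dst x : ρ) : RingInstr ρ
  | add (dst x y : ρ) : RingInstr ρ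
  | sub (dst x y : ρ) : RingInstr ρ
  | mul (dst x y : ρ) : RingInstr ρ

/-- The effect of one ring instruction on the memory. -/
noncomputable def RingInstr.exec {ρ : Type} [DecidableEq ρ] (I : RingInstr ρ) (s : ρ → ℝ) :
    ρ → ℝ :=
  match I with
  | .const dst c => Function.update s dst c
  | .copy dst x => Function.update s dst (s x)
  | .add dst x y => Function.update s dst (s x + s y)
  | .sub dst x y => Function.update s dst (s x - s y)
  | .mul dst x y => Function.update s dst (s x * s y)

/-- Programs: computation trees over the registers `ρ`. -/
inductive Prog (ρ : Type) : Type where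
  | halt : Prog ρ
  | ring (I : RingInstr ρ) (next : Prog ρ) : Prog ρ
  | div (dst x y : ρ) (next : Prog ρ) : Prog ρ
  | sqrt (dst x : ρ) (next : Prog ρ) : Prog ρ
  | apply (dst x : ρ) (next : Prog ρ) : Prog ρ
  | ifLe (x y : ρ) (yes no : Prog ρ) : Prog ρ

open Classical in
/-- The memory after running a program, where `apply` evaluates the function `f`. -/
noncomputable def Prog.run {ρ : Type} [DecidableEq ρ] (f : ℝ → ℝ) : Prog ρ → (ρ → ℝ) → (ρ → ℝ)
  | .halt, s => s
  | .ring I next, s => next.run f (I.exec s)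
  | .div dst x y next, s => next.run f (Function.update s dst (s x / s y))
  | .sqrt dst x next, s => next.run f (Function.update s dst (Real.sqrt (s x)))
  | .apply dst x next, s => next.run f (Function.update s dst (f (s x)))
  | .ifLe x y yes no, s => if s x ≤ s y then yes.run f s else no.run f s

open Classical in
/-- The number of instructions executed when running a program. -/
noncomputable def Prog.steps {ρ : Type} [DecidableEq ρ] (f : ℝ → ℝ) : Prog ρ → (ρ → ℝ) → ℕ
  | .halt, _ => 0
  | .ring I next, s => next.steps f (I.exec s) + 1
  | .div dst x y next, s => next.steps f (Function.update s dst (s x / s y)) + 1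
  | .sqrt dst x next, s => next.steps f (Function.update s dst (Real.sqrt (s x))) + 1
  | .apply dst x next, s => next.steps f (Function.update s dst (f (s x))) + 1
  | .ifLe x y yes no, s => (if s x ≤ s y then yes.steps f s else no.steps f s) + 1

/-! ### Matrix multiplication exponents -/

/-- Registers for multiplying an `m × k` matrix with a `k × p` matrix. -/
inductive MatMulReg (m k p : ℕ) : Type where
  | left (i : Fin m) (j : Fin k) : MatMulReg m k p
  | right (i : Fin k) (j : Fin p) : MatMulReg m k p
  | out (i : Fin m) (j : Fin p) : MatMulReg m k p
  | work (l : ℕ) : MatMulReg m k p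
  deriving DecidableEq

/-- The memory holding the two factors, with zeros elsewhere. -/
def matMulInput {m k p : ℕ} (X : Matrix (Fin m) (Fin k) ℝ) (Y : Matrix (Fin k) (Fin p) ℝ) :
    MatMulReg m k p → ℝ
  | .left i j => X i j
  | .right i j => Y i j
  | .out _ _ => 0
  | .work _ => 0

/-- An `m × k` matrix can be multiplied with a `k × p` matrix in at most `t` arithmetic operations
(a straight-line program of length at most `t`, correct on all pairs of real matrices). -/
def MatMulIn (m k p : ℕ) (t : ℝ) : Prop :=
  ∃ P : List (RingInstr (MatMulReg m k p)),
    (P.length : ℝ) ≤ t ∧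
    ∀ (X : Matrix (Fin m) (Fin k) ℝ) (Y : Matrix (Fin k) (Fin p) ℝ) (i : Fin m) (j : Fin p),
      (P.foldl (fun s I => I.exec s) (matMulInput X Y)) (.out i j) = (X * Y) i j

/-- Two `n × n` matrices can be multiplied in `O(n ^ ω)` arithmetic operations. -/
def IsMatMulExponent (ω : ℝ) : Prop :=
  ∃ K : ℝ, ∀ n : ℕ, 1 ≤ n → MatMulIn n n n (K * (n : ℝ) ^ ω)

/-- The dual exponent: `α` is the largest `b` such that an `n × n` matrix can be multiplied with an
`n × n ^ b` matrix in `n ^ (2 + o(1))` arithmetic operations. -/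
def IsDualExponent (α : ℝ) : Prop :=
  IsGreatest {b : ℝ | ∃ g : ℕ → ℝ, Tendsto g atTop (𝓝 0) ∧
    ∀ᶠ n : ℕ in atTop, MatMulIn n n ⌈(n : ℝ) ^ b⌉₊ ((n : ℝ) ^ (2 + g n))} α

/-! ### Data structures for projection maintenance -/

/-- Registers of the data structure: the inputs, the four output vectors and working memory. -/
inductive Reg (d n : ℕ) : Type where
  | matA (i : Fin d) (j : Fin n) : Reg d n
  | inU (i : Fin n) : Reg d n
  | inV (i : Fin n) : Reg d n
  | eps : Reg d n
  | outU (i : Fin n) : Reg d n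
  | outV (i : Fin n) : Reg d n
  | outF (i : Fin n) : Reg d n
  | outP (i : Fin n) : Reg d n
  | work (l : ℕ) : Reg d n
  deriving DecidableEq

/-- A deterministic data structure for `d × n` matrices: the programs of its two operations. -/
structure DataStructure (d n : ℕ) where
  initProg : Prog (Reg d n)
  updateProg : Prog (Reg d n)

/-- The memory on which `initProg` is started: the arguments, and zeros elsewhere. -/
def initMemory {d n : ℕ} (A : Matrix (Fin d) (Fin n) ℝ) (ε : ℝ) (u v : Fin n → ℝ) : Reg d n → ℝ
  | .matA i j => A i j
  | .inU i => u i
  | .inV i => v i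
  | .eps => ε
  | _ => 0

/-- Handing over the arguments `u`, `v` of a call of `updateProg`; all other registers persist. -/
def loadInput {d n : ℕ} (u v : Fin n → ℝ) (s : Reg d n → ℝ) : Reg d n → ℝ
  | .inU i => u i
  | .inV i => v i
  | r => s r

namespace DataStructure

variable {d n : ℕ}

/-- The number of steps of `initProg`. -/
noncomputable def initTime (D : DataStructure d n) (f : ℝ → ℝ) (A : Matrix (Fin d) (Fin n) ℝ)
    (ε : ℝ) (u v : Fin n → ℝ) : ℕ :=
  D.initProg.steps f (initMemory A ε u v)

/-- The memory after initialization with `u 0`, `v 0` and the updates `(u 1, v 1), …, (u k, v k)`.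
-/
noncomputable def memory (D : DataStructure d n) (f : ℝ → ℝ) (A : Matrix (Fin d) (Fin n) ℝ)
    (ε : ℝ) (u v : ℕ → Fin n → ℝ) : ℕ → (Reg d n → ℝ)
  | 0 => D.initProg.run f (initMemory A ε (u 0) (v 0))
  | k + 1 => D.updateProg.run f (loadInput (u (k + 1)) (v (k + 1)) (D.memory f A ε u v k))

/-- The number of steps of the update number `k + 1`, that is, the one with `u (k + 1)` and
`v (k + 1)` as its arguments. -/
noncomputable def updateTime (D : DataStructure d n) (f : ℝ → ℝ) (A : Matrix (Fin d) (Fin n) ℝ)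
    (ε : ℝ) (u v : ℕ → Fin n → ℝ) (k : ℕ) : ℕ :=
  D.updateProg.steps f (loadInput (u (k + 1)) (v (k + 1)) (D.memory f A ε u v k))

end DataStructure

/-- `√U Aᵀ (A U Aᵀ)⁻¹ A √U` for `U = diag u`. -/
noncomputable def projMatrix {d n : ℕ} (A : Matrix (Fin d) (Fin n) ℝ) (u : Fin n → ℝ) :
    Matrix (Fin n) (Fin n) ℝ :=
  Matrix.diagonal (fun i => Real.sqrt (u i)) * A.transpose *
    (A * Matrix.diagonal u * A.transpose)⁻¹ * A * Matrix.diagonal (fun i => Real.sqrt (u i))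

/-- The output registers of the memory `s` hold vectors `ũ`, `ṽ`, `f(ṽ)` and
`√Ũ Aᵀ (A Ũ Aᵀ)⁻¹ A √Ũ f(ṽ)` where `ũ`, `ṽ` approximate the inputs `u`, `v`. -/
def CorrectOutput {d n : ℕ} (f : ℝ → ℝ) (A : Matrix (Fin d) (Fin n) ℝ) (ε : ℝ)
    (u v : Fin n → ℝ) (s : Reg d n → ℝ) : Prop :=
  ∃ u' v' : Fin n → ℝ,
    (∀ i, (1 - ε) * u' i ≤ u i ∧ u i ≤ (1 + ε) * u' i) ∧
    (∀ i, (1 - ε) * v' i ≤ v i ∧ v i ≤ (1 + ε) * v' i) ∧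
    (∀ i, s (.outU i) = u' i) ∧
    (∀ i, s (.outV i) = v' i) ∧
    (∀ i, s (.outF i) = f (v' i)) ∧
    (∀ i, s (.outP i) = (projMatrix A u').mulVec (fun j => f (v' j)) i)

/-- Each of the first `T` steps of the sequence `x` changes the vector by at most `C` in relative
`ℓ₂` norm and every entry by at most a quarter. -/
def SmallChange {n : ℕ} (x : ℕ → Fin n → ℝ) (T : ℕ) (C : ℝ) : Prop :=
  ∀ k < T,
    ∑ i, ((x (k + 1) i - x k i) / x k i) ^ 2 ≤ C ^ 2 ∧
    ∀ i, |(x (k + 1) i - x k i) / x k i| ≤ 1 / 4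

end ProjMaint

/-! The data structure stores weights `w = (ũ, ṽ)`, the core matrix `M = Aᵀ(AŨAᵀ)⁻¹A` and the vector
`M √Ũ f(ṽ)`. An update compares its arguments `z = (u, v)` with `w`.

Lazy case. If at most `r₀ ≈ n^b` entries, with `b` slightly below `a`, have relative deviation above
`ε`, they are replaced in the answer only. The Woodbury identity (`woodbury`) applied to a single
column costs `O(n r₀ + r₀²)` plus the inversion of a matrix of size at most `r₀`. The dual exponent
gives square products with exponent `3 - b` by splitting the inner dimension, and `b (3 - b) ≤ 1 +
b`, so the whole answer costs `O(n^(1+b))`.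

Rebuild. Otherwise let thresholds fall from `ε` to `ε/2` in `p = O(log n)` equal steps. The number
of entries above the threshold cannot more than double at every step, so at some step it at most
doubles. All entries above the lower of these two thresholds, at most `2^j` of them, take their new
values, and `M` receives a Woodbury correction of rank at most `2^j`.

Amortization. For each `R` the potential is the sum of the `R` largest deviations, cut off at `ε`.
By Cauchy-Schwarz a change of the arguments raises it by `O(√R C)`; no rebuild raises it, and one at
level `j` lowers the potential for `R = 2^(j-2)` by `R ε/(2p)`. Hence level `j` is rebuilt `O(p T C
/ (ε √(2^j)))` times (`card_rebuild_le`).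

Price of a level. An `n × 2^j` by `2^j × n` product is built from blocks: a square product of size
`2^(p-q)` whose entries are `2^q × 2^(aq)` and `2^(aq) × 2^q` matrices (`MulCost.block`). The inner
shape comes from the dual exponent through the transposition principle
(`MulCost.of_matMulIn_transpose`). Divided by `√(2^j)`, the price is either at most about
`n^(ω-1/2)` times a factor decaying geometrically in `p - j`, or at most about `n^(2-a/2+2δ)`
(`interp_exponent`). Summing over levels gives the bound with a fixed loss `δ`; letting `δ` tend to
zero slowly with `n` turns the loss into `o(1)`.

Costs are counted on derivations of real quantities from one another (`Computes`, `Runs`), which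
never forget or overwrite anything; `Runs.sound` turns a derivation into a program by giving each
new quantity a fresh register. -/

namespace ProjMaint

/-! ### Derivations of quantities

A quantity is a real function on a type `Ω` of situations.  `Computes D A B c` says that on the
situations in `D` the quantities in `B` can be computed from those in `A` in at most `c` steps
without branching. -/

section Derivations

variable {Ω : Type}

/-- The quantity `q` is the result of one branch-free instruction applied to quantities in `A`. -/
inductive OneStep (A : Set (Ω → ℝ)) : (Ω → ℝ) → Prop
  | const (r : ℝ) : OneStep A (fun _ => r)
  | add {x y : Ω → ℝ} (hx : x ∈ A) (hy : y ∈ A) : OneStep A (x + y)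
  | sub {x y : Ω → ℝ} (hx : x ∈ A) (hy : y ∈ A) : OneStep A (x - y)
  | mul {x y : Ω → ℝ} (hx : x ∈ A) (hy : y ∈ A) : OneStep A (x * y)
  | div {x y : Ω → ℝ} (hx : x ∈ A) (hy : y ∈ A) : OneStep A (x / y)
  | sqrt {x : Ω → ℝ} (hx : x ∈ A) : OneStep A (fun s => Real.sqrt (x s))

/-- Every quantity in `B` agrees on `D` with one in `A`. -/
def Dominated (D : Set Ω) (B A : Set (Ω → ℝ)) : Prop :=
  ∀ b ∈ B, ∃ a ∈ A, Set.EqOn b a D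

theorem Dominated.of_subset {D : Set Ω} {B A : Set (Ω → ℝ)} (h : B ⊆ A) : Dominated D B A :=
  fun b hb => ⟨b, h hb, fun _ _ => rfl⟩

theorem Dominated.trans {D : Set Ω} {A B C : Set (Ω → ℝ)} (h : Dominated D A B)
    (h' : Dominated D B C) : Dominated D A C := by
  intro a ha
  obtain ⟨b, hb, hab⟩ := h a ha
  obtain ⟨c, hc, hbc⟩ := h' b hb
  exact ⟨c, hc, hab.trans hbc⟩

theorem Dominated.union {D : Set Ω} {A B C : Set (Ω → ℝ)} (h : Dominated D A C)
    (h' : Dominated D B C) : Dominated D (A ∪ B) C := by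
  rintro x (hx | hx)
  exacts [h x hx, h' x hx]

theorem Dominated.anti {D D' : Set Ω} {B A : Set (Ω → ℝ)} (h : Dominated D B A) (hD : D' ⊆ D) :
    Dominated D' B A := by
  intro b hb
  obtain ⟨a, ha, hab⟩ := h b hb
  exact ⟨a, ha, hab.mono hD⟩

theorem Dominated.insert {D : Set Ω} {B A : Set (Ω → ℝ)} {p q : Ω → ℝ} (h : Dominated D B A)
    (hpq : Set.EqOn p q D) : Dominated D (insert p B) (insert q A) := by
  rintro b (rfl | hb)
  · exact ⟨q, Set.mem_insert _ _, hpq⟩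
  · obtain ⟨a, ha, hab⟩ := h b hb
    exact ⟨a, Set.mem_insert_of_mem _ ha, hab⟩

theorem OneStep.dominated {D : Set Ω} {A A' : Set (Ω → ℝ)} {q : Ω → ℝ} (hq : OneStep A q)
    (h : Dominated D A A') : ∃ q', OneStep A' q' ∧ Set.EqOn q q' D := by
  cases hq with
  | const r => exact ⟨_, .const r, fun _ _ => rfl⟩
  | @add x y hx hy =>
    obtain ⟨x', hx', hxx⟩ := h x hx
    obtain ⟨y', hy', hyy⟩ := h y hy
    exact ⟨_, .add hx' hy', fun s hs => by simp [hxx hs, hyy hs]⟩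
  | @sub x y hx hy =>
    obtain ⟨x', hx', hxx⟩ := h x hx
    obtain ⟨y', hy', hyy⟩ := h y hy
    exact ⟨_, .sub hx' hy', fun s hs => by simp [hxx hs, hyy hs]⟩
  | @mul x y hx hy =>
    obtain ⟨x', hx', hxx⟩ := h x hx
    obtain ⟨y', hy', hyy⟩ := h y hy
    exact ⟨_, .mul hx' hy', fun s hs => by simp [hxx hs, hyy hs]⟩
  | @div x y hx hy =>
    obtain ⟨x', hx', hxx⟩ := h x hx
    obtain ⟨y', hy', hyy⟩ := h y hy
    exact ⟨_, .div hx' hy', fun s hs => by simp [hxx hs, hyy hs]⟩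
  | @sqrt x hx =>
    obtain ⟨x', hx', hxx⟩ := h x hx
    exact ⟨_, .sqrt hx', fun s hs => by simp [hxx hs]⟩

/-- On the situations in `D`, the quantities in `B` can be computed from those in `A` in `c`
steps. -/
inductive Computes (D : Set Ω) : Set (Ω → ℝ) → Set (Ω → ℝ) → ℝ → Prop
  | free {A B : Set (Ω → ℝ)} {c : ℝ} (h : Dominated D B A) (hc : 0 ≤ c) : Computes D A B c
  | step {A B : Set (Ω → ℝ)} {c : ℝ} (q : Ω → ℝ) (hq : OneStep A q)
      (h : Computes D (insert q A) B c) : Computes D A B (c + 1)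

namespace Computes

variable {D : Set Ω} {A A' B B' G : Set (Ω → ℝ)} {c c' : ℝ}

theorem nonneg (h : Computes D A B c) : 0 ≤ c := by
  induction h with
  | free _ hc => exact hc
  | step q hq _ ih => linarith

theorem mono_cost (h : Computes D A B c) (hc : c ≤ c') : Computes D A B c' := by
  induction h generalizing c' with
  | free h hc0 => exact .free h (hc0.trans hc)
  | step q hq _ ih =>
    have := step q hq (ih (c' := c' - 1) (by linarith))
    simpa using this

theorem dom_left (h : Computes D A B c) (hA : Dominated D A A') : Computes D A' B c := by
  induction h generalizing A' with
  | free h hc => exact .free (h.trans hA) hc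
  | step q hq _ ih =>
    obtain ⟨q', hq', hqq⟩ := hq.dominated hA
    exact .step q' hq' (ih (hA.insert hqq))

theorem dom_right (h : Computes D A B c) (hB : Dominated D G B) : Computes D A G c := by
  induction h with
  | free h hc => exact .free (hB.trans h) hc
  | step q hq _ ih => exact .step q hq (ih hB)

theorem mono_left (h : Computes D A B c) (hA : A ⊆ A') : Computes D A' B c :=
  h.dom_left (.of_subset hA)

theorem mono_right (h : Computes D A B c) (hB : G ⊆ B) : Computes D A G c :=
  h.dom_right (.of_subset hB)

theorem of_subset (h : B ⊆ A) : Computes D A B 0 := .free (.of_subset h) le_rfl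

/-- Agreement on `D` suffices, so identities that need positivity or invertibility can be used to
rename a result at no cost. -/
theorem congr (h : Computes D A B c) (hB : ∀ b' ∈ B', ∃ b ∈ B, ∀ s ∈ D, b' s = b s) :
    Computes D A B' c := h.dom_right hB

/-- Since nothing is forgotten, the second derivation may still use all of `A`. -/
theorem trans (h : Computes D A B c) (h' : Computes D (A ∪ B) G c') :
    Computes D A G (c + c') := by
  induction h with
  | @free A B c h hc =>
    exact (h'.dom_left ((Dominated.of_subset subset_rfl).union h)).mono_cost (by linarith)
  | @step A B c q hq _ ih =>
    have := step q hq (ih (h'.mono_left (Set.union_subset_union_left _ (Set.subset_insert _ _))))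
    exact this.mono_cost (by linarith)

theorem add_left (h : Computes D A B c) : Computes D A (A ∪ B) c := by
  induction h with
  | free h hc => exact .free ((Dominated.of_subset subset_rfl).union h) hc
  | step q hq _ ih =>
    exact .step q hq (ih.mono_right (Set.union_subset_union_left _ (Set.subset_insert _ _)))

theorem union (h : Computes D A B c) (h' : Computes D A B' c') :
    Computes D A (B ∪ B') (c + c') := by
  have h1 := h'.mono_left (Set.subset_union_left (t := B))
  refine h.trans (h1.add_left.mono_right ?_)
  rintro x (hx | hx)
  exacts [Or.inl (Or.inr hx), Or.inr hx]

theorem one (q : Ω → ℝ) (hq : OneStep A q) : Computes D A {q} 1 := by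
  have := step (D := D) q hq (of_subset (B := {q}) (by simp))
  simpa using this

theorem finset_biUnion {ι : Type*} (s : Finset ι) (Bs : ι → Set (Ω → ℝ)) (t : ℝ)
    (h : ∀ i ∈ s, Computes D A (Bs i) t) : Computes D A (⋃ i ∈ s, Bs i) (s.card * t) := by
  classical
  induction s using Finset.induction_on with
  | empty => simpa using of_subset (D := D) (Set.empty_subset A)
  | insert i s hi ih =>
    have := (h i (by simp)).union (ih fun j hj => h j (by simp [hj]))
    rw [Finset.card_insert_of_notMem hi]
    simp only [Finset.mem_insert, Set.iUnion_iUnion_eq_or_left]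
    exact this.mono_cost (by push_cast; linarith)

theorem iUnion {ι : Type*} [Fintype ι] (Bs : ι → Set (Ω → ℝ)) (t : ℝ)
    (h : ∀ i, Computes D A (Bs i) t) : Computes D A (⋃ i, Bs i) (Fintype.card ι * t) := by
  simpa using finset_biUnion Finset.univ Bs t fun i _ => h i

theorem range {ι : Type*} [Fintype ι] (q : ι → Ω → ℝ) (t : ℝ)
    (h : ∀ i, Computes D A {q i} t) : Computes D A (Set.range q) (Fintype.card ι * t) := by
  simpa using iUnion (fun i => {q i}) t h

theorem range_one {ι : Type*} [Fintype ι] (q : ι → Ω → ℝ)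
    (h : ∀ i, OneStep A (q i)) : Computes D A (Set.range q) (Fintype.card ι) := by
  simpa using range q 1 fun i => one _ (h i)

end Computes

end Derivations

/-! ### Programs from derivations -/

section Runs

variable {Ω ρ : Type}

/-- The setting in which a program runs: the initial memory and the function evaluated in every
situation, and the scratch registers. -/
structure Setting (Ω ρ : Type) where
  mem : Ω → ρ → ℝ
  fn : Ω → ℝ → ℝ
  scratch : ℕ → ρ
  scratch_injective : Function.Injective scratch

/-- A program started with `c` steps already used, on a memory holding the quantities in `A`,
reaches a memory `s` and a step count `c'` with `Post ω s c'`, in every situation `ω ∈ D`. -/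
inductive Runs (E : Setting Ω ρ) (Post : Ω → (ρ → ℝ) → ℝ → Prop) :
    Set Ω → Set (Ω → ℝ) → ℝ → Prop
  | done {D : Set Ω} {A : Set (Ω → ℝ)} {c : ℝ} (W : Finset ρ) (out : ρ → Ω → ℝ)
      (hW : ∀ w ∈ W, out w ∈ A ∧ w ∉ Set.range E.scratch)
      (h : ∀ x ∈ D, ∀ s : ρ → ℝ, (∀ w ∈ W, s w = out w x) →
        (∀ r, r ∉ W → r ∉ Set.range E.scratch → s r = E.mem x r) → Post x s (c + 2 * W.card)) :
      Runs E Post D A c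
  | step {D : Set Ω} {A : Set (Ω → ℝ)} {c : ℝ} (q : Ω → ℝ) (hq : OneStep A q)
      (h : Runs E Post D (insert q A) (c + 1)) : Runs E Post D A c
  | apply {D : Set Ω} {A : Set (Ω → ℝ)} {c : ℝ} (x : Ω → ℝ) (hx : x ∈ A)
      (h : Runs E Post D (insert (fun s => E.fn s (x s)) A) (c + 1)) : Runs E Post D A c
  | ifLe {D : Set Ω} {A : Set (Ω → ℝ)} {c : ℝ} (x y : Ω → ℝ) (hx : x ∈ A) (hy : y ∈ A)
      (hyes : Runs E Post (D ∩ {s | x s ≤ y s}) A (c + 1))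
      (hno : Runs E Post (D ∩ {s | ¬ x s ≤ y s}) A (c + 1)) : Runs E Post D A c
  | weaken {D : Set Ω} {A : Set (Ω → ℝ)} {c c' : ℝ} (hc : c ≤ c') (h : Runs E Post D A c') :
      Runs E Post D A c

variable {E : Setting Ω ρ} {Post : Ω → (ρ → ℝ) → ℝ → Prop} {D : Set Ω} {A : Set (Ω → ℝ)} {c : ℝ}

/-- A derivation only ever looks at values in situations of `D`, and branching shrinks `D`; so
quantities may be exchanged for others that agree with them there. -/
theorem Runs.dom {A' : Set (Ω → ℝ)} (h : Runs E Post D A c) (hA : Dominated D A A') :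
    Runs E Post D A' c := by
  classical
  induction h generalizing A' with
  | @done D A c W out hW h =>
    choose! a ha hab using hA
    refine .done W (fun w => a (out w)) (fun w hw => ⟨ha _ (hW w hw).1, (hW w hw).2⟩) ?_
    intro x hx s hs hs'
    exact h x hx s (fun w hw => (hs w hw).trans (hab _ (hW w hw).1 hx).symm) hs'
  | step q hq _ ih =>
    obtain ⟨q', hq', hqq⟩ := hq.dominated hA
    exact .step q' hq' (ih (hA.insert hqq))
  | apply x hx _ ih =>
    obtain ⟨x', hx', hxx⟩ := hA x hx
    exact .apply x' hx' (ih (hA.insert fun s hs => by simp [hxx hs]))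
  | @ifLe D A c x y hx hy _ _ ih1 ih2 =>
    obtain ⟨x', hx', hxx⟩ := hA x hx
    obtain ⟨y', hy', hyy⟩ := hA y hy
    have e1 : D ∩ {s | x s ≤ y s} = D ∩ {s | x' s ≤ y' s} := by
      ext s
      simp only [Set.mem_inter_iff, Set.mem_ofPred_eq, and_congr_right_iff]
      intro hs
      rw [hxx hs, hyy hs]
    have e2 : D ∩ {s | ¬ x s ≤ y s} = D ∩ {s | ¬ x' s ≤ y' s} := by
      ext s
      simp only [Set.mem_inter_iff, Set.mem_ofPred_eq, and_congr_right_iff]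
      intro hs
      rw [hxx hs, hyy hs]
    refine .ifLe x' y' hx' hy' ?_ ?_
    · rw [← e1]; exact ih1 (hA.anti Set.inter_subset_left)
    · rw [← e2]; exact ih2 (hA.anti Set.inter_subset_left)
  | weaken hc _ ih => exact .weaken hc (ih hA)

theorem Runs.computes {B : Set (Ω → ℝ)} {k : ℝ} (hk : Computes D A B k)
    (h : Runs E Post D (A ∪ B) (c + k)) : Runs E Post D A c := by
  induction hk generalizing c with
  | free hB hc =>
    exact .weaken (by linarith) (h.dom ((Dominated.of_subset subset_rfl).union hB))
  | @step A B k q hq _ ih =>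
    refine .step q hq (ih ?_)
    refine (Runs.weaken (by linarith) h).dom (.of_subset ?_)
    exact Set.union_subset_union_left _ (Set.subset_insert _ _)

theorem Runs.apply_range {ι : Type*} [Fintype ι] (x : ι → Ω → ℝ) (hx : ∀ i, x i ∈ A)
    (h : Runs E Post D (A ∪ Set.range fun i s => E.fn s (x i s)) (c + Fintype.card ι)) :
    Runs E Post D A c := by
  classical
  suffices H : ∀ (t : Finset ι) (c : ℝ),
      Runs E Post D (A ∪ (fun i s => E.fn s (x i s)) '' t) (c + t.card) → Runs E Post D A c by
    refine H Finset.univ c ?_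
    simpa using h
  intro t
  induction t using Finset.induction_on with
  | empty => intro c hc; simpa using hc
  | insert i t hi ih =>
    intro c hc
    refine ih c (.apply (x i) (Or.inl (hx i)) ?_)
    rw [Finset.card_insert_of_notMem hi] at hc
    push_cast at hc
    rw [← add_assoc] at hc
    refine hc.dom (.of_subset ?_)
    rw [Set.image_insert_eq, Set.union_insert]

/-- Branching on the set of indices `i` with `x i ≤ y i`. -/
theorem Runs.branch {ι : Type*} [Fintype ι] [DecidableEq ι] (x y : ι → Ω → ℝ)
    (hx : ∀ i, x i ∈ A) (hy : ∀ i, y i ∈ A)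
    (h : ∀ S : Finset ι, Runs E Post (D ∩ {s | ∀ i, i ∈ S ↔ x i s ≤ y i s}) A
      (c + Fintype.card ι)) :
    Runs E Post D A c := by
  suffices H : ∀ (t : Finset ι) (D : Set Ω) (c : ℝ),
      (∀ S ⊆ t, Runs E Post (D ∩ {s | ∀ i ∈ t, i ∈ S ↔ x i s ≤ y i s}) A (c + t.card)) →
      Runs E Post D A c by
    refine H Finset.univ D c fun S _ => ?_
    simpa using h S
  intro t
  induction t using Finset.induction_on with
  | empty => intro D c hc; simpa using hc ∅ subset_rfl
  | insert i t hi ih =>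
    intro D c hc
    refine .ifLe (x i) (y i) (hx i) (hy i) ?_ ?_
    · refine ih _ _ fun S hS => ?_
      have := hc (insert i S) (Finset.insert_subset_insert _ hS)
      rw [Finset.card_insert_of_notMem hi] at this
      push_cast at this
      rw [add_assoc, add_comm 1 (t.card : ℝ)]
      convert this using 1
      ext s
      simp only [Set.mem_inter_iff, Set.mem_ofPred_eq, Finset.mem_insert, forall_eq_or_imp, true_or,
        true_iff, and_assoc]
      refine and_congr_right fun _ => and_congr_right fun _ => forall₂_congr fun j hj => ?_
      have : j ≠ i := fun e => hi (e ▸ hj)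
      simp [this]
    · refine ih _ _ fun S hS => ?_
      have := hc S (hS.trans (Finset.subset_insert _ _))
      rw [Finset.card_insert_of_notMem hi] at this
      push_cast at this
      rw [add_assoc, add_comm 1 (t.card : ℝ)]
      convert this using 1
      ext s
      have : i ∉ S := fun e => hi (hS e)
      simp [this, and_assoc]

end Runs

/-! ### Soundness -/

section Sound

variable {Ω ρ : Type} [DecidableEq ρ]

/-- Writing the registers in a finite set with values that the memory holds elsewhere. -/
theorem exists_writeProg (scratch : ℕ → ρ) (hinj : Function.Injective scratch) (W : Finset ρ)
    (hW : ∀ w ∈ W, w ∉ Set.range scratch) (src : ρ → ρ) (m : ℕ)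
    (hsrc : ∀ w, ∀ l, m ≤ l → src w ≠ scratch l) :
    ∃ P : Prog ρ, ∀ f s, P.steps f s = 2 * W.card ∧ (∀ w ∈ W, P.run f s w = s (src w)) ∧
      ∀ r, r ∉ W → r ∉ Set.range scratch → P.run f s r = s r := by
  -- the sources are copied to fresh scratch registers first, as they may be written to
  have phase1 : ∀ V : Finset ρ, ∃ (loc : ρ → ℕ) (n : ℕ) (F : Prog ρ → Prog ρ),
      (∀ w ∈ V, m ≤ loc w ∧ loc w < n) ∧ m ≤ n ∧
      ∀ f s, ∃ s', (∀ Q, (F Q).run f s = Q.run f s' ∧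
          (F Q).steps f s = Q.steps f s' + V.card) ∧
        (∀ w ∈ V, s' (scratch (loc w)) = s (src w)) ∧
        (∀ r, (∀ l, m ≤ l → r ≠ scratch l) → s' r = s r) := by
    intro V
    induction V using Finset.induction_on with
    | empty => exact ⟨fun _ => m, m, id, by simp, le_rfl, fun f s => ⟨s, by simp, by simp,
        fun _ _ => rfl⟩⟩
    | insert w V hw ih =>
      obtain ⟨loc, n, F, h1, hmn, h2⟩ := ih
      refine ⟨Function.update loc w n, n + 1,
        fun Q => F (.ring (.copy (scratch n) (src w)) Q), ?_, by omega, ?_⟩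
      · intro v hv
        rcases Finset.mem_insert.1 hv with rfl | hv
        · simp [hmn]
        · have : v ≠ w := fun e => hw (e ▸ hv)
          have := h1 v hv
          simp [*]
          omega
      · intro f s
        obtain ⟨s', a1, a2, a3⟩ := h2 f s
        refine ⟨Function.update s' (scratch n) (s (src w)), ?_, ?_, ?_⟩
        · intro Q
          obtain ⟨b1, b2⟩ := a1 (.ring (.copy (scratch n) (src w)) Q)
          rw [b1, b2]
          simp only [Prog.run, Prog.steps, RingInstr.exec, a3 _ (hsrc w),
            Finset.card_insert_of_notMem hw]
          exact ⟨trivial, by ring⟩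
        · intro v hv
          rcases Finset.mem_insert.1 hv with rfl | hv
          · simp
          · have hne : v ≠ w := fun e => hw (e ▸ hv)
            have := h1 v hv
            rw [Function.update_of_ne hne, Function.update_of_ne, a2 v hv]
            exact fun e => by have := hinj e; omega
        · intro r hr
          rw [Function.update_of_ne (hr n hmn), a3 r hr]
  have phase2 : ∀ (loc : ρ → ℕ) (V : Finset ρ), (∀ w ∈ V, w ∉ Set.range scratch) →
      ∃ P : Prog ρ, ∀ f s, P.steps f s = V.card ∧
        (∀ w ∈ V, P.run f s w = s (scratch (loc w))) ∧ ∀ r, r ∉ V → P.run f s r = s r := by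
    intro loc V
    induction V using Finset.induction_on with
    | empty => exact fun _ => ⟨.halt, by simp [Prog.run, Prog.steps]⟩
    | insert w V hw ih =>
      intro hV
      obtain ⟨P, hP⟩ := ih fun v hv => hV v (by simp [hv])
      refine ⟨.ring (.copy w (scratch (loc w))) P, fun f s => ?_⟩
      obtain ⟨h1, h2, h3⟩ := hP f (Function.update s w (s (scratch (loc w))))
      have hwS : ∀ l, scratch l ≠ w := fun l e => hV w (by simp) ⟨l, e⟩
      simp only [Prog.run, Prog.steps, RingInstr.exec]
      refine ⟨by rw [h1, Finset.card_insert_of_notMem hw], ?_, ?_⟩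
      · intro v hv
        rcases Finset.mem_insert.1 hv with rfl | hv
        · rw [h3 _ hw]; simp
        · rw [h2 v hv, Function.update_of_ne (hwS _)]
      · intro r hr
        rw [Finset.mem_insert, not_or] at hr
        rw [h3 r hr.2, Function.update_of_ne hr.1]
  obtain ⟨loc, n, F, h1, hmn, h2⟩ := phase1 W
  obtain ⟨P, hP⟩ := phase2 loc W hW
  refine ⟨F P, fun f s => ?_⟩
  obtain ⟨s', a1, a2, a3⟩ := h2 f s
  obtain ⟨b1, b2⟩ := a1 P
  obtain ⟨c1, c2, c3⟩ := hP f s'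
  rw [b1, b2, c1]
  refine ⟨by ring, fun w hw => by rw [c2 w hw, a2 w hw], fun r hr hr' => ?_⟩
  rw [c3 r hr, a3 r fun l _ e => hr' ⟨l, e.symm⟩]

/-- Each new quantity goes to the first scratch register not yet in use, whose number is `m`. Thus
quantities already held survive, and the other registers keep their initial contents until the final
write. The step count is only bounded by `c'`, because derivations may overcount. -/
theorem Runs.sound {E : Setting Ω ρ} {Post : Ω → (ρ → ℝ) → ℝ → Prop} {D : Set Ω}
    {A : Set (Ω → ℝ)} {c : ℝ} (h : Runs E Post D A c) (addr : (Ω → ℝ) → ρ) (m : ℕ)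
    (hm : ∀ a ∈ A, ∀ l, m ≤ l → addr a ≠ E.scratch l) :
    ∃ P : Prog ρ, ∀ x ∈ D, ∀ s : ρ → ℝ, (∀ a ∈ A, s (addr a) = a x) →
      (∀ r, r ∉ Set.range E.scratch → s r = E.mem x r) →
      ∃ c', c + P.steps (E.fn x) s ≤ c' ∧ Post x (P.run (E.fn x) s) c' := by
  classical
  -- one instruction that appends the quantity `q` to the memory
  have key : ∀ {D : Set Ω} {A : Set (Ω → ℝ)} {c : ℝ} (q : Ω → ℝ) (addr : (Ω → ℝ) → ρ) (m : ℕ)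
      (_ : ∀ a ∈ A, ∀ l, m ≤ l → addr a ≠ E.scratch l)
      (I : Prog ρ → Prog ρ)
      (_ : ∀ x ∈ D, ∀ s : ρ → ℝ, (∀ a ∈ A, s (addr a) = a x) → ∀ Q : Prog ρ,
        (I Q).run (E.fn x) s = Q.run (E.fn x) (Function.update s (E.scratch m) (q x)) ∧
        (I Q).steps (E.fn x) s = Q.steps (E.fn x) (Function.update s (E.scratch m) (q x)) + 1)
      (_ : ∀ (addr : (Ω → ℝ) → ρ) (m : ℕ)
        (_ : ∀ a ∈ insert q A, ∀ l, m ≤ l → addr a ≠ E.scratch l),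
        ∃ P : Prog ρ, ∀ x ∈ D, ∀ s : ρ → ℝ, (∀ a ∈ insert q A, s (addr a) = a x) →
          (∀ r, r ∉ Set.range E.scratch → s r = E.mem x r) →
          ∃ c', c + 1 + P.steps (E.fn x) s ≤ c' ∧ Post x (P.run (E.fn x) s) c'),
      ∃ P : Prog ρ, ∀ x ∈ D, ∀ s : ρ → ℝ, (∀ a ∈ A, s (addr a) = a x) →
        (∀ r, r ∉ Set.range E.scratch → s r = E.mem x r) →
        ∃ c', c + P.steps (E.fn x) s ≤ c' ∧ Post x (P.run (E.fn x) s) c' := by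
    intro D A c q addr m hm I hI ih
    obtain ⟨P, hP⟩ := ih (Function.update addr q (E.scratch m)) (m + 1) (by
      intro a ha l hl
      by_cases haq : a = q
      · subst haq
        rw [Function.update_self]
        exact fun e => by have := E.scratch_injective e; omega
      · rw [Function.update_of_ne haq]
        exact hm a (ha.resolve_left haq) l (by omega))
    refine ⟨I P, fun x hx s hs hmem => ?_⟩
    obtain ⟨e1, e2⟩ := hI x hx s hs P
    obtain ⟨c', hc', hpost⟩ := hP x hx (Function.update s (E.scratch m) (q x)) (by
      intro a ha
      by_cases haq : a = q
      · subst haq; simp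
      · have haA := ha.resolve_left haq
        rw [Function.update_of_ne haq, Function.update_of_ne (hm a haA m le_rfl), hs a haA]) (by
      intro r hr
      rw [Function.update_of_ne (fun e => hr ⟨m, e.symm⟩), hmem r hr])
    refine ⟨c', ?_, by rwa [e1]⟩
    rw [e2]
    push_cast
    linarith
  induction h generalizing addr m with
  | @done D A c W out hW h =>
    by_cases hA : A.Nonempty
    · obtain ⟨a0, ha0⟩ := hA
      -- Registers outside `W` get the address of `a0` as a dummy source, which also avoids the free
      -- scratch registers.
      obtain ⟨P, hP⟩ := exists_writeProg E.scratch E.scratch_injective W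
        (fun w hw => (hW w hw).2) (fun w => if w ∈ W then addr (out w) else addr a0) m (by
          intro w
          by_cases hw : w ∈ W
          · simpa [hw] using hm _ (hW w hw).1
          · simpa [hw] using hm _ ha0)
      refine ⟨P, fun x hx s hs hmem => ⟨c + 2 * W.card, ?_, ?_⟩⟩
      · obtain ⟨h1, h2, h3⟩ := hP (E.fn x) s
        rw [h1]; push_cast; exact le_rfl
      · obtain ⟨h1, h2, h3⟩ := hP (E.fn x) s
        refine h x hx _ (fun w hw => ?_) fun r hr hr' => ?_
        · rw [h2 w hw, if_pos hw, hs _ (hW w hw).1]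
        · rw [h3 r hr hr', hmem r hr']
    · have hWe : W = ∅ := by
        refine Finset.eq_empty_of_forall_notMem fun w hw => hA ⟨_, (hW w hw).1⟩
      subst hWe
      refine ⟨.halt, fun x hx s hs hmem => ⟨c, by simp [Prog.steps], ?_⟩⟩
      have := h x hx s (by simp) (fun r _ hr => hmem r hr)
      simpa [Prog.run] using this
  | @step D A c q hq _ ih =>
    cases hq with
    | const r =>
      refine key _ addr m hm (.ring (.const (E.scratch m) r)) ?_ ih
      intro x hx s hs Q
      exact ⟨rfl, rfl⟩
    | @add a b ha hb =>
      refine key _ addr m hm (.ring (.add (E.scratch m) (addr a) (addr b))) ?_ ih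
      intro x hx s hs Q
      simp only [Prog.run, Prog.steps, RingInstr.exec, hs a ha, hs b hb, Pi.add_apply, and_self]
    | @sub a b ha hb =>
      refine key _ addr m hm (.ring (.sub (E.scratch m) (addr a) (addr b))) ?_ ih
      intro x hx s hs Q
      simp only [Prog.run, Prog.steps, RingInstr.exec, hs a ha, hs b hb, Pi.sub_apply, and_self]
    | @mul a b ha hb =>
      refine key _ addr m hm (.ring (.mul (E.scratch m) (addr a) (addr b))) ?_ ih
      intro x hx s hs Q
      simp only [Prog.run, Prog.steps, RingInstr.exec, hs a ha, hs b hb, Pi.mul_apply, and_self]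
    | @div a b ha hb =>
      refine key _ addr m hm (.div (E.scratch m) (addr a) (addr b)) ?_ ih
      intro x hx s hs Q
      simp only [Prog.run, Prog.steps, hs a ha, hs b hb, Pi.div_apply, and_self]
    | @sqrt a ha =>
      refine key _ addr m hm (.sqrt (E.scratch m) (addr a)) ?_ ih
      intro x hx s hs Q
      simp only [Prog.run, Prog.steps, hs a ha, and_self]
  | @apply D A c a ha _ ih =>
    refine key _ addr m hm (.apply (E.scratch m) (addr a)) ?_ ih
    intro x hx s hs Q
    simp only [Prog.run, Prog.steps, hs a ha, and_self]
  | @ifLe D A c a b ha hb _ _ ih1 ih2 =>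
    obtain ⟨P1, hP1⟩ := ih1 addr m hm
    obtain ⟨P2, hP2⟩ := ih2 addr m hm
    refine ⟨.ifLe (addr a) (addr b) P1 P2, fun x hx s hs hmem => ?_⟩
    simp only [Prog.run, Prog.steps, hs a ha, hs b hb]
    by_cases hab : a x ≤ b x
    · obtain ⟨c', h1, h2⟩ := hP1 x ⟨hx, hab⟩ s hs hmem
      refine ⟨c', ?_, by rwa [if_pos hab]⟩
      rw [if_pos hab]; push_cast; linarith
    · obtain ⟨c', h1, h2⟩ := hP2 x ⟨hx, hab⟩ s hs hmem
      refine ⟨c', ?_, by rwa [if_neg hab]⟩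
      rw [if_neg hab]; push_cast; linarith
  | weaken hc _ ih =>
    obtain ⟨P, hP⟩ := ih addr m hm
    refine ⟨P, fun x hx s hs hmem => ?_⟩
    obtain ⟨c', h1, h2⟩ := hP x hx s hs hmem
    exact ⟨c', by linarith, h2⟩

/-- A derivation from the contents of the non-scratch registers yields a program. -/
theorem Runs.exists_prog {E : Setting Ω ρ} {Post : Ω → (ρ → ℝ) → ℝ → Prop} {D : Set Ω}
    [Nonempty ρ]
    (h : Runs E Post D {q | ∃ r, r ∉ Set.range E.scratch ∧ q = fun x => E.mem x r} 0) :
    ∃ P : Prog ρ, ∀ x ∈ D, ∃ c' : ℝ, P.steps (E.fn x) (E.mem x) ≤ c' ∧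
      Post x (P.run (E.fn x) (E.mem x)) c' := by
  classical
  choose! addr haddr using
    fun (q : Ω → ℝ) (hq : ∃ r, r ∉ Set.range E.scratch ∧ q = fun x => E.mem x r) => hq
  obtain ⟨P, hP⟩ := h.sound addr 0 (by
    intro a ha l _ e
    exact (haddr a ha).1 ⟨l, e.symm⟩)
  refine ⟨P, fun x hx => ?_⟩
  obtain ⟨c', h1, h2⟩ := hP x hx (E.mem x) (by
    intro a ha
    exact (congrFun (haddr a ha).2 x).symm) (fun _ _ => rfl)
  exact ⟨c', by linarith, h2⟩

end Sound
end ProjMaint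


/-! ### Matrix products: padding, splitting, transposition and blocking of straight-line programs.
-/

namespace ProjMaint

/-! ### Straight-line programs over commutative algebras -/

section RunIn

variable {ρ : Type} [DecidableEq ρ] {R R' : Type*} [CommRing R] [Algebra ℝ R] [CommRing R']
  [Algebra ℝ R']

/-- The effect of a ring instruction on a memory holding elements of an `ℝ`-algebra. -/
def RingInstr.execIn (I : RingInstr ρ) (s : ρ → R) : ρ → R :=
  match I with
  | .const dst c => Function.update s dst (algebraMap ℝ R c)
  | .copy dst x => Function.update s dst (s x)
  | .add dst x y => Function.update s dst (s x + s y)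
  | .sub dst x y => Function.update s dst (s x - s y)
  | .mul dst x y => Function.update s dst (s x * s y)

/-- Running a straight-line program over an `ℝ`-algebra. -/
def runIn (P : List (RingInstr ρ)) (s : ρ → R) : ρ → R :=
  P.foldl (fun s I => I.execIn s) s

theorem runIn_real (P : List (RingInstr ρ)) (s : ρ → ℝ) :
    P.foldl (fun s I => I.exec s) s = runIn P s := by
  unfold runIn
  congr 1

theorem map_execIn (φ : R →ₐ[ℝ] R') (I : RingInstr ρ) (s : ρ → R) :
    (fun r => φ (I.execIn s r)) = I.execIn (fun r => φ (s r)) := by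
  cases I <;> funext r <;> simp only [RingInstr.execIn, Function.update_apply] <;>
    split_ifs <;> simp

/-- Straight-line programs without division evaluate polynomials, so they commute with algebra
homomorphisms. This carries a program from the reals to quantities, polynomials and dual numbers. -/
theorem map_runIn (φ : R →ₐ[ℝ] R') (P : List (RingInstr ρ)) (s : ρ → R) :
    (fun r => φ (runIn P s r)) = runIn P (fun r => φ (s r)) := by
  induction P generalizing s with
  | nil => rfl
  | cons I P ih =>
    change (fun r => φ (runIn P (I.execIn s) r)) = runIn P (I.execIn fun r => φ (s r))
    rw [ih, map_execIn]

/-- The memory over `R` holding two factors. -/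
def mulInput {m k p : ℕ} (X : Matrix (Fin m) (Fin k) R) (Y : Matrix (Fin k) (Fin p) R) :
    MatMulReg m k p → R
  | .left i j => X i j
  | .right i j => Y i j
  | .out _ _ => 0
  | .work _ => 0

theorem matMulInput_eq {m k p : ℕ} (X : Matrix (Fin m) (Fin k) ℝ) (Y : Matrix (Fin k) (Fin p) ℝ) :
    matMulInput X Y = mulInput X Y := by
  funext r; cases r <;> rfl

theorem map_mulInput {m k p : ℕ} (φ : R →ₐ[ℝ] R') (X : Matrix (Fin m) (Fin k) R)
    (Y : Matrix (Fin k) (Fin p) R) :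
    (fun r => φ (mulInput X Y r)) = mulInput (X.map φ) (Y.map φ) := by
  funext r; cases r <;> simp [mulInput]

end RunIn

section RunComputes

variable {Ω ρ : Type} [DecidableEq ρ] {D : Set Ω} {A : Set (Ω → ℝ)}

theorem RingInstr.computes_execIn (I : RingInstr ρ) (st : ρ → Ω → ℝ) (h : ∀ r, st r ∈ A) :
    ∃ q : Ω → ℝ, Computes D A {q} 1 ∧ ∀ r, I.execIn st r ∈ insert q A := by
  have key : ∀ (dst : ρ) (q : Ω → ℝ) (r : ρ), Function.update st dst q r ∈ insert q A := by
    intro dst q r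
    rw [Function.update_apply]
    split_ifs
    exacts [Set.mem_insert _ _, Set.mem_insert_of_mem _ (h r)]
  cases I with
  | const dst c => exact ⟨_, .one _ (.const c), fun r => key dst _ r⟩
  | copy dst x => exact ⟨_, (Computes.of_subset (by simpa using h x)).mono_cost zero_le_one,
      fun r => key dst _ r⟩
  | add dst x y => exact ⟨_, .one _ (.add (h x) (h y)), fun r => key dst _ r⟩
  | sub dst x y => exact ⟨_, .one _ (.sub (h x) (h y)), fun r => key dst _ r⟩
  | mul dst x y => exact ⟨_, .one _ (.mul (h x) (h y)), fun r => key dst _ r⟩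

/-- A run over the algebra `Ω → ℝ` treats all situations at once, and each instruction produces at
most one new quantity. -/
theorem computes_runIn (P : List (RingInstr ρ)) (st : ρ → Ω → ℝ) (h : ∀ r, st r ∈ A) :
    Computes D A (Set.range (runIn P st)) P.length := by
  induction P generalizing A st with
  | nil =>
    have : Set.range (runIn ([] : List (RingInstr ρ)) st) ⊆ A := by
      rintro _ ⟨r, rfl⟩; exact h r
    simpa using Computes.of_subset this
  | cons I P ih =>
    obtain ⟨q, hq, hst⟩ := I.computes_execIn (D := D) st h
    have := hq.trans ((ih (A := A ∪ {q}) (I.execIn st) (by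
      intro r; simpa [or_comm] using hst r)))
    rw [List.length_cons]
    push_cast
    rw [add_comm]
    exact this

end RunComputes

/-! ### Costs of matrix products -/

/-- The entries of a matrix of quantities. -/
def ents {Ω ι κ : Type} (X : Ω → Matrix ι κ ℝ) : Set (Ω → ℝ) :=
  Set.range fun (p : ι × κ) s => X s p.1 p.2

theorem mem_ents {Ω ι κ : Type} (X : Ω → Matrix ι κ ℝ) (i : ι) (j : κ) :
    (fun s => X s i j) ∈ ents X := ⟨(i, j), rfl⟩

theorem ents_subset {Ω ι κ : Type} {X : Ω → Matrix ι κ ℝ} {A : Set (Ω → ℝ)} :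
    ents X ⊆ A ↔ ∀ i j, (fun s => X s i j) ∈ A := by
  constructor
  · exact fun h i j => h (mem_ents X i j)
  · rintro h _ ⟨⟨i, j⟩, rfl⟩
    exact h i j

theorem ents_transpose {Ω ι κ : Type} (X : Ω → Matrix ι κ ℝ) :
    ents (fun s => (X s).transpose) = ents X := by
  apply Set.Subset.antisymm
  · rw [ents_subset]; exact fun i j => mem_ents X j i
  · rw [ents_subset]; exact fun i j => mem_ents (fun s => (X s).transpose) j i

theorem ents_submatrix_subset {Ω ι κ ι' κ' : Type} (X : Ω → Matrix ι κ ℝ) (f : ι' → ι)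
    (g : κ' → κ) : ents (fun s => (X s).submatrix f g) ⊆ ents X := by
  rw [ents_subset]; exact fun i j => mem_ents X (f i) (g j)

/-- Products of matrices of quantities with at most the given dimensions take at most `t` steps. -/
structure MulCost (m k p : ℕ) (t : ℝ) : Prop where
  apply : ∀ {Ω ι κ μ : Type} [Fintype ι] [Fintype κ] [Fintype μ], Fintype.card ι ≤ m →
    Fintype.card κ ≤ k → Fintype.card μ ≤ p → ∀ (D : Set Ω) (A : Set (Ω → ℝ))
    (X : Ω → Matrix ι κ ℝ) (Y : Ω → Matrix κ μ ℝ), ents X ⊆ A → ents Y ⊆ A →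
    Computes D A (ents fun s => X s * Y s) t

namespace MulCost

variable {m k p m' k' p' : ℕ} {t t' : ℝ}

theorem mono (h : MulCost m k p t) (hm : m' ≤ m) (hk : k' ≤ k) (hp : p' ≤ p) (ht : t ≤ t') :
    MulCost m' k' p' t' :=
  ⟨fun h1 h2 h3 D A X Y hX hY =>
    (h.apply (h1.trans hm) (h2.trans hk) (h3.trans hp) D A X Y hX hY).mono_cost ht⟩

theorem nonneg (h : MulCost m k p t) : 0 ≤ t :=
  (h.apply (Ω := Unit) (ι := Empty) (κ := Empty) (μ := Empty) (by simp) (by simp) (by simp) ∅ ∅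
    (fun _ => 0) (fun _ => 0) (by rintro _ ⟨⟨i, _⟩, _⟩; exact i.elim)
    (by rintro _ ⟨⟨i, _⟩, _⟩; exact i.elim)).nonneg

/-- Smaller matrices are padded with zeros. -/
theorem of_exact {I K M : Type} [Fintype I] [Fintype K] [Fintype M]
    (h : ∀ {Ω : Type} (D : Set Ω) (A : Set (Ω → ℝ)) (X : Ω → Matrix I K ℝ) (Y : Ω → Matrix K M ℝ),
      ents X ⊆ A → ents Y ⊆ A → Computes D A (ents fun s => X s * Y s) t) :
    MulCost (Fintype.card I) (Fintype.card K) (Fintype.card M) (t + 1) := by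
  constructor
  intro Ω ι κ μ _ _ _ h1 h2 h3 D A X Y hX hY
  obtain ⟨e1⟩ := Function.Embedding.nonempty_of_card_le h1
  obtain ⟨e2⟩ := Function.Embedding.nonempty_of_card_le h2
  obtain ⟨e3⟩ := Function.Embedding.nonempty_of_card_le h3
  let X' : Ω → Matrix I K ℝ := fun s =>
    Function.extend e1 (fun i => Function.extend e2 (X s i) 0) 0
  let Y' : Ω → Matrix K M ℝ := fun s =>
    Function.extend e2 (fun i => Function.extend e3 (Y s i) 0) 0
  have hX' : ents X' ⊆ A ∪ {fun _ => 0} := by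
    rw [ents_subset]
    intro a b
    by_cases ha : ∃ i, e1 i = a
    · obtain ⟨i, rfl⟩ := ha
      by_cases hb : ∃ j, e2 j = b
      · obtain ⟨j, rfl⟩ := hb
        left
        simpa [X', e1.injective.extend_apply, e2.injective.extend_apply] using hX (mem_ents X i j)
      · right
        simp [X', e1.injective.extend_apply, Function.extend_apply' _ _ _ hb]
    · right
      simp [X', Function.extend_apply' _ _ _ ha]
  have hY' : ents Y' ⊆ A ∪ {fun _ => 0} := by
    rw [ents_subset]
    intro a b
    by_cases ha : ∃ i, e2 i = a
    · obtain ⟨i, rfl⟩ := ha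
      by_cases hb : ∃ j, e3 j = b
      · obtain ⟨j, rfl⟩ := hb
        left
        simpa [Y', e2.injective.extend_apply, e3.injective.extend_apply] using hY (mem_ents Y i j)
      · right
        simp [Y', e2.injective.extend_apply, Function.extend_apply' _ _ _ hb]
    · right
      simp [Y', Function.extend_apply' _ _ _ ha]
  have main := (Computes.one (D := D) (A := A) _ (.const 0)).trans (h D _ X' Y' hX' hY')
  refine (main.mono_right (G := ents fun s => X s * Y s) ?_).mono_cost (by linarith)
  rw [ents_subset]
  intro i l
  convert mem_ents (fun s => X' s * Y' s) (e1 i) (e3 l) using 2 with s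
  rw [Matrix.mul_apply, Matrix.mul_apply]
  refine Fintype.sum_of_injective e2 e2.injective _ _ ?_ ?_
  · intro b hb
    simp [X', e1.injective.extend_apply, Function.extend_apply' _ _ _ hb]
  · intro j
    simp [X', Y', e1.injective.extend_apply, e2.injective.extend_apply,
      e3.injective.extend_apply]

theorem of_matMulIn (h : MatMulIn m k p t) : MulCost m k p (t + 2) := by
  obtain ⟨P, hlen, hP⟩ := h
  have := of_exact (I := Fin m) (K := Fin k) (M := Fin p) (t := t + 1) (by
    intro Ω D A X Y hX hY
    let X' : Matrix (Fin m) (Fin k) (Ω → ℝ) := fun i j s => X s i j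
    let Y' : Matrix (Fin k) (Fin p) (Ω → ℝ) := fun i j s => Y s i j
    have hin : ∀ r, mulInput X' Y' r ∈ A ∪ {fun _ => 0} := by
      rintro (⟨i, j⟩ | ⟨i, j⟩ | ⟨i, j⟩ | l)
      · exact Or.inl (hX (mem_ents X i j))
      · exact Or.inl (hY (mem_ents Y i j))
      · exact Or.inr rfl
      · exact Or.inr rfl
    have main := (Computes.one (D := D) (A := A) _ (.const 0)).trans
      (computes_runIn (D := D) P _ hin)
    refine (main.mono_right ?_).mono_cost (by linarith)
    rw [ents_subset]
    intro i j
    refine ⟨.out i j, ?_⟩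
    funext s
    have e := congrFun (map_runIn (Pi.evalAlgHom ℝ (fun _ : Ω => ℝ) s) P (mulInput X' Y'))
      (.out i j)
    rw [map_mulInput] at e
    have e' := hP (X s) (Y s) i j
    rw [runIn_real, matMulInput_eq] at e'
    rw [← e']
    exact e)
  simpa [add_assoc, one_add_one_eq_two] using this

theorem exists_partition {ι : Type} [Fintype ι] {s m : ℕ} (h : Fintype.card ι ≤ s * m) :
    ∃ c : ι → Fin s, ∀ b, Fintype.card {i // c i = b} ≤ m := by
  obtain ⟨e⟩ := Function.Embedding.nonempty_of_card_le
    (α := ι) (β := Fin s × Fin m) (by simpa using h)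
  refine ⟨fun i => (e i).1, fun b => ?_⟩
  have : Function.Injective fun i : {i // (e i).1 = b} => (e i.1).2 := by
    intro i j hij
    apply Subtype.ext
    apply e.injective
    exact Prod.ext (i.2.trans j.2.symm) hij
  simpa using Fintype.card_le_of_injective _ this

/-- The rows of the left factor fall into `s` groups of at most `m`, each multiplied separately; no
additions are needed. -/
theorem rows (h : MulCost m k p t) (s : ℕ) : MulCost (s * m) k p (s * t) := by
  constructor
  intro Ω ι κ μ _ _ _ h1 h2 h3 D A X Y hX hY
  obtain ⟨c, hc⟩ := exists_partition h1
  have := Computes.iUnion (D := D) (A := A) (ι := Fin s)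
    (fun b => ents fun x => (X x).submatrix (Subtype.val : {i // c i = b} → ι) id * Y x) t
    fun b => h.apply (hc b) h2 h3 D A _ _ ((ents_submatrix_subset _ _ _).trans hX) hY
  rw [Fintype.card_fin] at this
  refine this.mono_right ?_
  rw [ents_subset]
  intro i l
  refine Set.mem_iUnion.2 ⟨c i, ?_⟩
  exact mem_ents (fun x => (X x).submatrix (Subtype.val : {i' // c i' = c i} → ι) id * Y x)
    ⟨i, rfl⟩ l

/-- From `(XY)ᵀ = YᵀXᵀ`: this exchanges the two outer dimensions for free. Moving the inner
dimension outside is the harder transposition principle `MulCost.of_matMulIn_transpose`. -/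
theorem transpose (h : MulCost m k p t) : MulCost p k m t := by
  constructor
  intro Ω ι κ μ _ _ _ h1 h2 h3 D A X Y hX hY
  have := h.apply h3 h2 h1 D A (fun s => (Y s).transpose) (fun s => (X s).transpose)
    (by rwa [ents_transpose]) (by rwa [ents_transpose])
  rw [← ents_transpose] at this
  simpa [Matrix.transpose_mul] using this

theorem cols (h : MulCost m k p t) (s : ℕ) : MulCost m k (s * p) (s * t) :=
  (h.transpose.rows s).transpose

end MulCost

/-- Sums over a finite index set of available families of quantities. -/
theorem Computes.sum_range {Ω ι : Type} [Fintype ι] {D : Set Ω} {A : Set (Ω → ℝ)} {β : Type}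
    (s : Finset β) (q : β → ι → Ω → ℝ) (hq : ∀ b ∈ s, ∀ i, q b i ∈ A) :
    Computes D A (Set.range fun i x => ∑ b ∈ s, q b i x) (1 + s.card * Fintype.card ι) := by
  classical
  induction s using Finset.induction_on with
  | empty =>
    refine ((Computes.one _ (.const 0)).mono_right ?_).mono_cost (by simp)
    rintro _ ⟨i, rfl⟩
    simp
  | insert b s hb ih =>
    have h1 := ih fun b hb => hq b (by simp [hb])
    have h2 := h1.trans (Computes.range_one (D := D) (fun i x => ∑ b ∈ insert b s, q b i x) (by
      intro i
      have : (fun x => ∑ b ∈ insert b s, q b i x) = q b i + fun x => ∑ b ∈ s, q b i x := by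
        funext x; simp [Finset.sum_insert hb]
      rw [this]
      exact .add (Or.inl (hq b (by simp) i)) (Or.inr ⟨i, rfl⟩)))
    refine h2.mono_cost ?_
    rw [Finset.card_insert_of_notMem hb]
    push_cast
    linarith

/-- Sums of available families of quantities. -/
theorem Computes.sum_ents {Ω ι κ β : Type} [Fintype ι] [Fintype κ] [Fintype β] {D : Set Ω}
    {A : Set (Ω → ℝ)} (Z : β → Ω → Matrix ι κ ℝ) (hZ : ∀ b, ents (Z b) ⊆ A) :
    Computes D A (ents fun x => ∑ b, Z b x)
      (1 + Fintype.card β * (Fintype.card ι * Fintype.card κ)) := by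
  have := Computes.sum_range (D := D) (A := A) Finset.univ
    (fun b (p : ι × κ) x => Z b x p.1 p.2) (fun b _ p => hZ b (mem_ents _ p.1 p.2))
  simp only [Finset.card_univ, Fintype.card_prod, Nat.cast_mul] at this
  have e : (ents fun x => ∑ b, Z b x) =
      Set.range fun (p : ι × κ) x => ∑ b, Z b x p.1 p.2 := by
    unfold ents
    congr 1
    funext p x
    simp [Matrix.sum_apply]
  rwa [e]

namespace MulCost

variable {m k p m' k' p' : ℕ} {t t' : ℝ}

/-- The inner dimension is cut into `s` slabs; the `s` partial products then have to be added, which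
accounts for the terms `m * p`. -/
theorem inner (h : MulCost m k p t) (s : ℕ) : MulCost m (s * k) p (s * (t + m * p) + 1) := by
  constructor
  intro Ω ι κ μ _ _ _ h1 h2 h3 D A X Y hX hY
  classical
  obtain ⟨c, hc⟩ := exists_partition h2
  let Z : Fin s → Ω → Matrix ι μ ℝ := fun b x =>
    (X x).submatrix id (Subtype.val : {i // c i = b} → κ) *
      (Y x).submatrix (Subtype.val : {i // c i = b} → κ) id
  have h4 := Computes.iUnion (D := D) (A := A) (ι := Fin s) (fun b => ents (Z b)) t
    fun b => h.apply h1 (hc b) h3 D A _ _ ((ents_submatrix_subset _ _ _).trans hX)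
      ((ents_submatrix_subset _ _ _).trans hY)
  have h5 := h4.trans (Computes.sum_ents Z fun b =>
    (Set.subset_iUnion (fun b => ents (Z b)) b).trans Set.subset_union_right)
  have e : (fun x => ∑ b, Z b x) = fun x => X x * Y x := by
    funext x
    ext i l
    simp only [Z, Matrix.sum_apply, Matrix.mul_apply, Matrix.submatrix_apply, id]
    exact Fintype.sum_fiberwise c fun j => X x i j * Y x j l
  rw [e] at h5
  refine h5.mono_cost ?_
  rw [Fintype.card_fin]
  have h6 : (Fintype.card ι : ℝ) * Fintype.card μ ≤ m * p := by
    gcongr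
  have h7 : (s : ℝ) * (Fintype.card ι * Fintype.card μ) ≤ s * (m * p) := by gcongr
  linarith

theorem one_one_one : MulCost 1 1 1 1 := by
  constructor
  intro Ω ι κ μ _ _ _ h1 h2 h3 D A X Y hX hY
  rcases isEmpty_or_nonempty κ with hκ | ⟨⟨j⟩⟩
  · refine (Computes.one (D := D) _ (.const 0)).mono_right ?_
    rw [ents_subset]
    intro i l
    simp [Matrix.mul_apply]
  have hj : ∀ j', j' = j := fun j' => (Fintype.card_le_one_iff.1 h2) _ _
  rcases isEmpty_or_nonempty ι with hι | ⟨⟨i⟩⟩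
  · exact (Computes.of_subset (by rw [ents_subset]; exact fun i => hι.elim i)).mono_cost zero_le_one
  rcases isEmpty_or_nonempty μ with hμ | ⟨⟨l⟩⟩
  · exact (Computes.of_subset (by rw [ents_subset]; exact fun _ i => hμ.elim i)).mono_cost
      zero_le_one
  refine (Computes.one (D := D) _ (.mul (hX (mem_ents X i j)) (hY (mem_ents Y j l)))).mono_right ?_
  rw [ents_subset]
  intro i' l'
  rw [Fintype.card_le_one_iff.1 h1 i' i, Fintype.card_le_one_iff.1 h3 l' l]
  simp only [Set.mem_singleton_iff]
  funext x
  rw [Matrix.mul_apply, Fintype.sum_eq_single j fun j' h => (h (hj j')).elim]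
  rfl

/-- The schoolbook algorithm. -/
theorem naive (m k p : ℕ) : MulCost m k p (2 * (m * k * p) + m * p) := by
  have := (((one_one_one.inner k).rows m).cols p)
  simp only [mul_one] at this
  refine this.mono le_rfl le_rfl le_rfl ?_
  push_cast
  ring_nf
  rfl

end MulCost

/-! ### Lower bounds for matrix products -/

/-- The register written by an instruction. -/
def RingInstr.dst {ρ : Type} : RingInstr ρ → ρ
  | .const dst _ => dst
  | .copy dst _ => dst
  | .add dst _ _ => dst
  | .sub dst _ _ => dst
  | .mul dst _ _ => dst

theorem foldl_exec_of_not_mem {ρ : Type} [DecidableEq ρ] (P : List (RingInstr ρ)) (s : ρ → ℝ)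
    (r : ρ) (h : r ∉ P.map RingInstr.dst) : P.foldl (fun s I => I.exec s) s r = s r := by
  induction P generalizing s with
  | nil => rfl
  | cons I P ih =>
    simp only [List.map_cons, List.mem_cons, not_or] at h
    rw [List.foldl_cons, ih _ h.2]
    have h1 := h.1
    cases I <;> exact Function.update_of_ne h1 _ _

/-- Every entry of the product has to be written. -/
theorem MatMulIn.le {m k p : ℕ} {t : ℝ} (hk : 1 ≤ k) (h : MatMulIn m k p t) :
    (m * p : ℝ) ≤ t := by
  obtain ⟨P, hlen, hP⟩ := h
  refine le_trans ?_ hlen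
  have hmem : ∀ q : Fin m × Fin p, MatMulReg.out (k := k) q.1 q.2 ∈ P.map RingInstr.dst := by
    rintro ⟨i, j⟩
    by_contra hc
    -- All entries of this product equal `k ≠ 0`, whereas an output register that is never written
    -- still holds its initial zero.
    have := hP (Matrix.of fun _ _ => 1) (Matrix.of fun _ _ => 1) i j
    rw [foldl_exec_of_not_mem P _ _ hc, Matrix.mul_apply] at this
    simp only [matMulInput, Matrix.of_apply, mul_one, Finset.sum_const, Finset.card_univ, Fintype.card_fin,
      nsmul_eq_mul] at this
    have : k = 0 := by exact_mod_cast this.symm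
    omega
  have hinj : Function.Injective fun q : Fin m × Fin p => MatMulReg.out (k := k) q.1 q.2 := by
    rintro ⟨i, j⟩ ⟨i', j'⟩ e
    simpa using e
  have h1 : (Finset.univ.image fun q : Fin m × Fin p => MatMulReg.out (k := k) q.1 q.2) ⊆
      (P.map RingInstr.dst).toFinset := by
    intro r hr
    obtain ⟨q, -, rfl⟩ := Finset.mem_image.1 hr
    exact List.mem_toFinset.2 (hmem q)
  have h2 := (Finset.card_le_card h1).trans (List.toFinset_card_le _)
  rw [Finset.card_image_of_injective _ hinj] at h2
  simp only [Finset.card_univ, Fintype.card_prod, Fintype.card_fin, List.length_map] at h2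
  exact_mod_cast h2

end ProjMaint


namespace ProjMaint

/-! ### Transposition -/

/-- A straight-line program multiplying real matrices multiplies matrices over every commutative
`ℝ`-algebra. -/
theorem runIn_mulInput {m k p : ℕ} {P : List (RingInstr (MatMulReg m k p))}
    (hP : ∀ (X : Matrix (Fin m) (Fin k) ℝ) (Y : Matrix (Fin k) (Fin p) ℝ) (i : Fin m) (j : Fin p),
      (P.foldl (fun s I => I.exec s) (matMulInput X Y)) (.out i j) = (X * Y) i j)
    {R : Type*} [CommRing R] [Algebra ℝ R] (X : Matrix (Fin m) (Fin k) R)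
    (Y : Matrix (Fin k) (Fin p) R) (i : Fin m) (j : Fin p) :
    runIn P (mulInput X Y) (.out i j) = (X * Y) i j := by
  let σ := (Fin m × Fin k) ⊕ (Fin k × Fin p)
  let GX : Matrix (Fin m) (Fin k) (MvPolynomial σ ℝ) :=
    Matrix.of fun i j => MvPolynomial.X (Sum.inl (i, j))
  let GY : Matrix (Fin k) (Fin p) (MvPolynomial σ ℝ) :=
    Matrix.of fun i j => MvPolynomial.X (Sum.inr (i, j))
  -- Correctness at all real points is an identity of polynomials in the entries, since a polynomial
  -- over an infinite field is determined by its values. It then specializes to every algebra.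
  have gen : runIn P (mulInput GX GY) (.out i j) = (GX * GY) i j := by
    apply MvPolynomial.funext
    intro x
    have e := congrFun (map_runIn (MvPolynomial.aeval x : MvPolynomial σ ℝ →ₐ[ℝ] ℝ) P
      (mulInput GX GY)) (.out i j)
    rw [map_mulInput, ← runIn_real, ← matMulInput_eq, hP] at e
    have e2 : (GX.map (MvPolynomial.aeval x : MvPolynomial σ ℝ →ₐ[ℝ] ℝ) *
        GY.map (MvPolynomial.aeval x : MvPolynomial σ ℝ →ₐ[ℝ] ℝ)) i j =
        (MvPolynomial.aeval x : MvPolynomial σ ℝ →ₐ[ℝ] ℝ) ((GX * GY) i j) := by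
      simp [Matrix.mul_apply]
    rw [e2] at e
    exact e
  let x : σ → R := Sum.elim (fun q => X q.1 q.2) (fun q => Y q.1 q.2)
  have e := congrFun (map_runIn (MvPolynomial.aeval x : MvPolynomial σ ℝ →ₐ[ℝ] R) P
      (mulInput GX GY)) (.out i j)
  have eX : GX.map (MvPolynomial.aeval x : MvPolynomial σ ℝ →ₐ[ℝ] R) = X := by
    ext i j; simp [GX, x]
  have eY : GY.map (MvPolynomial.aeval x : MvPolynomial σ ℝ →ₐ[ℝ] R) = Y := by
    ext i j; simp [GY, x]
  rw [map_mulInput, eX, eY] at e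
  rw [← e, gen]
  simp [Matrix.mul_apply, GX, GY, x]

section Adjoint

variable {ρ : Type} [DecidableEq ρ] {R : Type*} [CommRing R]

/-- Adding `g` to the register `x`. -/
def accum (l : ρ → R) (x : ρ) (g : R) : ρ → R := Function.update l x (l x + g)

/-- The derivative of an instruction. -/
def RingInstr.tangent (I : RingInstr ρ) (st v : ρ → R) : ρ → R :=
  match I with
  | .const dst _ => Function.update v dst 0
  | .copy dst x => Function.update v dst (v x)
  | .add dst x y => Function.update v dst (v x + v y)
  | .sub dst x y => Function.update v dst (v x - v y)
  | .mul dst x y => Function.update v dst (st x * v y + st y * v x)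

/-- The adjoint of the derivative of an instruction. -/
def RingInstr.adjoint (I : RingInstr ρ) (st l : ρ → R) : ρ → R :=
  match I with
  | .const dst _ => Function.update l dst 0
  | .copy dst x => accum (Function.update l dst 0) x (l dst)
  | .add dst x y => accum (accum (Function.update l dst 0) x (l dst)) y (l dst)
  | .sub dst x y => accum (accum (Function.update l dst 0) x (l dst)) y (0 - l dst)
  | .mul dst x y => accum (accum (Function.update l dst 0) x (st y * l dst)) y (st x * l dst)

/-- The registers used by an instruction. -/
def RingInstr.regs : RingInstr ρ → Finset ρ
  | .const dst _ => {dst}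
  | .copy dst x => {dst, x}
  | .add dst x y => {dst, x, y}
  | .sub dst x y => {dst, x, y}
  | .mul dst x y => {dst, x, y}

theorem sum_update_mul (F : Finset ρ) (l v : ρ → R) {x : ρ} (hx : x ∈ F) (b : R) :
    ∑ r ∈ F, Function.update l x b r * v r = ∑ r ∈ F, l r * v r + (b - l x) * v x := by
  rw [← Finset.add_sum_erase F _ hx, ← Finset.add_sum_erase F (fun r => l r * v r) hx]
  rw [Finset.sum_congr rfl fun r hr => by
    rw [Function.update_of_ne (Finset.ne_of_mem_erase hr)]]
  rw [Function.update_self]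
  ring

theorem sum_accum_mul (F : Finset ρ) (l v : ρ → R) {x : ρ} (hx : x ∈ F) (g : R) :
    ∑ r ∈ F, accum l x g r * v r = ∑ r ∈ F, l r * v r + g * v x := by
  rw [accum, sum_update_mul F l v hx, add_sub_cancel_left]

/-- One step of reverse-mode differentiation. The weight of `dst` is cleared before its old value is
passed on to the operands, so the identity also holds when `dst` is one of them or when the operands
coincide. -/
theorem RingInstr.sum_adjoint (I : RingInstr ρ) (F : Finset ρ) (hF : I.regs ⊆ F)
    (st l v : ρ → R) :
    ∑ r ∈ F, I.adjoint st l r * v r = ∑ r ∈ F, l r * I.tangent st v r := by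
  have h2 : ∀ {x : ρ} (_ : x ∈ F) (b : R), ∑ r ∈ F, l r * Function.update v x b r =
      ∑ r ∈ F, l r * v r + l x * (b - v x) := by
    intro x hx b
    have := sum_update_mul F v l hx b
    simp only [mul_comm (l _)]
    exact this
  cases I with
  | const dst c =>
    simp only [regs, Finset.singleton_subset_iff] at hF
    simp only [adjoint, tangent, sum_update_mul F _ _ hF, h2 hF]
    ring
  | copy dst x =>
    simp only [regs, Finset.insert_subset_iff, Finset.singleton_subset_iff] at hF
    simp only [adjoint, tangent, sum_accum_mul F _ _ hF.2, sum_update_mul F _ _ hF.1, h2 hF.1]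
    ring
  | add dst x y =>
    simp only [regs, Finset.insert_subset_iff, Finset.singleton_subset_iff] at hF
    simp only [adjoint, tangent, sum_accum_mul F _ _ hF.2.1, sum_accum_mul F _ _ hF.2.2,
      sum_update_mul F _ _ hF.1, h2 hF.1]
    ring
  | sub dst x y =>
    simp only [regs, Finset.insert_subset_iff, Finset.singleton_subset_iff] at hF
    simp only [adjoint, tangent, sum_accum_mul F _ _ hF.2.1, sum_accum_mul F _ _ hF.2.2,
      sum_update_mul F _ _ hF.1, h2 hF.1]
    ring
  | mul dst x y =>
    simp only [regs, Finset.insert_subset_iff, Finset.singleton_subset_iff] at hF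
    simp only [adjoint, tangent, sum_accum_mul F _ _ hF.2.1, sum_accum_mul F _ _ hF.2.2,
      sum_update_mul F _ _ hF.1, h2 hF.1]
    ring

variable [Algebra ℝ R]

/-- The derivative of a straight-line program. -/
def tangent : List (RingInstr ρ) → (ρ → R) → (ρ → R) → (ρ → R)
  | [], _, v => v
  | I :: P, st, v => tangent P (I.execIn st) (I.tangent st v)

/-- The adjoint of the derivative of a straight-line program. -/
def adjoint : List (RingInstr ρ) → (ρ → R) → (ρ → R) → (ρ → R)
  | [], _, l => l
  | I :: P, st, l => I.adjoint st (adjoint P (I.execIn st) l)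

theorem sum_adjoint (P : List (RingInstr ρ)) (F : Finset ρ) (hF : ∀ I ∈ P, I.regs ⊆ F)
    (st l v : ρ → R) :
    ∑ r ∈ F, adjoint P st l r * v r = ∑ r ∈ F, l r * tangent P st v r := by
  induction P generalizing st v with
  | nil => rfl
  | cons I P ih =>
    rw [adjoint, tangent, I.sum_adjoint F (hF I (by simp)), ih fun J hJ => hF J (by simp [hJ])]

/-- Running over dual numbers is forward-mode differentiation: the nilpotent part obeys the product
rule. -/
theorem runIn_dualNumber (P : List (RingInstr ρ)) (S : ρ → DualNumber R) :
    (∀ r, (runIn P S r).fst = runIn P (fun r => (S r).fst) r) ∧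
      ∀ r, (runIn P S r).snd = tangent P (fun r => (S r).fst) (fun r => (S r).snd) r := by
  induction P generalizing S with
  | nil => exact ⟨fun _ => rfl, fun _ => rfl⟩
  | cons I P ih =>
    have h1 : (fun r => (I.execIn S r).fst) = I.execIn fun r => (S r).fst := by
      cases I <;> funext r <;> simp only [RingInstr.execIn, Function.update_apply] <;>
        split_ifs <;> simp [TrivSqZeroExt.algebraMap_eq_inl']
    have h2 : (fun r => (I.execIn S r).snd) =
        I.tangent (fun r => (S r).fst) fun r => (S r).snd := by
      cases I <;> funext r <;>
        simp only [RingInstr.execIn, RingInstr.tangent, Function.update_apply] <;>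
        split_ifs <;> simp [TrivSqZeroExt.algebraMap_eq_inl', mul_comm]
    have := ih (I.execIn S)
    rw [h1, h2] at this
    exact this

end Adjoint

section AdjointComputes

variable {Ω ρ : Type} [DecidableEq ρ] {D : Set Ω} {A : Set (Ω → ℝ)}

theorem update_mem {l : ρ → Ω → ℝ} {q : Ω → ℝ} (hl : ∀ r, l r ∈ A) (hq : q ∈ A) (x : ρ) (r : ρ) :
    Function.update l x q r ∈ A := by
  rw [Function.update_apply]
  split_ifs
  exacts [hq, hl r]

theorem computes_accum {l : ρ → Ω → ℝ} {g : Ω → ℝ} (hl : ∀ r, l r ∈ A) (hg : g ∈ A) (x : ρ) :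
    Computes D A (Set.range (accum l x g)) 1 := by
  refine (Computes.step (l x + g) (.add (hl x) hg) (.of_subset ?_)).mono_cost (zero_add 1).le
  rintro _ ⟨r, rfl⟩
  exact update_mem (fun r => Set.mem_insert_of_mem _ (hl r)) (Set.mem_insert _ _) x r

theorem computes_accum₂ {l : ρ → Ω → ℝ} {g g' : Ω → ℝ} (hl : ∀ r, l r ∈ A) (hg : g ∈ A)
    (hg' : g' ∈ A) (x y : ρ) :
    Computes D A (Set.range (accum (accum l x g) y g')) 2 :=
  ((computes_accum hl hg x).trans (computes_accum (fun r => Or.inr ⟨r, rfl⟩) (Or.inl hg')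
    y)).mono_cost (by norm_num)

theorem RingInstr.computes_adjoint (I : RingInstr ρ) {st l : ρ → Ω → ℝ} (h0 : 0 ∈ A)
    (hst : ∀ r, st r ∈ A) (hl : ∀ r, l r ∈ A) :
    Computes D A (Set.range (I.adjoint st l)) 4 := by
  have hu : ∀ dst r, Function.update l dst 0 r ∈ A := fun dst r => update_mem hl h0 dst r
  cases I with
  | const dst c =>
    refine (Computes.of_subset ?_).mono_cost (by norm_num)
    rintro _ ⟨r, rfl⟩
    exact hu dst r
  | copy dst x => exact (computes_accum (hu dst) (hl dst) x).mono_cost (by norm_num)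
  | add dst x y => exact (computes_accum₂ (hu dst) (hl dst) (hl dst) x y).mono_cost (by norm_num)
  | sub dst x y =>
    refine (Computes.step (0 - l dst) (.sub h0 (hl dst)) ?_).mono_cost (c := 2 + 1) (by norm_num)
    exact computes_accum₂ (fun r => Or.inr (hu dst r)) (Or.inr (hl dst)) (Or.inl rfl) x y
  | mul dst x y =>
    refine (Computes.step (st y * l dst) (.mul (hst y) (hl dst))
      (Computes.step (st x * l dst) (.mul (Or.inr (hst x)) (Or.inr (hl dst))) ?_)).mono_cost
      (c := 2 + 1 + 1) (by norm_num)
    exact computes_accum₂ (fun r => Or.inr (Or.inr (hu dst r))) (Or.inr (Or.inl rfl))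
      (Or.inl rfl) x y

/-- Per instruction, one step replays the forward run and four pass the weights back. -/
theorem computes_adjoint (P : List (RingInstr ρ)) {st l : ρ → Ω → ℝ} (h0 : 0 ∈ A)
    (hst : ∀ r, st r ∈ A) (hl : ∀ r, l r ∈ A) :
    Computes D A (Set.range (adjoint P st l)) (5 * P.length) := by
  induction P generalizing A st with
  | nil =>
    refine (Computes.of_subset ?_).mono_cost (by simp)
    rintro _ ⟨r, rfl⟩
    exact hl r
  | cons I P ih =>
    obtain ⟨q, hq, hst'⟩ := I.computes_execIn (D := D) st hst
    have h1 := ih (A := A ∪ {q}) (Or.inl h0) (st := I.execIn st) (by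
      intro r; simpa [or_comm] using hst' r) (fun r => Or.inl (hl r))
    have h2 := h1.trans (I.computes_adjoint (D := D) (st := st)
      (l := adjoint P (I.execIn st) l) (Or.inl (Or.inl h0)) (fun r => Or.inl (Or.inl (hst r)))
      (fun r => Or.inr ⟨r, rfl⟩))
    refine (hq.trans h2).mono_cost ?_
    rw [List.length_cons]
    push_cast
    linarith

end AdjointComputes

/-- The transposition principle for matrix products: a program for `m × k` by `k × p` products
yields one for `m × p` by `p × k` products. -/
theorem MulCost.of_matMulIn_transpose {m k p : ℕ} {t : ℝ} (h : MatMulIn m k p t) :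
    MulCost m p k (5 * t + 2) := by
  classical
  obtain ⟨P, hlen, hP⟩ := h
  have := MulCost.of_exact (I := Fin m) (K := Fin p) (M := Fin k) (t := 5 * t + 1) (by
    intro Ω D A W Z hW hZ
    let Y' : Matrix (Fin k) (Fin p) (Ω → ℝ) := fun i j s => Z s j i
    -- With `Y' = Zᵀ`, the entries of `W Z` are the partial derivatives of `∑ W i j * (X Y') i j`
    -- with respect to the entries of `X`. This form is linear in `X`, so the derivative may be
    -- taken at `X = 0`; the weights `l` are the entries of `W` at the outputs.
    let st : MatMulReg m k p → Ω → ℝ := mulInput 0 Y'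
    let l : MatMulReg m k p → Ω → ℝ := fun r => match r with
      | .out i j => fun s => W s i j
      | _ => 0
    have hst : ∀ r, st r ∈ A ∪ {fun _ => 0} := by
      rintro (⟨i, j⟩ | ⟨i, j⟩ | ⟨i, j⟩ | l)
      · exact Or.inr rfl
      · exact Or.inl (hZ (mem_ents Z j i))
      · exact Or.inr rfl
      · exact Or.inr rfl
    have hl : ∀ r, l r ∈ A ∪ {fun _ => 0} := by
      rintro (⟨i, j⟩ | ⟨i, j⟩ | ⟨i, j⟩ | l)
      · exact Or.inr rfl
      · exact Or.inr rfl
      · exact Or.inl (hW (mem_ents W i j))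
      · exact Or.inr rfl
    have main := (Computes.one (D := D) (A := A) _ (.const 0)).trans
      (computes_adjoint (D := D) P (Or.inr rfl) hst hl)
    refine (main.mono_right ?_).mono_cost (by linarith)
    rw [ents_subset]
    intro i0 k0
    refine ⟨.left i0 k0, ?_⟩
    -- The direction that varies only the entry `(i0, k0)` of the left factor.
    let v : MatMulReg m k p → Ω → ℝ := fun r => if r = .left i0 k0 then 1 else 0
    let outs : Finset (MatMulReg m k p) :=
      Finset.univ.image fun q : Fin m × Fin p => MatMulReg.out q.1 q.2
    -- There are infinitely many registers; the pairing is summed over a finite set containing all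
    -- that matter.
    let F : Finset (MatMulReg m k p) := insert (.left i0 k0) (outs ∪ P.toFinset.biUnion
      RingInstr.regs)
    have hF : ∀ I ∈ P, I.regs ⊆ F := by
      intro I hI r hr
      refine Finset.mem_insert_of_mem (Finset.mem_union_right _ ?_)
      exact Finset.mem_biUnion.2 ⟨I, List.mem_toFinset.2 hI, hr⟩
    have hsum := sum_adjoint P F hF st l v
    have e1 : ∑ r ∈ F, adjoint P st l r * v r = adjoint P st l (.left i0 k0) := by
      rw [Finset.sum_eq_single_of_mem (MatMulReg.left i0 k0) (by simp [F])]
      · simp [v]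
      · intro r _ hr
        simp [v, hr]
    have e2 : ∑ r ∈ F, l r * tangent P st v r =
        ∑ q : Fin m × Fin p, l (.out q.1 q.2) * tangent P st v (.out q.1 q.2) := by
      have hinj : Function.Injective
          fun q : Fin m × Fin p => MatMulReg.out (k := k) q.1 q.2 := by
        rintro ⟨i, j⟩ ⟨i', j'⟩ e
        simpa using e
      rw [← Finset.sum_image (s := Finset.univ) (f := fun r => l r * tangent P st v r)
        (g := fun q : Fin m × Fin p => MatMulReg.out (k := k) q.1 q.2) hinj.injOn]
      symm
      refine Finset.sum_subset (fun r hr => Finset.mem_insert_of_mem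
        (Finset.mem_union_left _ hr)) ?_
      intro r _ hr
      have : l r = 0 := by
        rcases r with ⟨i, j⟩ | ⟨i, j⟩ | ⟨i, j⟩ | l
        · rfl
        · rfl
        · exact (hr (Finset.mem_image.2 ⟨(i, j), Finset.mem_univ _, rfl⟩)).elim
        · rfl
      rw [this, zero_mul]
    let SX : Matrix (Fin m) (Fin k) (DualNumber (Ω → ℝ)) :=
      Matrix.of fun i j => TrivSqZeroExt.inr (v (.left i j))
    let SY : Matrix (Fin k) (Fin p) (DualNumber (Ω → ℝ)) :=
      Matrix.of fun i j => TrivSqZeroExt.inl (Y' i j)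
    have d1 : (fun r => (mulInput SX SY r).fst) = st := by
      funext r; cases r <;> rfl
    have d2 : (fun r => (mulInput SX SY r).snd) = v := by
      funext r
      cases r with
      | left i j => rfl
      | right i j => exact (if_neg (by simp)).symm
      | out i j => exact (if_neg (by simp)).symm
      | work l => exact (if_neg (by simp)).symm
    have e3 : ∀ i j, tangent P st v (.out i j) = if i = i0 then Y' k0 j else 0 := by
      intro i j
      have := (runIn_dualNumber P (mulInput SX SY)).2 (.out i j)
      rw [d1, d2] at this
      have hm : ∀ a b : Ω → ℝ, (TrivSqZeroExt.inr a * TrivSqZeroExt.inl b :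
          DualNumber (Ω → ℝ)).snd = a * b := by
        intro a b; simp [TrivSqZeroExt.snd_mul, mul_comm]
      rw [← this, runIn_mulInput hP, Matrix.mul_apply, TrivSqZeroExt.snd_sum]
      simp only [SX, SY, Matrix.of_apply, hm]
      by_cases hi : i = i0
      · subst hi
        simp [v]
      · simp [v, hi]
    rw [e1, e2] at hsum
    rw [hsum]
    funext s
    rw [Finset.sum_apply, Fintype.sum_prod_type, Fintype.sum_eq_single i0]
    · simp only [e3]
      simp [l, Y', Matrix.mul_apply]
    · intro i hi
      simp only [e3]
      simp [hi])
  simpa [add_assoc, one_add_one_eq_two] using this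

end ProjMaint


namespace ProjMaint

/-! ### Block products

A straight-line program for square products is run on matrices of blocks.  Every register then
holds a scalar, a linear combination of the blocks of each factor and a combination of products of
blocks, which are the components of degree at most one in each factor. -/

/-- The components of degree at most one in each factor. -/
structure Blocks (Ω ι κ : Type) where
  scal : ℝ
  left : Ω → Matrix ι κ ℝ
  right : Ω → Matrix κ ι ℝ
  prod : Ω → Matrix ι ι ℝ

namespace Blocks

variable {Ω ι κ : Type}

/-- The constant `c`. -/
def const (c : ℝ) : Blocks Ω ι κ := ⟨c, 0, 0, 0⟩

/-- The combination `a x + b y`. -/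
def comb (a b : ℝ) (x y : Blocks Ω ι κ) : Blocks Ω ι κ :=
  ⟨a * x.scal + b * y.scal, fun s => a • x.left s + b • y.left s,
    fun s => a • x.right s + b • y.right s, fun s => a • x.prod s + b • y.prod s⟩

/-- The truncated product; the blocks of the first factor are kept on the left. -/
def mul [Fintype κ] (x y : Blocks Ω ι κ) : Blocks Ω ι κ :=
  ⟨x.scal * y.scal, fun s => x.scal • y.left s + y.scal • x.left s,
    fun s => x.scal • y.right s + y.scal • x.right s,
    fun s => x.scal • y.prod s + y.scal • x.prod s +
      (x.left s * y.right s + y.left s * x.right s)⟩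

/-- The quantities in the registers. -/
def ents (x : Blocks Ω ι κ) : Set (Ω → ℝ) :=
  ProjMaint.ents x.left ∪ ProjMaint.ents x.right ∪ ProjMaint.ents x.prod

/-- `x` represents the family `S` of scalar computations in the entries of the blocks. -/
def Rep [Fintype κ] (s : Ω) (i j : ι) (x : Blocks Ω ι κ)
    (S : κ → DualNumber (DualNumber ℝ)) : Prop :=
  (∀ e, (S e).fst.fst = x.scal) ∧ (∀ e, (S e).fst.snd = x.left s i e) ∧
    (∀ e, (S e).snd.fst = x.right s e j) ∧ ∑ e, (S e).snd.snd = x.prod s i j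

variable [Fintype κ] {s : Ω} {i j : ι}

theorem Rep.const (c : ℝ) : Rep s i j (Blocks.const c : Blocks Ω ι κ)
    (fun _ => algebraMap ℝ _ c) := by
  refine ⟨fun e => ?_, fun e => ?_, fun e => ?_, ?_⟩ <;>
    simp [Blocks.const, TrivSqZeroExt.algebraMap_eq_inl']

theorem Rep.comb {a b : ℝ} {x y : Blocks Ω ι κ} {S T : κ → DualNumber (DualNumber ℝ)}
    (hx : Rep s i j x S) (hy : Rep s i j y T) :
    Rep s i j (Blocks.comb a b x y) (fun e => a • S e + b • T e) := by
  obtain ⟨h1, h2, h3, h4⟩ := hx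
  obtain ⟨k1, k2, k3, k4⟩ := hy
  refine ⟨fun e => ?_, fun e => ?_, fun e => ?_, ?_⟩
  · simp [Blocks.comb, h1, k1]
  · simp [Blocks.comb, h2, k2]
  · simp [Blocks.comb, h3, k3]
  · simp [Blocks.comb, ← h4, ← k4, Finset.sum_add_distrib, Finset.mul_sum]

/-- The coefficient of both nilpotents has two cross terms. In the second the right part of `x`
meets the left part of `y`; its entries are commuting scalars, so it can be read as the matrix
product `y.left * x.right`. -/
theorem Rep.mul {x y : Blocks Ω ι κ} {S T : κ → DualNumber (DualNumber ℝ)}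
    (hx : Rep s i j x S) (hy : Rep s i j y T) :
    Rep s i j (Blocks.mul x y) (fun e => S e * T e) := by
  obtain ⟨h1, h2, h3, h4⟩ := hx
  obtain ⟨k1, k2, k3, k4⟩ := hy
  refine ⟨fun e => ?_, fun e => ?_, fun e => ?_, ?_⟩
  · simp [Blocks.mul, h1, k1]
  · simp [Blocks.mul, TrivSqZeroExt.fst_mul, TrivSqZeroExt.snd_mul, h1, k1, h2, k2, mul_comm]
  · simp [Blocks.mul, TrivSqZeroExt.fst_mul, TrivSqZeroExt.snd_mul, h1, k1, h3, k3, mul_comm]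
  · simp only [Blocks.mul, TrivSqZeroExt.snd_mul, Matrix.add_apply,
      Matrix.smul_apply, ← h4, ← k4, Matrix.mul_apply, smul_eq_mul, Finset.mul_sum,
      ← Finset.sum_add_distrib, TrivSqZeroExt.snd_add, MulOpposite.smul_eq_mul_unop,
      MulOpposite.unop_op, h1, k1, h2, k2, h3, k3]
    refine Finset.sum_congr rfl fun e _ => ?_
    ring

end Blocks

section BlockRun

variable {Ω ι κ ρ : Type} [DecidableEq ρ] [Fintype κ]

/-- An instruction on blocks. -/
noncomputable def RingInstr.execBlocks (I : RingInstr ρ) (st : ρ → Blocks Ω ι κ) :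
    ρ → Blocks Ω ι κ :=
  match I with
  | .const dst c => Function.update st dst (.const c)
  | .copy dst x => Function.update st dst (st x)
  | .add dst x y => Function.update st dst (.comb 1 1 (st x) (st y))
  | .sub dst x y => Function.update st dst (.comb 1 (-1) (st x) (st y))
  | .mul dst x y => Function.update st dst (.mul (st x) (st y))

/-- A straight-line program on blocks. -/
noncomputable def runBlocks (P : List (RingInstr ρ)) (st : ρ → Blocks Ω ι κ) :
    ρ → Blocks Ω ι κ :=
  P.foldl (fun s I => I.execBlocks s) st

/-- The given program need not be bilinear and assumes commuting entries, so it cannot be run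
naively on matrices. Keeping only degrees at most one in each factor makes the run on blocks track
one commutative run per inner index `e`. -/
theorem rep_runBlocks {s : Ω} {i j : ι} (P : List (RingInstr ρ)) (st : ρ → Blocks Ω ι κ)
    (S : κ → ρ → DualNumber (DualNumber ℝ)) (h : ∀ r, (st r).Rep s i j fun e => S e r) (r : ρ) :
    (runBlocks P st r).Rep s i j fun e => runIn P (S e) r := by
  induction P generalizing st S with
  | nil => exact h r
  | cons I P ih =>
    refine ih (I.execBlocks st) (fun e => I.execIn (S e)) fun r => ?_
    have key : ∀ dst (x : Blocks Ω ι κ) (T : κ → DualNumber (DualNumber ℝ)), x.Rep s i j T →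
        (Function.update st dst x r).Rep s i j fun e => Function.update (S e) dst (T e) r := by
      intro dst x T hx
      by_cases hr : r = dst
      · subst hr
        simpa using hx
      · simpa [hr] using h r
    cases I with
    | const dst c => exact key dst _ _ (.const c)
    | copy dst x => exact key dst _ _ (h x)
    | add dst x y =>
      have := key dst _ _ ((h x).comb (a := 1) (b := 1) (h y))
      simp only [one_smul] at this
      exact this
    | sub dst x y =>
      have := key dst _ _ ((h x).comb (a := 1) (b := -1) (h y))
      simp only [one_smul, neg_smul, ← sub_eq_add_neg] at this
      exact this
    | mul dst x y => exact key dst _ _ ((h x).mul (h y))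

end BlockRun

theorem Computes.comb {Ω : Type} {D : Set Ω} {A : Set (Ω → ℝ)} (a b : ℝ) {x y : Ω → ℝ}
    (hx : x ∈ A) (hy : y ∈ A) :
    Computes D A {fun s => a * x s + b * y s} 5 := by
  refine Computes.mono_cost (c := 0 + 1 + 1 + 1 + 1 + 1) ?_ (by norm_num)
  refine .step _ (.const a) (.step _ (.const b) (.step ((fun _ => a) * x) (.mul ?_ ?_)
    (.step ((fun _ => b) * y) (.mul ?_ ?_)
    (.step ((fun _ => a) * x + (fun _ => b) * y) (.add ?_ ?_) (.of_subset ?_)))))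
  all_goals first | (rintro _ rfl; exact Or.inl rfl) | simp [hx, hy]

section BlockComputes

variable {Ω ι κ μ : Type} [Fintype ι] [Fintype κ] [Fintype μ] {D : Set Ω} {A : Set (Ω → ℝ)}

theorem Computes.ents_of_entry {Z : Ω → Matrix ι κ ℝ} {t : ℝ}
    (h : ∀ i j, Computes D A {fun s => Z s i j} t) :
    Computes D A (ents Z) (Fintype.card ι * Fintype.card κ * t) := by
  have := Computes.range (D := D) (A := A) (fun (p : ι × κ) s => Z s p.1 p.2) t
    fun p => h p.1 p.2
  rw [Fintype.card_prod] at this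
  exact_mod_cast this

theorem Computes.ents_comb (a b : ℝ) {X Y : Ω → Matrix ι κ ℝ} (hX : ents X ⊆ A)
    (hY : ents Y ⊆ A) :
    Computes D A (ents fun s => a • X s + b • Y s) (Fintype.card ι * Fintype.card κ * 5) :=
  .ents_of_entry fun i j => .comb a b (hX (mem_ents X i j)) (hY (mem_ents Y i j))

theorem Computes.ents_add {X Y : Ω → Matrix ι κ ℝ} (hX : ents X ⊆ A) (hY : ents Y ⊆ A) :
    Computes D A (ents fun s => X s + Y s) (Fintype.card ι * Fintype.card κ) := by
  have := Computes.ents_of_entry (D := D) (A := A) (Z := fun s => X s + Y s) (t := 1)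
    fun i j => .one _ (.add (hX (mem_ents X i j)) (hY (mem_ents Y i j)))
  simpa using this

theorem Computes.ents_sub {X Y : Ω → Matrix ι κ ℝ} (hX : ents X ⊆ A) (hY : ents Y ⊆ A) :
    Computes D A (ents fun s => X s - Y s) (Fintype.card ι * Fintype.card κ) := by
  have := Computes.ents_of_entry (D := D) (A := A) (Z := fun s => X s - Y s) (t := 1)
    fun i j => .one _ (.sub (hX (mem_ents X i j)) (hY (mem_ents Y i j)))
  simpa using this

theorem Blocks.computes_comb (a b : ℝ) {x y : Blocks Ω ι κ} (hx : x.ents ⊆ A) (hy : y.ents ⊆ A) :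
    Computes D A (Blocks.comb a b x y).ents
      (10 * (Fintype.card ι * Fintype.card κ) + 5 * Fintype.card ι ^ 2) := by
  simp only [Blocks.ents, Set.union_subset_iff] at hx hy
  refine (((Computes.ents_comb a b hx.1.1 hy.1.1).union
    (Computes.ents_comb a b hx.1.2 hy.1.2)).union (Computes.ents_comb a b hx.2 hy.2)).mono_cost ?_
  apply le_of_eq
  ring

/-- Only two genuine block products occur; everything else is entrywise with known scalars. -/
theorem Blocks.computes_mul {x y : Blocks Ω ι κ} (hx : x.ents ⊆ A) (hy : y.ents ⊆ A) {t : ℝ}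
    (ht : MulCost (Fintype.card ι) (Fintype.card κ) (Fintype.card ι) t) :
    Computes D A (Blocks.mul x y).ents
      (10 * (Fintype.card ι * Fintype.card κ) + 7 * Fintype.card ι ^ 2 + 2 * t) := by
  simp only [Blocks.ents, Set.union_subset_iff] at hx hy
  have h1 := Computes.ents_comb (D := D) x.scal y.scal hy.2 hx.2
  have h2 := ht.apply le_rfl le_rfl le_rfl D A x.left y.right hx.1.1 hy.1.2
  have h3 := ht.apply le_rfl le_rfl le_rfl D A y.left x.right hy.1.1 hx.1.2
  have h4 := (h2.union h3).trans (Computes.ents_add (D := D)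
    (Set.subset_union_left.trans Set.subset_union_right)
    (Set.subset_union_right.trans Set.subset_union_right))
  have h5 := (h1.union h4).trans (Computes.ents_add (D := D)
    (Set.subset_union_left.trans Set.subset_union_right)
    (Set.subset_union_right.trans Set.subset_union_right))
  refine (((Computes.ents_comb x.scal y.scal hy.1.1 hx.1.1).union
    (Computes.ents_comb x.scal y.scal hy.1.2 hx.1.2)).union h5).mono_cost ?_
  apply le_of_eq
  ring

theorem computes_runBlocks {ρ : Type} [DecidableEq ρ] (P : List (RingInstr ρ))
    (st : ρ → Blocks Ω ι κ) {t : ℝ}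
    (ht : MulCost (Fintype.card ι) (Fintype.card κ) (Fintype.card ι) t) (h0 : 0 ∈ A)
    (h : ∀ r, (st r).ents ⊆ A) :
    Computes D A (⋃ r, (runBlocks P st r).ents)
      (P.length * (10 * (Fintype.card ι * Fintype.card κ) + 7 * Fintype.card ι ^ 2 + 2 * t)) := by
  induction P generalizing A st with
  | nil => exact (Computes.of_subset (Set.iUnion_subset h)).mono_cost (by simp)
  | cons I P ih =>
    have ht0 := ht.nonneg
    have hs0 : (0 : ℝ) ≤ Fintype.card ι * Fintype.card κ := by positivity
    have hs1 : (0 : ℝ) ≤ (Fintype.card ι : ℝ) ^ 2 := by positivity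
    have key : ∃ (x : Blocks Ω ι κ) (dst : ρ), I.execBlocks st = Function.update st dst x ∧
        Computes D A x.ents
          (10 * (Fintype.card ι * Fintype.card κ) + 7 * Fintype.card ι ^ 2 + 2 * t) := by
      cases I with
      | const dst c =>
        refine ⟨_, dst, rfl, (Computes.of_subset ?_).mono_cost (by linarith)⟩
        simp only [Blocks.ents, Set.union_subset_iff, ents_subset]
        exact ⟨⟨fun _ _ => h0, fun _ _ => h0⟩, fun _ _ => h0⟩
      | copy dst x => exact ⟨_, dst, rfl, (Computes.of_subset (h x)).mono_cost (by linarith)⟩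
      | add dst x y =>
        exact ⟨_, dst, rfl, (Blocks.computes_comb 1 1 (h x) (h y)).mono_cost (by linarith)⟩
      | sub dst x y =>
        exact ⟨_, dst, rfl, (Blocks.computes_comb 1 (-1) (h x) (h y)).mono_cost (by linarith)⟩
      | mul dst x y => exact ⟨_, dst, rfl, Blocks.computes_mul (h x) (h y) ht⟩
    obtain ⟨x, dst, hI, hx⟩ := key
    have h1 := hx.trans (ih (A := A ∪ x.ents) (I.execBlocks st) (Or.inl h0) (by
      intro r
      rw [hI]
      by_cases hr : r = dst
      · subst hr
        simp
      · rw [Function.update_of_ne hr]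
        exact (h r).trans Set.subset_union_left))
    refine h1.mono_cost ?_
    rw [List.length_cons]
    push_cast
    linarith

end BlockComputes

/-- Products of `(a b) × (a c)` by `(a c) × (a b)` matrices from a program for square products of
size `a` and the cost of `b × c` by `c × b` products. -/
theorem MulCost.block {a b c : ℕ} {t t' : ℝ} (ha : MatMulIn a a a t) (hb : MulCost b c b t') :
    MulCost (a * b) (a * c) (a * b) (t * (10 * (b * c) + 7 * b ^ 2 + 2 * t') + 2) := by
  classical
  obtain ⟨P, hlen, hP⟩ := ha
  have := MulCost.of_exact (I := Fin a × Fin b) (K := Fin a × Fin c) (M := Fin a × Fin b)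
    (t := t * (10 * (b * c) + 7 * b ^ 2 + 2 * t') + 1) (by
    intro Ω D A X Y hX hY
    let st : MatMulReg a a a → Blocks Ω (Fin b) (Fin c) := fun r => match r with
      | .left i k => ⟨0, fun s => (X s).submatrix (fun x => (i, x)) (fun y => (k, y)), 0, 0⟩
      | .right k j => ⟨0, 0, fun s => (Y s).submatrix (fun x => (k, x)) (fun y => (j, y)), 0⟩
      | .out _ _ => .const 0
      | .work _ => .const 0
    have h0 : ∀ {α β : Type}, ents (0 : Ω → Matrix α β ℝ) ⊆ A ∪ {fun _ => 0} := by
      intro α β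
      rw [ents_subset]
      exact fun _ _ => Or.inr rfl
    have hst : ∀ r, (st r).ents ⊆ A ∪ {fun _ => 0} := by
      rintro (⟨i, j⟩ | ⟨i, j⟩ | ⟨i, j⟩ | l)
      · exact Set.union_subset (Set.union_subset (((ents_submatrix_subset X _ _).trans hX).trans
          Set.subset_union_left) h0) h0
      · exact Set.union_subset (Set.union_subset h0 (((ents_submatrix_subset Y _ _).trans
          hY).trans Set.subset_union_left)) h0
      · exact Set.union_subset (Set.union_subset h0 h0) h0
      · exact Set.union_subset (Set.union_subset h0 h0) h0
    have main := (Computes.one (D := D) (A := A) _ (.const 0)).trans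
      (computes_runBlocks (D := D) P st (t := t') (by simpa using hb) (Or.inr rfl) hst)
    have ht' := hb.nonneg
    refine (main.mono_right ?_).mono_cost ?_
    · rw [ents_subset]
      rintro ⟨i, x⟩ ⟨j, y⟩
      refine Set.mem_iUnion.2 ⟨.out i j, Or.inr ?_⟩
      convert mem_ents (runBlocks P st (.out i j)).prod x y using 2 with s
      -- For a fixed inner coordinate `e` the two factors are put into independent nilpotent
      -- directions; the coefficient of the mixed direction, summed over `e`, is the wanted entry.
      let SX : Fin c → Matrix (Fin a) (Fin a) (DualNumber (DualNumber ℝ)) := fun e =>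
        Matrix.of fun i k => TrivSqZeroExt.inl (TrivSqZeroExt.inr (X s (i, x) (k, e)))
      let SY : Fin c → Matrix (Fin a) (Fin a) (DualNumber (DualNumber ℝ)) := fun e =>
        Matrix.of fun k j => TrivSqZeroExt.inr (TrivSqZeroExt.inl (Y s (k, e) (j, y)))
      have hrep := rep_runBlocks (s := s) (i := x) (j := y) P st
        (fun e => mulInput (SX e) (SY e)) (by
          rintro (⟨i, j⟩ | ⟨i, j⟩ | ⟨i, j⟩ | l) <;>
          refine ⟨fun e => ?_, fun e => ?_, fun e => ?_, ?_⟩ <;>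
          simp [mulInput, st, SX, SY, Blocks.const]) (.out i j)
      rw [← hrep.2.2.2]
      simp only [runIn_mulInput hP, Matrix.mul_apply, TrivSqZeroExt.snd_sum, SX, SY,
        Matrix.of_apply]
      rw [Fintype.sum_prod_type, Finset.sum_comm]
      simp [TrivSqZeroExt.snd_mul]
    · rw [Fintype.card_fin, Fintype.card_fin]
      have : (P.length : ℝ) * (10 * (b * c) + 7 * b ^ 2 + 2 * t') ≤
          t * (10 * (b * c) + 7 * b ^ 2 + 2 * t') := by gcongr
      linarith)
  simpa [add_assoc, one_add_one_eq_two] using this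

end ProjMaint


/-! ### Inversion by matrix products and the low-rank correction of the projection. -/

namespace ProjMaint

/-! ### Inversion of positive definite matrices -/

open Matrix in
-- The Schur complement is `Bᵀ X B` for the injective matrix `B` with blocks `-(P⁻¹Q)` and `1`, so
-- it inherits positive definiteness. This keeps the recursive inversion free of pivoting.
theorem posDef_schur {α β : Type} [Fintype α] [Fintype β] [DecidableEq α] [DecidableEq β]
    {X : Matrix (α ⊕ β) (α ⊕ β) ℝ} (hX : X.PosDef) :
    (X.toBlocks₂₂ - X.toBlocks₂₁ * (X.toBlocks₁₁⁻¹ * X.toBlocks₁₂)).PosDef := by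
  have hP : (X.toBlocks₁₁).PosDef := hX.submatrix Sum.inl_injective
  have hPu : IsUnit X.toBlocks₁₁.det := (Matrix.isUnit_iff_isUnit_det _).1 hP.isUnit
  set P := X.toBlocks₁₁
  set Q := X.toBlocks₁₂
  set R := X.toBlocks₂₁
  set S := X.toBlocks₂₂
  let B : Matrix (α ⊕ β) β ℝ := fromRows (-(P⁻¹ * Q)) 1
  have hB : Function.Injective B.mulVec := by
    intro x y hxy
    funext b
    have := congrFun hxy (Sum.inr b)
    simpa [B, fromRows_mulVec] using this
  have hX2 : X = fromBlocks P Q R S := (fromBlocks_toBlocks X).symm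
  have h := hX.conjTranspose_mul_mul_same hB
  convert h using 1
  rw [hX2, Matrix.mul_assoc, fromBlocks_mul_fromRows, conjTranspose_fromRows_eq_fromCols_conjTranspose,
    fromCols_mul_fromRows]
  have e1 : P * -(P⁻¹ * Q) + Q * (1 : Matrix β β ℝ) = 0 := by
    rw [Matrix.mul_neg, Matrix.mul_nonsing_inv_cancel_left _ _ hPu, Matrix.mul_one, neg_add_cancel]
  rw [e1]
  simp [sub_eq_neg_add]

open Matrix in
-- Block elimination. By symmetry `R P⁻¹ = Fᵀ`, so two inversions and four products of half size
-- suffice.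
theorem inv_posDef_sum {α β : Type} [Fintype α] [Fintype β] [DecidableEq α] [DecidableEq β]
    {X : Matrix (α ⊕ β) (α ⊕ β) ℝ} (hX : X.PosDef) {F G : Matrix α β ℝ} {T : Matrix β β ℝ}
    (hF : F = X.toBlocks₁₁⁻¹ * X.toBlocks₁₂) (hT : T = (X.toBlocks₂₂ - X.toBlocks₂₁ * F)⁻¹)
    (hG : G = F * T) :
    X⁻¹ = fromBlocks (X.toBlocks₁₁⁻¹ + G * Fᵀ) (-G) (-Gᵀ) T := by
  have hP : (X.toBlocks₁₁).PosDef := hX.submatrix Sum.inl_injective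
  have hPu : IsUnit X.toBlocks₁₁.det := (Matrix.isUnit_iff_isUnit_det _).1 hP.isUnit
  have hS := posDef_schur hX
  rw [← hF] at hS
  have hSu := (Matrix.isUnit_iff_isUnit_det _).1 hS.isUnit
  have hsymm : ∀ i j, X i j = X j i := by
    intro i j
    have := hX.isHermitian
    conv_lhs => rw [← this]
    simp
  have hPs : (X.toBlocks₁₁)⁻¹ᵀ = X.toBlocks₁₁⁻¹ := by
    have := hP.inv.isHermitian
    rwa [IsHermitian, conjTranspose_eq_transpose_of_trivial] at this
  have hTs : Tᵀ = T := by
    have := hS.inv.isHermitian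
    rwa [← hT, IsHermitian, conjTranspose_eq_transpose_of_trivial] at this
  have hQ : (X.toBlocks₁₂)ᵀ = X.toBlocks₂₁ := by
    ext i j; exact hsymm _ _
  have hFt : Fᵀ = X.toBlocks₂₁ * X.toBlocks₁₁⁻¹ := by
    rw [hF, transpose_mul, hPs, hQ]
  have hGt : Gᵀ = T * Fᵀ := by rw [hG, transpose_mul, hTs]
  have hPF : X.toBlocks₁₁ * F = X.toBlocks₁₂ := by
    rw [hF, Matrix.mul_nonsing_inv_cancel_left _ _ hPu]
  have hST : (X.toBlocks₂₂ - X.toBlocks₂₁ * F) * T = 1 := by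
    rw [hT, Matrix.mul_nonsing_inv _ hSu]
  have hST' : X.toBlocks₂₂ * T = 1 + X.toBlocks₂₁ * F * T := by
    rw [← hST, Matrix.sub_mul, sub_add_cancel]
  apply Matrix.inv_eq_right_inv
  suffices h : fromBlocks X.toBlocks₁₁ X.toBlocks₁₂ X.toBlocks₂₁ X.toBlocks₂₂ *
      fromBlocks (X.toBlocks₁₁⁻¹ + G * Fᵀ) (-G) (-Gᵀ) T = 1 by
    rwa [fromBlocks_toBlocks] at h
  rw [fromBlocks_multiply, ← fromBlocks_one]
  congr 1
  · rw [Matrix.mul_add, Matrix.mul_nonsing_inv _ hPu, hGt, hG, ← Matrix.mul_assoc,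
      ← Matrix.mul_assoc, hPF, Matrix.mul_neg, Matrix.mul_assoc, add_neg_cancel_right]
  · rw [Matrix.mul_neg, hG, ← Matrix.mul_assoc, hPF, neg_add_cancel]
  · rw [Matrix.mul_add, ← hFt, Matrix.mul_neg, hGt, ← Matrix.mul_assoc X.toBlocks₂₂, hST', hG,
      Matrix.add_mul, Matrix.one_mul]
    simp only [Matrix.mul_assoc]
    abel
  · rw [hST', Matrix.mul_neg, hG, ← Matrix.mul_assoc]
    abel

/-- Index types of size `2 ^ k`. -/
def BinIdx : ℕ → Type
  | 0 => Unit
  | k + 1 => BinIdx k ⊕ BinIdx k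

instance BinIdx.instFintype : ∀ k, Fintype (BinIdx k)
  | 0 => inferInstanceAs (Fintype Unit)
  | k + 1 => by
    have := BinIdx.instFintype k
    exact inferInstanceAs (Fintype (BinIdx k ⊕ BinIdx k))

instance BinIdx.instDecidableEq : ∀ k, DecidableEq (BinIdx k)
  | 0 => inferInstanceAs (DecidableEq Unit)
  | k + 1 => by
    have := BinIdx.instDecidableEq k
    exact inferInstanceAs (DecidableEq (BinIdx k ⊕ BinIdx k))

theorem BinIdx.card (k : ℕ) : Fintype.card (BinIdx k) = 2 ^ k := by
  induction k with
  | zero => rfl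
  | succ k ih =>
    have : Fintype.card (BinIdx (k + 1)) = Fintype.card (BinIdx k ⊕ BinIdx k) := rfl
    rw [this, Fintype.card_sum, ih]
    ring

section Inverse

variable {Ω : Type} {D : Set Ω} {A : Set (Ω → ℝ)}

/-- Recursion on halves by `inv_posDef_sum`. Since `2^w ≥ 4`, the two recursive calls use at most
half of the budget; the other half pays for four products and `7 h²` entrywise operations, which
fixes the constant `2 K + 4`. -/
theorem computes_inv_binIdx {K w : ℝ} (hw : 2 ≤ w)
    (hM : ∀ n : ℕ, 1 ≤ n → MulCost n n n (K * (n : ℝ) ^ w)) (k : ℕ) :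
    ∀ {A : Set (Ω → ℝ)} {X : Ω → Matrix (BinIdx k) (BinIdx k) ℝ}, (∀ s ∈ D, (X s).PosDef) →
      ents X ⊆ A → Computes D A (ents fun s => (X s)⁻¹) ((2 * K + 4) * ((2 : ℝ) ^ k) ^ w) := by
  have hK : 0 ≤ K := by simpa using (hM 1 le_rfl).nonneg
  induction k with
  | zero =>
    intro A X hX hA
    let Y : Ω → Matrix Unit Unit ℝ := X
    have h1 : Computes D A {fun s => 1 / Y s () ()} 2 :=
      (Computes.step _ (.const 1) (.one ((fun _ => (1 : ℝ)) / fun s => Y s () ())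
        (.div (Or.inl rfl) (Or.inr (hA (mem_ents X () ())))))).mono_cost (by norm_num)
    refine (h1.mono_right ?_).mono_cost (by simp; linarith)
    change (ents fun s => (Y s)⁻¹) ⊆ _
    rw [ents_subset]
    intro _ _
    simp [Matrix.inv_subsingleton]
  | succ k ih =>
    intro A X hX hA
    let Y : Ω → Matrix (BinIdx k ⊕ BinIdx k) (BinIdx k ⊕ BinIdx k) ℝ := X
    change ∀ s ∈ D, (Y s).PosDef at hX
    change ents Y ⊆ A at hA
    change Computes D A (ents fun s => (Y s)⁻¹) _
    let P : Ω → Matrix (BinIdx k) (BinIdx k) ℝ := fun s => (Y s).toBlocks₁₁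
    let Q : Ω → Matrix (BinIdx k) (BinIdx k) ℝ := fun s => (Y s).toBlocks₁₂
    let R : Ω → Matrix (BinIdx k) (BinIdx k) ℝ := fun s => (Y s).toBlocks₂₁
    let S : Ω → Matrix (BinIdx k) (BinIdx k) ℝ := fun s => (Y s).toBlocks₂₂
    let F : Ω → Matrix (BinIdx k) (BinIdx k) ℝ := fun s => (P s)⁻¹ * Q s
    let RF : Ω → Matrix (BinIdx k) (BinIdx k) ℝ := fun s => R s * F s
    let Sc : Ω → Matrix (BinIdx k) (BinIdx k) ℝ := fun s => S s - RF s
    let T : Ω → Matrix (BinIdx k) (BinIdx k) ℝ := fun s => (Sc s)⁻¹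
    let G : Ω → Matrix (BinIdx k) (BinIdx k) ℝ := fun s => F s * T s
    let GF : Ω → Matrix (BinIdx k) (BinIdx k) ℝ := fun s => G s * (F s).transpose
    have hMk := hM (2 ^ k) Nat.one_le_two_pow
    have hmul := fun (A : Set (Ω → ℝ)) (X Y : Ω → Matrix (BinIdx k) (BinIdx k) ℝ) =>
      hMk.apply (BinIdx.card k).le (BinIdx.card k).le (BinIdx.card k).le D A X Y
    push_cast at hmul
    have hQA : ents Q ⊆ A := by
      rw [ents_subset]; exact fun i j => hA (mem_ents Y (Sum.inl i) (Sum.inr j))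
    have hRA : ents R ⊆ A := by
      rw [ents_subset]; exact fun i j => hA (mem_ents Y (Sum.inr i) (Sum.inl j))
    have hSA : ents S ⊆ A := by
      rw [ents_subset]; exact fun i j => hA (mem_ents Y (Sum.inr i) (Sum.inr j))
    have hPA : ents P ⊆ A := by
      rw [ents_subset]; exact fun i j => hA (mem_ents Y (Sum.inl i) (Sum.inl j))
    have c1 := ih (A := A) (X := P) (fun s hs => (hX s hs).submatrix Sum.inl_injective) hPA
    set A1 := A ∪ ents fun s => (P s)⁻¹ with hA1
    have a1 : A ⊆ A1 := Set.subset_union_left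
    have c2 := hmul A1 (fun s => (P s)⁻¹) Q Set.subset_union_right (hQA.trans a1)
    set A2 := A1 ∪ ents F with hA2
    have a2 : A1 ⊆ A2 := Set.subset_union_left
    have c3 := hmul A2 R F (hRA.trans (a1.trans a2)) Set.subset_union_right
    set A3 := A2 ∪ ents RF with hA3
    have a3 : A2 ⊆ A3 := Set.subset_union_left
    have c4 := Computes.ents_sub (D := D) (A := A3) (X := S) (Y := RF)
      (hSA.trans (a1.trans (a2.trans a3))) Set.subset_union_right
    set A4 := A3 ∪ ents Sc with hA4
    have a4 : A3 ⊆ A4 := Set.subset_union_left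
    have c5 := ih (A := A4) (X := Sc) (fun s hs => posDef_schur (hX s hs)) Set.subset_union_right
    set A5 := A4 ∪ ents T with hA5
    have a5 : A4 ⊆ A5 := Set.subset_union_left
    have fA5 : ents F ⊆ A5 := Set.subset_union_right.trans (a3.trans (a4.trans a5))
    have c6 := hmul A5 F T fA5 Set.subset_union_right
    set A6 := A5 ∪ ents G with hA6
    have a6 : A5 ⊆ A6 := Set.subset_union_left
    have c7 := hmul A6 G (fun s => (F s).transpose) Set.subset_union_right
      (by rw [ents_transpose]; exact fA5.trans a6)
    set A7 := A6 ∪ ents GF with hA7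
    have a7 : A6 ⊆ A7 := Set.subset_union_left
    have pA7 : (ents fun s => (P s)⁻¹) ⊆ A7 :=
      Set.subset_union_right.trans (a2.trans (a3.trans (a4.trans (a5.trans (a6.trans a7)))))
    have c8 := Computes.ents_add (D := D) (A := A7) (X := fun s => (P s)⁻¹) (Y := GF) pA7
      Set.subset_union_right
    have gA7 : ents G ⊆ A7 := Set.subset_union_right.trans a7
    -- Negation of `G` as the combination `-1 • G + 0 • G`.
    have c9 := Computes.ents_comb (D := D) (A := A7) (-1) 0 (X := G) (Y := G) gA7 gA7
    have c10 : Computes D A7 (ents T) 0 :=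
      .of_subset (Set.subset_union_right.trans (a6.trans a7))
    have main := c1.trans (c2.trans (c3.trans (c4.trans (c5.trans (c6.trans (c7.trans
      ((c8.union c9).union c10)))))))
    refine (main.congr ?_).mono_cost ?_
    · have hinv : ∀ s ∈ D, (Y s)⁻¹ = Matrix.fromBlocks ((P s)⁻¹ + GF s) (-G s) (-(G s).transpose)
          (T s) := fun s hs => inv_posDef_sum (hX s hs) rfl rfl rfl
      rintro _ ⟨⟨i | i, j | j⟩, rfl⟩
      · refine ⟨_, Or.inl (Or.inl (mem_ents _ i j)), fun s hs => ?_⟩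
        simp [hinv s hs]
      · refine ⟨_, Or.inl (Or.inr (mem_ents _ i j)), fun s hs => ?_⟩
        simp [hinv s hs]
      · refine ⟨_, Or.inl (Or.inr (mem_ents _ j i)), fun s hs => ?_⟩
        simp [hinv s hs]
      · refine ⟨_, Or.inr (mem_ents _ i j), fun s hs => ?_⟩
        simp [hinv s hs]
    · simp only [BinIdx.card]
      push_cast
      set h : ℝ := (2 : ℝ) ^ k
      have hh : 1 ≤ h := one_le_pow₀ (by norm_num)
      have h2 : h * h ≤ h ^ w := by
        rw [← pow_two, ← Real.rpow_two]
        exact Real.rpow_le_rpow_of_exponent_le hh hw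
      have h3 : ((2 : ℝ) ^ (k + 1)) ^ w = 2 ^ w * h ^ w := by
        rw [pow_succ, Real.mul_rpow (by positivity) (by norm_num), mul_comm]
      have h4 : (4 : ℝ) ≤ 2 ^ w := by
        calc (4 : ℝ) = 2 ^ (2 : ℝ) := by norm_num
          _ ≤ 2 ^ w := Real.rpow_le_rpow_of_exponent_le (by norm_num) hw
      have h5 : 0 ≤ h ^ w := by positivity
      rw [h3]
      have h6 : 4 * ((2 * K + 4) * h ^ w) ≤ 2 ^ w * ((2 * K + 4) * h ^ w) := by gcongr
      nlinarith

end Inverse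
end ProjMaint


namespace ProjMaint

/-! ### Inversion of invertible matrices -/

/-- Inverses of matrices of quantities of size at most `r` that are invertible on `D` take at most
`t` steps. -/
structure InvCost (r : ℕ) (t : ℝ) : Prop where
  apply : ∀ {Ω ι : Type} [Fintype ι] [DecidableEq ι], Fintype.card ι ≤ r → ∀ (D : Set Ω)
    (A : Set (Ω → ℝ)) (X : Ω → Matrix ι ι ℝ), (∀ s ∈ D, IsUnit (X s).det) → ents X ⊆ A →
    Computes D A (ents fun s => (X s)⁻¹) t

theorem inv_fromBlocks_one {α β : Type} [Fintype α] [Fintype β] [DecidableEq α] [DecidableEq β]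
    {X : Matrix α α ℝ} (hX : IsUnit X.det) :
    (Matrix.fromBlocks X 0 0 (1 : Matrix β β ℝ))⁻¹ = Matrix.fromBlocks X⁻¹ 0 0 1 := by
  apply Matrix.inv_eq_right_inv
  rw [Matrix.fromBlocks_multiply, ← Matrix.fromBlocks_one]
  congr 1 <;> simp [Matrix.mul_nonsing_inv _ hX]

/-- General invertible matrices reduce to positive definite ones by `Y⁻¹ = (YᵀY)⁻¹Yᵀ`. Before that,
`X` is enlarged by an identity block to a power of two of size at most `2 r`. The kernels in the
Woodbury identity are not symmetric, hence this generality. -/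
theorem InvCost.of_mulCost {K w : ℝ} (hw : 2 ≤ w)
    (hM : ∀ n : ℕ, 1 ≤ n → MulCost n n n (K * (n : ℝ) ^ w)) {r : ℕ} (hr : 1 ≤ r) :
    InvCost r ((4 * K + 5) * 2 ^ w * (r : ℝ) ^ w) := by
  classical
  have hK : 0 ≤ K := by simpa using (hM 1 le_rfl).nonneg
  constructor
  intro Ω ι _ _ hι D A X hX hA
  set k := Nat.clog 2 r
  have hk1 : r ≤ 2 ^ k := Nat.le_pow_clog one_lt_two r
  have hk2 : 2 ^ k ≤ 2 * r := by
    rcases hr.eq_or_lt with h | h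
    · simp [k, ← h]
    · have := Nat.pow_pred_clog_lt_self one_lt_two h
      have hpos : 0 < k := Nat.clog_pos one_lt_two h
      obtain ⟨j, hj⟩ := Nat.exists_eq_succ_of_ne_zero hpos.ne'
      rw [hj, pow_succ]
      change 2 ^ (k - 1) < r at this
      rw [hj] at this
      simp only [Nat.succ_eq_add_one, Nat.add_sub_cancel] at this
      omega
  have hcard : Fintype.card (BinIdx k) =
      Fintype.card (ι ⊕ Fin (2 ^ k - Fintype.card ι)) := by
    rw [BinIdx.card, Fintype.card_sum, Fintype.card_fin]
    omega
  let e : BinIdx k ≃ ι ⊕ Fin (2 ^ k - Fintype.card ι) := Fintype.equivOfCardEq hcard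
  let Y : Ω → Matrix (BinIdx k) (BinIdx k) ℝ := fun s =>
    (Matrix.fromBlocks (X s) 0 0 1).submatrix e e
  have hYdet : ∀ s ∈ D, IsUnit (Y s).det := by
    intro s hs
    rw [Matrix.det_submatrix_equiv_self, Matrix.det_fromBlocks_zero₂₁, Matrix.det_one, mul_one]
    exact hX s hs
  have hYinv : ∀ s ∈ D, (Y s)⁻¹ = (Matrix.fromBlocks (X s)⁻¹ 0 0 1).submatrix e e := by
    intro s hs
    rw [Matrix.inv_submatrix_equiv, inv_fromBlocks_one (hX s hs)]
  set A1 := A ∪ ({fun _ => 0} ∪ {fun _ => 1}) with hA1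
  have c0 : Computes D A ({fun _ => 0} ∪ {fun _ => 1}) (1 + 1) :=
    (Computes.one _ (.const 0)).union (.one _ (.const 1))
  have hYA : ents Y ⊆ A1 := by
    rw [ents_subset]
    intro a b
    rcases ha : e a with i | i <;> rcases hb : e b with j | j
    · exact Or.inl (by simpa [Y, ha, hb] using hA (mem_ents X i j))
    · exact Or.inr (Or.inl (by simp [Y, ha, hb]))
    · exact Or.inr (Or.inl (by simp [Y, ha, hb]))
    · by_cases hij : i = j
      · exact Or.inr (Or.inr (by simp [Y, ha, hb, hij]))
      · exact Or.inr (Or.inl (by simp [Y, ha, hb, Matrix.one_apply_ne hij]))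
  have hMk := hM (2 ^ k) Nat.one_le_two_pow
  have hmul := fun (A : Set (Ω → ℝ)) (X Y : Ω → Matrix (BinIdx k) (BinIdx k) ℝ) =>
    hMk.apply (BinIdx.card k).le (BinIdx.card k).le (BinIdx.card k).le D A X Y
  push_cast at hmul
  have hYtA : (ents fun s => (Y s).transpose) ⊆ A1 := by rwa [ents_transpose]
  have c1 := hmul A1 (fun s => (Y s).transpose) Y hYtA hYA
  have c2 := computes_inv_binIdx (D := D) hw hM k
    (A := A1 ∪ ents fun s => (Y s).transpose * Y s)
    (X := fun s => (Y s).transpose * Y s) (by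
      intro s hs
      have := Matrix.PosDef.conjTranspose_mul_self (Y s)
        (Matrix.mulVec_injective_iff_isUnit.2 ((Matrix.isUnit_iff_isUnit_det _).2 (hYdet s hs)))
      rwa [Matrix.conjTranspose_eq_transpose_of_trivial] at this) Set.subset_union_right
  have c3 := hmul ((A1 ∪ ents fun s => (Y s).transpose * Y s) ∪
    ents fun s => ((Y s).transpose * Y s)⁻¹) (fun s => ((Y s).transpose * Y s)⁻¹)
    (fun s => (Y s).transpose) Set.subset_union_right
    (hYtA.trans (Set.subset_union_left.trans Set.subset_union_left))
  have main := c0.trans (c1.trans (c2.trans c3))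
  refine (main.congr ?_).mono_cost ?_
  · rintro _ ⟨⟨i, j⟩, rfl⟩
    refine ⟨_, mem_ents _ (e.symm (Sum.inl i)) (e.symm (Sum.inl j)), fun s hs => ?_⟩
    have h1 : ((Y s).transpose * Y s)⁻¹ * (Y s).transpose = (Y s)⁻¹ := by
      rw [Matrix.mul_inv_rev, Matrix.mul_assoc,
        Matrix.nonsing_inv_mul _ (Matrix.isUnit_det_transpose _ (hYdet s hs)), Matrix.mul_one]
    simp only [h1, hYinv s hs, Matrix.submatrix_apply, Equiv.apply_symm_apply,
      Matrix.fromBlocks_apply₁₁]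
  · have h1 : ((2 : ℝ) ^ k) ^ w ≤ 2 ^ w * (r : ℝ) ^ w := by
      rw [← Real.mul_rpow (by norm_num) (by positivity)]
      refine Real.rpow_le_rpow (by positivity) ?_ (by linarith)
      exact_mod_cast hk2
    have h4 : (2 : ℝ) ≤ 2 ^ w * (r : ℝ) ^ w := by
      have h5 : (1 : ℝ) ≤ (r : ℝ) ^ w := Real.one_le_rpow (by exact_mod_cast hr) (by linarith)
      have h6 : (2 : ℝ) ≤ 2 ^ w := by
        calc (2 : ℝ) = 2 ^ (1 : ℝ) := by norm_num
          _ ≤ 2 ^ w := Real.rpow_le_rpow_of_exponent_le (by norm_num) (by linarith)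
      nlinarith
    have h7 := mul_le_mul_of_nonneg_left h1 (by linarith : 0 ≤ 4 * K + 4)
    linarith

/-! ### The projection matrix -/

section Woodbury

open Matrix

variable {d n : ℕ}

/-- Full row rank makes `x ↦ xᵀA` injective, so the positive form `diagonal u` pulls back to a
positive form. -/
theorem posDef_gram {A : Matrix (Fin d) (Fin n) ℝ} (hA : A.rank = d) {u : Fin n → ℝ}
    (hu : ∀ i, 0 < u i) : (A * diagonal u * Aᵀ).PosDef := by
  have hrow : LinearIndependent ℝ A.row := by
    rw [linearIndependent_iff_card_eq_finrank_span, Fintype.card_fin]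
    exact hA.symm.trans A.rank_eq_finrank_span_row
  have := (PosDef.diagonal hu).mul_mul_conjTranspose_same (B := A)
    (Matrix.vecMul_injective_iff.2 hrow)
  rwa [conjTranspose_eq_transpose_of_trivial] at this

/-- `Aᵀ (A U Aᵀ)⁻¹ A` for `U = diag u`. -/
noncomputable def coreMatrix (A : Matrix (Fin d) (Fin n) ℝ) (u : Fin n → ℝ) :
    Matrix (Fin n) (Fin n) ℝ :=
  Aᵀ * (A * diagonal u * Aᵀ)⁻¹ * A

theorem projMatrix_mulVec (A : Matrix (Fin d) (Fin n) ℝ) (u x : Fin n → ℝ) (i : Fin n) :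
    (projMatrix A u).mulVec x i =
      Real.sqrt (u i) * (coreMatrix A u).mulVec (fun j => Real.sqrt (u j) * x j) i := by
  have h : projMatrix A u = diagonal (fun i => Real.sqrt (u i)) *
      (coreMatrix A u * diagonal (fun i => Real.sqrt (u i))) := by
    simp only [projMatrix, coreMatrix, Matrix.mul_assoc]
  rw [h, ← mulVec_mulVec, ← mulVec_mulVec, mulVec_diagonal]
  congr 2
  funext j
  rw [mulVec_diagonal]

/-- The matrix inverted in a low-rank update. -/
noncomputable def updateKernel (M : Matrix (Fin n) (Fin n) ℝ) (S : Finset (Fin n))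
    (e : Fin n → ℝ) : Matrix S S ℝ :=
  1 + diagonal (fun i : S => e i) * M.submatrix (Subtype.val : S → Fin n) Subtype.val

/-- The Gram matrix changes by `F E Fᵀ`, where `F` consists of the columns of `A` in `S`. The kernel
is written `1 + E FᵀG⁻¹F` and not with `E⁻¹`, since some changes in `S` may be zero. -/
theorem woodbury {A : Matrix (Fin d) (Fin n) ℝ} (hA : A.rank = d) {u u' : Fin n → ℝ}
    (hu : ∀ i, 0 < u i) (hu' : ∀ i, 0 < u' i) (S : Finset (Fin n)) (hS : ∀ i ∉ S, u' i = u i) :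
    IsUnit (updateKernel (coreMatrix A u) S (u' - u)).det ∧
    coreMatrix A u' = coreMatrix A u - (coreMatrix A u).submatrix id (Subtype.val : S → Fin n) *
      ((updateKernel (coreMatrix A u) S (u' - u))⁻¹ *
        (diagonal (fun i : S => (u' - u) i) *
          (coreMatrix A u).submatrix (Subtype.val : S → Fin n) id)) := by
  set G := A * diagonal u * Aᵀ with hG
  set G' := A * diagonal u' * Aᵀ with hG'
  have hGu : IsUnit G.det := (isUnit_iff_isUnit_det _).1 (posDef_gram hA hu).isUnit
  have hGu' : IsUnit G'.det := (isUnit_iff_isUnit_det _).1 (posDef_gram hA hu').isUnit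
  let F : Matrix (Fin d) S ℝ := A.submatrix id Subtype.val
  let E : Matrix S S ℝ := diagonal (fun i : S => (u' - u) i)
  have h1 : G' = G + F * E * Fᵀ := by
    have : diagonal u' = diagonal u + diagonal (u' - u) := by
      rw [diagonal_add]; congr 1; funext i; simp
    rw [hG', this, Matrix.mul_add, Matrix.add_mul]
    congr 1
    ext i j
    rw [Matrix.mul_apply, Matrix.mul_apply]
    simp only [Matrix.mul_diagonal, E, F, submatrix_apply, id, transpose_apply]
    refine Eq.trans ?_ (Finset.sum_coe_sort S fun k => A i k * (u' - u) k * A j k).symm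
    refine (Finset.sum_subset (Finset.subset_univ S) fun k _ hk => ?_).symm
    simp [hS k hk]
  have hcore : ∀ {p q : Type} (f : p → Fin n) (g : q → Fin n),
      (coreMatrix A u).submatrix f g = (A.submatrix id f)ᵀ * G⁻¹ * A.submatrix id g := by
    intro p q f g
    ext i j
    simp [coreMatrix, Matrix.mul_apply, hG]
  have hker : updateKernel (coreMatrix A u) S (u' - u) = 1 + E * (Fᵀ * G⁻¹ * F) := by
    rw [updateKernel, hcore]
  rw [hker, hcore, hcore]
  have hdet : IsUnit (1 + E * (Fᵀ * G⁻¹ * F)).det := by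
    -- Sylvester's identity `det (1 + XY) = det (1 + YX)` reduces invertibility of the kernel to
    -- that of the two Gram matrices.
    have e1 : (1 + E * (Fᵀ * G⁻¹ * F)).det = (G⁻¹ * G').det := by
      rw [h1, Matrix.mul_add, nonsing_inv_mul _ hGu]
      have : E * (Fᵀ * G⁻¹ * F) = (E * Fᵀ) * (G⁻¹ * F) := by simp only [Matrix.mul_assoc]
      rw [this, det_one_add_mul_comm]
      simp only [Matrix.mul_assoc]
    rw [e1, det_mul]
    exact (isUnit_nonsing_inv_det _ hGu).mul hGu'
  refine ⟨hdet, ?_⟩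
  set N := 1 + E * (Fᵀ * G⁻¹ * F) with hN
  have hinv : G'⁻¹ = G⁻¹ - G⁻¹ * F * (N⁻¹ * (E * (Fᵀ * G⁻¹))) := by
    apply inv_eq_right_inv
    have hNN : N * N⁻¹ = 1 := mul_nonsing_inv _ hdet
    have h2 : E * (Fᵀ * G⁻¹ * F) * N⁻¹ = 1 - N⁻¹ := by
      rw [← hNN, hN, Matrix.add_mul, Matrix.one_mul, ← hN, add_sub_cancel_left]
    calc G' * (G⁻¹ - G⁻¹ * F * (N⁻¹ * (E * (Fᵀ * G⁻¹))))
        = G * G⁻¹ + F * E * Fᵀ * G⁻¹ - (G * G⁻¹) * F * (N⁻¹ * (E * (Fᵀ * G⁻¹)))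
          - F * ((E * (Fᵀ * G⁻¹ * F) * N⁻¹) * (E * (Fᵀ * G⁻¹))) := by
          rw [h1]
          simp only [Matrix.add_mul, Matrix.mul_sub, Matrix.mul_assoc]
          abel
      _ = 1 := by
          rw [h2, mul_nonsing_inv _ hGu, Matrix.one_mul, Matrix.sub_mul, Matrix.one_mul,
            Matrix.mul_sub]
          simp only [Matrix.mul_assoc]
          abel
  have hid : A.submatrix id id = A := rfl
  rw [hid, coreMatrix, coreMatrix, ← hG, ← hG', hinv, Matrix.mul_sub, Matrix.sub_mul]
  congr 1
  simp only [Matrix.mul_assoc]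
  rfl

end Woodbury

end ProjMaint


/-! ### The price of a correction of rank `2^j` in terms of `ω` and `a`. -/

namespace ProjMaint

/-! ### Consequences of the matrix multiplication exponents -/

/-- All `n²` entries of the product must be written. -/
theorem IsMatMulExponent.two_le {ω : ℝ} (hω : IsMatMulExponent ω) : 2 ≤ ω := by
  obtain ⟨K, hK⟩ := hω
  by_contra! h
  have h1 : ∀ n : ℕ, 1 ≤ n → (n : ℝ) ^ (2 - ω) ≤ K := by
    intro n hn
    have h2 := (hK n hn).le hn
    have hn' : (0 : ℝ) < n := by exact_mod_cast hn
    rw [Real.rpow_sub hn', div_le_iff₀ (by positivity), Real.rpow_two, pow_two]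
    exact h2
  have h3 := (tendsto_rpow_atTop (by linarith : 0 < 2 - ω)).comp tendsto_natCast_atTop_atTop
  obtain ⟨n, hn1, hn2⟩ := ((h3.eventually_gt_atTop K).and (eventually_ge_atTop 1)).exists
  exact absurd (h1 n hn2) (not_le.2 hn1)

theorem IsDualExponent.le_one {α : ℝ} (hα : IsDualExponent α) : α ≤ 1 := by
  obtain ⟨g, hg, hev⟩ := hα.1
  have h1 : ∀ᶠ n : ℕ in atTop, α - 1 ≤ g n := by
    filter_upwards [hev, eventually_ge_atTop 2] with n hn hn2
    have h2 := hn.le (by omega)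
    have hn' : (1 : ℝ) < n := by exact_mod_cast hn2
    have h3 : (n : ℝ) ^ (1 + α) ≤ (n : ℝ) ^ (2 + g n) := by
      rw [Real.rpow_add (by linarith), Real.rpow_one]
      refine le_trans ?_ h2
      gcongr
      exact Nat.le_ceil _
    have := (Real.rpow_le_rpow_left_iff hn').1 h3
    linarith
  have := ge_of_tendsto hg h1
  linarith

theorem IsMatMulExponent.mulCost {ω : ℝ} (hω : IsMatMulExponent ω) :
    ∃ K : ℝ, 0 ≤ K ∧ ∀ n : ℕ, 1 ≤ n → MulCost n n n (K * (n : ℝ) ^ ω) := by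
  obtain ⟨K, hK⟩ := hω
  have hK1 : 1 ≤ K := by simpa using (hK 1 le_rfl).le le_rfl
  refine ⟨K + 2, by linarith, fun n hn => (MulCost.of_matMulIn (hK n hn)).mono le_rfl le_rfl le_rfl ?_⟩
  have : (1 : ℝ) ≤ (n : ℝ) ^ ω :=
    Real.one_le_rpow (by exact_mod_cast hn) (by
      have := IsMatMulExponent.two_le ⟨K, hK⟩
      linarith)
  linarith

theorem ceil_rpow_le {a : ℝ} (ha : a ≤ 1) {n : ℕ} (hn : 1 ≤ n) : ⌈(n : ℝ) ^ a⌉₊ ≤ n := by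
  refine Nat.ceil_le.2 ?_
  calc (n : ℝ) ^ a ≤ (n : ℝ) ^ (1 : ℝ) :=
        Real.rpow_le_rpow_of_exponent_le (by exact_mod_cast hn) ha
    _ = n := Real.rpow_one _

/-- The dual exponent speaks of a small outer dimension; the transposition principle makes the inner
one small. The finitely many `n` below `n0` use the schoolbook product, their cost going into `K`.
-/
theorem IsDualExponent.mulCost {α a : ℝ} (hα : IsDualExponent α) (ha : a ≤ α) {δ : ℝ}
    (hδ : 0 < δ) : ∃ K : ℝ, 0 ≤ K ∧ ∀ n : ℕ, 1 ≤ n →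
      MulCost n ⌈(n : ℝ) ^ a⌉₊ n (K * (n : ℝ) ^ (2 + δ)) := by
  have hα1 := hα.le_one
  obtain ⟨g, hg, hev⟩ := hα.1
  obtain ⟨n0, hn0⟩ := eventually_atTop.1 (hev.and (hg.eventually_le_const hδ))
  refine ⟨7 + 3 * n0, by positivity, fun n hn => ?_⟩
  have hn' : (1 : ℝ) ≤ n := by exact_mod_cast hn
  have h1 : (1 : ℝ) ≤ (n : ℝ) ^ (2 + δ) := Real.one_le_rpow hn' (by linarith)
  rcases le_total n0 n with h | h
  · obtain ⟨hn1, hn2⟩ := hn0 n h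
    refine (MulCost.of_matMulIn_transpose hn1).mono le_rfl ?_ le_rfl ?_
    · exact Nat.ceil_le_ceil (Real.rpow_le_rpow_of_exponent_le hn' ha)
    · have h2 : (n : ℝ) ^ (2 + g n) ≤ (n : ℝ) ^ (2 + δ) :=
        Real.rpow_le_rpow_of_exponent_le hn' (by linarith)
      have h3 : 0 ≤ 3 * (n0 : ℝ) * (n : ℝ) ^ (2 + δ) := by positivity
      linarith
  · refine (MulCost.naive n ⌈(n : ℝ) ^ a⌉₊ n).mono le_rfl le_rfl le_rfl ?_
    have h2 : ((⌈(n : ℝ) ^ a⌉₊ : ℕ) : ℝ) ≤ n0 := by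
      exact_mod_cast (ceil_rpow_le (ha.trans hα1) hn).trans h
    have h3 : (n : ℝ) * n ≤ (n : ℝ) ^ (2 + δ) := by
      rw [← pow_two, ← Real.rpow_two]
      exact Real.rpow_le_rpow_of_exponent_le hn' (by linarith)
    have h4 : (n : ℝ) * ⌈(n : ℝ) ^ a⌉₊ * n ≤ n0 * (n : ℝ) ^ (2 + δ) := by
      calc (n : ℝ) * ⌈(n : ℝ) ^ a⌉₊ * n = ⌈(n : ℝ) ^ a⌉₊ * ((n : ℝ) * n) := by ring
        _ ≤ _ := by gcongr
    have h5 : 0 ≤ (n0 : ℝ) * (n : ℝ) ^ (2 + δ) := by positivity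
    linarith

/-- Square products by splitting the inner dimension. -/
theorem IsDualExponent.mulCost_square {α a : ℝ} (hα : IsDualExponent α)
    (ha : a ≤ α) {δ : ℝ}
    (hδ : 0 < δ) : ∃ K : ℝ, 0 ≤ K ∧ ∀ n : ℕ, 1 ≤ n →
      MulCost n n n (K * (n : ℝ) ^ (3 - a + δ)) := by
  obtain ⟨K, hK0, hK⟩ := hα.mulCost ha hδ
  have ha1 : a ≤ 1 := ha.trans hα.le_one
  refine ⟨2 * K + 3, by linarith, fun n hn => ?_⟩
  have hn' : (1 : ℝ) ≤ n := by exact_mod_cast hn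
  have hn0 : (0 : ℝ) < n := by linarith
  -- About `n^(1-a)` slabs of inner width `n^a`. The given `ω` may be too large to invert matrices
  -- of size `n^a` within `n^(1+a)` steps; the exponent `3 - a` tied to `a` is not.
  set s := ⌈(n : ℝ) ^ (1 - a)⌉₊
  have hs1 : (n : ℝ) ^ (1 - a) ≤ s := Nat.le_ceil _
  have h1 : (1 : ℝ) ≤ (n : ℝ) ^ (1 - a) := Real.one_le_rpow hn' (by linarith)
  have hs2 : (s : ℝ) ≤ 2 * (n : ℝ) ^ (1 - a) := by
    have := Nat.ceil_lt_add_one (by linarith : 0 ≤ (n : ℝ) ^ (1 - a))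
    linarith
  have hk : n ≤ s * ⌈(n : ℝ) ^ a⌉₊ := by
    have : (n : ℝ) ≤ s * ⌈(n : ℝ) ^ a⌉₊ := by
      calc (n : ℝ) = (n : ℝ) ^ (1 - a) * (n : ℝ) ^ a := by
            rw [← Real.rpow_add hn0]; simp
        _ ≤ _ := by
            gcongr
            exact Nat.le_ceil _
    exact_mod_cast this
  refine ((hK n hn).inner s).mono le_rfl hk le_rfl ?_
  have h3 : (n : ℝ) * n ≤ (n : ℝ) ^ (2 + δ) := by
    rw [← pow_two, ← Real.rpow_two]
    exact Real.rpow_le_rpow_of_exponent_le hn' (by linarith)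
  have h4 : (n : ℝ) ^ (3 - a + δ) = (n : ℝ) ^ (1 - a) * (n : ℝ) ^ (2 + δ) := by
    rw [← Real.rpow_add hn0]; congr 1; ring
  have h5 : (1 : ℝ) ≤ (n : ℝ) ^ (3 - a + δ) := Real.one_le_rpow hn' (by linarith)
  calc (s : ℝ) * (K * (n : ℝ) ^ (2 + δ) + n * n) + 1
      ≤ (2 * (n : ℝ) ^ (1 - a)) * (K * (n : ℝ) ^ (2 + δ) + (n : ℝ) ^ (2 + δ)) +
        (n : ℝ) ^ (3 - a + δ) := by gcongr
    _ = (2 * K + 3) * (n : ℝ) ^ (3 - a + δ) := by rw [h4]; ring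

/-- Rectangular products by interpolation between the two exponents. -/
theorem exists_mulCost_block {ω α a δ : ℝ} (hω : IsMatMulExponent ω) (hα : IsDualExponent α)
    (ha : a ≤ α) (hδ : 0 < δ) :
    ∃ K : ℝ, 0 ≤ K ∧ ∀ x y : ℕ, 1 ≤ x → 1 ≤ y →
      MulCost (x * y) (x * ⌈(y : ℝ) ^ a⌉₊) (x * y) (K * ((x : ℝ) ^ ω * (y : ℝ) ^ (2 + δ))) := by
  have hω2 := hω.two_le
  obtain ⟨K, hK0, hK⟩ := hα.mulCost ha hδ
  obtain ⟨L, hL⟩ := hω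
  have hL1 : 1 ≤ L := by simpa using (hL 1 le_rfl).le le_rfl
  refine ⟨L * (17 + 2 * K) + 2, by positivity, fun x y hx hy => ?_⟩
  have hx' : (1 : ℝ) ≤ x := by exact_mod_cast hx
  have hy' : (1 : ℝ) ≤ y := by exact_mod_cast hy
  refine (MulCost.block (hL x hx) (hK y hy)).mono le_rfl le_rfl le_rfl ?_
  have h1 : (1 : ℝ) ≤ (x : ℝ) ^ ω := Real.one_le_rpow hx' (by linarith)
  have h2 : (1 : ℝ) ≤ (y : ℝ) ^ (2 + δ) := Real.one_le_rpow hy' (by linarith)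
  have h3 : (y : ℝ) ^ 2 ≤ (y : ℝ) ^ (2 + δ) := by
    rw [← Real.rpow_two]
    exact Real.rpow_le_rpow_of_exponent_le hy' (by linarith)
  have h4 : ((⌈(y : ℝ) ^ a⌉₊ : ℕ) : ℝ) ≤ y := by
    exact_mod_cast ceil_rpow_le (ha.trans hα.le_one) hy
  have h5 : (y : ℝ) * ⌈(y : ℝ) ^ a⌉₊ ≤ (y : ℝ) ^ (2 + δ) := by
    refine le_trans ?_ h3
    rw [pow_two]
    gcongr
  have h6 : (1 : ℝ) ≤ (x : ℝ) ^ ω * (y : ℝ) ^ (2 + δ) := one_le_mul_of_one_le_of_one_le h1 h2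
  calc L * (x : ℝ) ^ ω * (10 * (y * ⌈(y : ℝ) ^ a⌉₊) + 7 * (y : ℝ) ^ 2 +
        2 * (K * (y : ℝ) ^ (2 + δ))) + 2
      ≤ L * (x : ℝ) ^ ω * (10 * (y : ℝ) ^ (2 + δ) + 7 * (y : ℝ) ^ (2 + δ) +
        2 * (K * (y : ℝ) ^ (2 + δ))) + 2 * ((x : ℝ) ^ ω * (y : ℝ) ^ (2 + δ)) := by
          gcongr
          linarith
    _ = _ := by ring

/-! ### The cost of an update of low rank -/

theorem two_rpow_nat (x : ℝ) (j : ℕ) : ((2 : ℝ) ^ j) ^ x = 2 ^ (x * j) := by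
  rw [← Real.rpow_natCast, ← Real.rpow_mul (by norm_num), mul_comm]

/-- The dimension `n` rounded up to a power of two is `2 ^ levels n`, with room for `2 n`. -/
def levels (n : ℕ) : ℕ := Nat.clog 2 (2 * n)

theorem two_mul_le_two_pow_levels (n : ℕ) : 2 * n ≤ 2 ^ levels n :=
  Nat.le_pow_clog one_lt_two _

theorem two_pow_levels_le {n : ℕ} (hn : 1 ≤ n) : 2 ^ levels n ≤ 4 * n := by
  have h := Nat.pow_pred_clog_lt_self one_lt_two (by omega : 1 < 2 * n)
  have hpos : 0 < levels n := Nat.clog_pos one_lt_two (by omega)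
  obtain ⟨j, hj⟩ := Nat.exists_eq_succ_of_ne_zero hpos.ne'
  change 2 ^ (levels n - 1) < 2 * n at h
  rw [hj] at h ⊢
  simp only [Nat.succ_eq_add_one, Nat.add_sub_cancel] at h
  rw [Nat.succ_eq_add_one, pow_succ]
  omega

/-- A product of inner size `2^j` uses outer blocks of size `2^(p-q)` and inner ones of size `2^q`,
with `q` maximal subject to `p - q + a q ≥ j`. If `q = p`, the lower bound on `j` gives the second
alternative. If `q < p`, maximality ties `j` to `q` up to rounding, and the comparison of `ω - 1/2`
with `2 - a/2 + 2 δ` decides which end of the interpolation dominates. The term `-δ (p - j)` is the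
decay that makes the later sum over levels geometric. -/
theorem interp_exponent {ω a δ e : ℝ} {p q j : ℕ} (ha0 : 0 < a) (ha1 : a ≤ 1)
    (hδ0 : 0 < δ) (he : e ≤ δ) (he0 : 0 < e)
    (hqp : q ≤ p) (hq : ∀ k, k ≤ p → (j : ℝ) ≤ p - k + a * k → k ≤ q) (hjp : j ≤ p)
    (hj : (a - e) * ((p : ℝ) - 2) ≤ j) :
    ω * (p - q) + (2 + δ) * q - j / 2 ≤ p * (ω - 1 / 2) - δ * (p - j) + 1 ∨
      ω * (p - q) + (2 + δ) * q - j / 2 ≤ p * (2 - a / 2 + 2 * δ) + 1 := by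
  have hjp' : (j : ℝ) ≤ p := by exact_mod_cast hjp
  have hp0 : (0 : ℝ) ≤ p := by positivity
  have hq0 : (0 : ℝ) ≤ q := by positivity
  have hqp' : (q : ℝ) ≤ p := by exact_mod_cast hqp
  rcases hqp.eq_or_lt with h | h
  · right
    subst h
    nlinarith
  · have h1 : ¬ (j : ℝ) ≤ p - (q + 1 : ℕ) + a * (q + 1 : ℕ) := by
      intro hc
      have := hq (q + 1) h hc
      omega
    push_cast at h1
    -- The choice `k = p - j` is always admissible, hence at most the maximal one.
    have h2 : (p : ℝ) - j ≤ q := by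
      have := hq (p - j) (Nat.sub_le _ _) (by
        rw [Nat.cast_sub hjp]
        nlinarith)
      have : ((p - j : ℕ) : ℝ) ≤ q := by exact_mod_cast this
      rwa [Nat.cast_sub hjp] at this
    rcases le_total (2 - a / 2 + 2 * δ) (ω - 1 / 2) with h3 | h3
    · left
      nlinarith
    · right
      nlinarith

/-- The three summands are the large product, the entrywise work, and the inversion together with
the `2^j × 2^j` by `2^j × n` product. The factor `√(2^j)` on the right is what the amortization
gains at level `j`. -/
theorem exists_levelCost {ω α a δ e : ℝ} (hω : IsMatMulExponent ω) (hα : IsDualExponent α)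
    (ha0 : 0 < a) (ha : a ≤ α) (hδ0 : 0 < δ) (hδ1 : δ ≤ 1 / 2) (he0 : 0 < e) (he : e ≤ δ)
    (hea : e < a) :
    ∃ K : ℝ, 0 ≤ K ∧ ∀ n : ℕ, 1 ≤ n → ∃ c : ℕ → ℝ,
      (∀ j ≤ levels n, MulCost n (2 ^ j) n (c j)) ∧
      ∀ j ≤ levels n, (n : ℝ) ^ (a - e) ≤ 2 ^ j →
        c j + (2 ^ levels n) ^ 2 + 2 ^ (levels n - j) * ((2 : ℝ) ^ j) ^ ω ≤
          K * Real.sqrt (2 ^ j) * (2 ^ (levels n * (ω - 1 / 2) - δ * (levels n - j)) +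
            2 ^ (levels n * (2 - a / 2 + 2 * δ))) := by
  classical
  have hω2 := hω.two_le
  have ha1 : a ≤ 1 := ha.trans hα.le_one
  obtain ⟨K, hK0, hK⟩ := exists_mulCost_block hω hα ha hδ0
  refine ⟨2 * K + 3, by linarith, fun n hn => ?_⟩
  have hN := two_mul_le_two_pow_levels n
  have hN4 := two_pow_levels_le hn
  generalize levels n = p at hN hN4 ⊢
  let q : ℕ → ℕ := fun j => Nat.findGreatest (fun k => (j : ℝ) ≤ p - k + a * k) p
  have hqp : ∀ j, q j ≤ p := fun j => Nat.findGreatest_le p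
  refine ⟨fun j => K * (2 : ℝ) ^ (ω * (p - q j) + (2 + δ) * q j), fun j hj => ?_, fun j hj hnj => ?_⟩
  · have hjp : (j : ℝ) ≤ p := by exact_mod_cast hj
    have h1 : (j : ℝ) ≤ p - q j + a * q j := by
      have := Nat.findGreatest_spec (P := fun k : ℕ => (j : ℝ) ≤ p - k + a * k) (Nat.zero_le p)
        (by simpa using hjp)
      exact this
    have h2 : 2 ^ j ≤ 2 ^ (p - q j) * ⌈((2 ^ q j : ℕ) : ℝ) ^ a⌉₊ := by
      have : (2 : ℝ) ^ j ≤ 2 ^ (p - q j) * ⌈((2 ^ q j : ℕ) : ℝ) ^ a⌉₊ := by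
        refine le_trans ?_ (mul_le_mul_of_nonneg_left (Nat.le_ceil _) (by positivity))
        push_cast
        rw [two_rpow_nat, ← Real.rpow_natCast, ← Real.rpow_natCast, ← Real.rpow_add (by norm_num)]
        refine Real.rpow_le_rpow_of_exponent_le (by norm_num) ?_
        rw [Nat.cast_sub (hqp j)]
        exact h1
      exact_mod_cast this
    have h3 : 2 ^ (p - q j) * 2 ^ q j = 2 ^ p := by
      rw [← pow_add, Nat.sub_add_cancel (hqp j)]
    have h4 := hK (2 ^ (p - q j)) (2 ^ q j) Nat.one_le_two_pow Nat.one_le_two_pow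
    refine h4.mono (by rw [h3]; omega) h2 (by rw [h3]; omega) ?_
    push_cast
    rw [two_rpow_nat, two_rpow_nat, ← Real.rpow_add (by norm_num), Nat.cast_sub (hqp j)]
  · have hjp : (j : ℝ) ≤ p := by exact_mod_cast hj
    have hn1 : (1 : ℝ) ≤ n := by exact_mod_cast hn
    -- Since `2^p ≤ 4 n`, one has `2^(p-2) ≤ n`.
    have h1 : (a - e) * ((p : ℝ) - 2) ≤ j := by
      have h2 : (2 : ℝ) ^ ((a - e) * ((p : ℝ) - 2)) ≤ 2 ^ (j : ℝ) := by
        rw [Real.rpow_natCast]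
        refine le_trans ?_ hnj
        rw [mul_comm, Real.rpow_mul (by norm_num)]
        refine Real.rpow_le_rpow (by positivity) ?_ (by linarith)
        rw [Real.rpow_sub (by norm_num), Real.rpow_natCast, div_le_iff₀ (by positivity)]
        have : (2 : ℝ) ^ p ≤ 4 * n := by exact_mod_cast hN4
        norm_num
        linarith
      exact (Real.rpow_le_rpow_left_iff (by norm_num)).1 h2
    have hsq : Real.sqrt (2 ^ j) = 2 ^ ((j : ℝ) / 2) := by
      rw [Real.sqrt_eq_rpow, two_rpow_nat]
      congr 1
      ring
    rw [hsq]
    set B : ℝ := 2 ^ ((p : ℝ) * (ω - 1 / 2) - δ * (p - j)) with hB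
    set C : ℝ := 2 ^ ((p : ℝ) * (2 - a / 2 + 2 * δ)) with hC
    have hB0 : 0 < B := by positivity
    have hC0 : 0 < C := by positivity
    set s : ℝ := 2 ^ ((j : ℝ) / 2) with hs
    have hs0 : 0 < s := by positivity
    have toB : ∀ x : ℝ, x - j / 2 ≤ p * (ω - 1 / 2) - δ * (p - j) + 1 → (2 : ℝ) ^ x ≤ 2 * (s * B) := by
      intro x hx
      calc (2 : ℝ) ^ x ≤ 2 ^ (1 + ((j : ℝ) / 2 + (p * (ω - 1 / 2) - δ * (p - j)))) :=
            Real.rpow_le_rpow_of_exponent_le (by norm_num) (by linarith)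
        _ = 2 * (s * B) := by
            rw [Real.rpow_add (by norm_num), Real.rpow_add (by norm_num), Real.rpow_one]
    have toC : ∀ x : ℝ, x - j / 2 ≤ p * (2 - a / 2 + 2 * δ) + 1 → (2 : ℝ) ^ x ≤ 2 * (s * C) := by
      intro x hx
      calc (2 : ℝ) ^ x ≤ 2 ^ (1 + ((j : ℝ) / 2 + (p * (2 - a / 2 + 2 * δ)))) :=
            Real.rpow_le_rpow_of_exponent_le (by norm_num) (by linarith)
        _ = 2 * (s * C) := by
            rw [Real.rpow_add (by norm_num), Real.rpow_add (by norm_num), Real.rpow_one]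
    have t1 : (2 : ℝ) ^ (ω * (p - q j) + (2 + δ) * q j) ≤ 2 * (s * (B + C)) := by
      have hsB : 0 < s * B := by positivity
      have hsC : 0 < s * C := by positivity
      rcases interp_exponent ha0 ha1 hδ0 he he0 (hqp j)
        (fun k hk hk' => Nat.le_findGreatest hk hk') hj h1 with h | h
      · have := toB _ h
        linarith
      · have := toC _ h
        linarith
    have t2 : ((2 : ℝ) ^ p) ^ 2 ≤ 2 * (s * C) := by
      rw [← Real.rpow_two, two_rpow_nat]
      apply toC
      nlinarith [(Nat.cast_nonneg p : (0 : ℝ) ≤ p)]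
    -- The exponents differ by `(p - j) (ω - 3/2 - δ)`, nonnegative because `ω ≥ 2` and `δ ≤ 1/2`.
    have t3 : (2 : ℝ) ^ (p - j) * ((2 : ℝ) ^ j) ^ ω ≤ s * B := by
      rw [two_rpow_nat, ← Real.rpow_natCast, ← Real.rpow_add (by norm_num), Nat.cast_sub hj, hs, hB,
        ← Real.rpow_add (by norm_num)]
      refine Real.rpow_le_rpow_of_exponent_le (by norm_num) ?_
      nlinarith
    have hsB : 0 < s * B := by positivity
    have hsC : 0 < s * C := by positivity
    calc K * (2 : ℝ) ^ (ω * (p - q j) + (2 + δ) * q j) + (2 ^ p) ^ 2 +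
          2 ^ (p - j) * ((2 : ℝ) ^ j) ^ ω
        ≤ K * (2 * (s * (B + C))) + 2 * (s * C) + s * B := by gcongr
      _ ≤ (2 * K + 3) * s * (B + C) := by linarith

theorem sum_two_rpow_le {δ : ℝ} (hδ : 0 < δ) (p : ℕ) :
    ∑ j ∈ Finset.range (p + 1), (2 : ℝ) ^ (-δ * (p - j)) ≤ 1 / (1 - 2 ^ (-δ)) := by
  have h1 : (2 : ℝ) ^ (-δ) < 1 := Real.rpow_lt_one_of_one_lt_of_neg (by norm_num) (by linarith)
  have h0 : (0 : ℝ) ≤ 2 ^ (-δ) := by positivity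
  rw [← Finset.sum_range_reflect]
  have : ∀ j ∈ Finset.range (p + 1), (2 : ℝ) ^ (-δ * ((p : ℝ) - (p + 1 - 1 - j : ℕ))) =
      ((2 : ℝ) ^ (-δ)) ^ j := by
    intro j hj
    have hj' : j ≤ p := Nat.lt_succ_iff.1 (Finset.mem_range.1 hj)
    rw [Nat.add_sub_cancel, Nat.cast_sub hj', ← Real.rpow_natCast, ← Real.rpow_mul (by norm_num)]
    congr 1
    ring
  rw [Finset.sum_congr rfl this, one_div, ← tsum_geometric_of_lt_one h0 h1]
  exact (summable_geometric_of_lt_one h0 h1).sum_le_tsum _ fun _ _ => by positivity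

/-- The first terms form a geometric series, so `n^β` gains no logarithm. The second terms do not
decay; their number `p + 1` is absorbed by an extra `n^δ`. -/
theorem exists_sum_level_le (β γ : ℝ) {δ : ℝ} (hβ : 0 ≤ β) (hγ : 0 ≤ γ) (hδ : 0 < δ) :
    ∃ K : ℝ, 0 ≤ K ∧ ∀ n : ℕ, 1 ≤ n →
      ∑ j ∈ Finset.range (levels n + 1), ((2 : ℝ) ^ (levels n * β - δ * (levels n - j)) +
          2 ^ (levels n * γ)) ≤ K * ((n : ℝ) ^ β + (n : ℝ) ^ (γ + δ)) := by
  have h1 : (2 : ℝ) ^ (-δ) < 1 := Real.rpow_lt_one_of_one_lt_of_neg (by norm_num) (by linarith)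
  have h1' : 0 < 1 / (1 - (2 : ℝ) ^ (-δ)) := by
    have : 0 < 1 - (2 : ℝ) ^ (-δ) := by linarith
    positivity
  have hl2 : 0 < Real.log 2 := Real.log_pos (by norm_num)
  set L : ℝ := 1 + 1 / (δ * Real.log 2) with hL
  have hL0 : 0 < L := by positivity
  refine ⟨1 / (1 - (2 : ℝ) ^ (-δ)) * 4 ^ β + L * 4 ^ (γ + δ), by positivity, fun n hn => ?_⟩
  have hN4 := two_pow_levels_le hn
  generalize levels n = p at hN4 ⊢
  have hN : (2 : ℝ) ^ p ≤ 4 * n := by exact_mod_cast hN4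
  have hpow : ∀ x : ℝ, 0 ≤ x → (2 : ℝ) ^ (p * x) ≤ 4 ^ x * (n : ℝ) ^ x := by
    intro x hx
    rw [mul_comm (p : ℝ), ← two_rpow_nat, ← Real.mul_rpow (by norm_num) (by positivity)]
    exact Real.rpow_le_rpow (by positivity) hN hx
  have hp : (p : ℝ) + 1 ≤ L * 2 ^ (p * δ) := by
    have h2 : (p : ℝ) * (δ * Real.log 2) + 1 ≤ 2 ^ (p * δ) := by
      rw [Real.rpow_def_of_pos (by norm_num)]
      have := Real.add_one_le_exp (Real.log 2 * (p * δ))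
      linarith
    have h3 : (1 : ℝ) ≤ 2 ^ (p * δ) := Real.one_le_rpow (by norm_num) (by positivity)
    have h4 : (p : ℝ) ≤ 1 / (δ * Real.log 2) * 2 ^ (p * δ) := by
      rw [one_div, inv_mul_eq_div, le_div_iff₀ (by positivity)]
      linarith
    rw [hL, add_mul]
    linarith
  rw [Finset.sum_add_distrib]
  have e1 : ∑ j ∈ Finset.range (p + 1), (2 : ℝ) ^ (p * β - δ * (p - j)) =
      2 ^ (p * β) * ∑ j ∈ Finset.range (p + 1), (2 : ℝ) ^ (-δ * (p - j)) := by
    rw [Finset.mul_sum]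
    refine Finset.sum_congr rfl fun j _ => ?_
    rw [← Real.rpow_add (by norm_num)]
    congr 1
    ring
  rw [e1, Finset.sum_const, Finset.card_range, nsmul_eq_mul]
  push_cast
  have s1 := mul_le_mul (hpow β hβ) (sum_two_rpow_le hδ p)
    (Finset.sum_nonneg fun _ _ => by positivity) (by positivity)
  have s2 : ((p : ℝ) + 1) * 2 ^ (p * γ) ≤ L * (4 ^ (γ + δ) * (n : ℝ) ^ (γ + δ)) := by
    calc ((p : ℝ) + 1) * 2 ^ (p * γ) ≤ (L * 2 ^ (p * δ)) * 2 ^ (p * γ) := by gcongr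
      _ = L * 2 ^ (p * (γ + δ)) := by
          rw [mul_assoc, ← Real.rpow_add (by norm_num)]
          congr 2
          ring
      _ ≤ _ := by
          gcongr
          exact hpow _ (by linarith)
  have p1 : 0 ≤ 1 / (1 - (2 : ℝ) ^ (-δ)) * 4 ^ β * (n : ℝ) ^ (γ + δ) := by positivity
  have p2 : 0 ≤ L * 4 ^ (γ + δ) * (n : ℝ) ^ β := by positivity
  linarith

end ProjMaint


/-! ### Counting rebuilds with a Ky Fan potential. -/

namespace ProjMaint

/-! ### Amortization -/

section Amortization

variable {X : Type} [Fintype X]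

/-- The sum of the `R` largest entries of a nonnegative vector. -/
noncomputable def kyFan (R : ℕ) (ψ : X → ℝ) : ℝ :=
  ((Finset.univ : Finset (Finset X)).filter fun S => S.card ≤ R).sup' ⟨∅, by simp⟩
    fun S => ∑ x ∈ S, ψ x

theorem le_kyFan {R : ℕ} (ψ : X → ℝ) {S : Finset X} (hS : S.card ≤ R) :
    ∑ x ∈ S, ψ x ≤ kyFan R ψ :=
  Finset.le_sup' (f := fun S : Finset X => ∑ x ∈ S, ψ x) (by simpa using hS)

theorem kyFan_le {R : ℕ} {ψ : X → ℝ} {b : ℝ} (h : ∀ S : Finset X, S.card ≤ R → ∑ x ∈ S, ψ x ≤ b) :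
    kyFan R ψ ≤ b :=
  Finset.sup'_le _ _ fun S hS => h S (by simpa using hS)

theorem kyFan_nonneg (R : ℕ) (ψ : X → ℝ) : 0 ≤ kyFan R ψ := by
  simpa using le_kyFan (R := R) ψ (S := ∅) (by simp)

theorem kyFan_mono {R : ℕ} {ψ φ : X → ℝ} (h : ∀ x, ψ x ≤ φ x) : kyFan R ψ ≤ kyFan R φ :=
  kyFan_le fun _ hS => (Finset.sum_le_sum fun x _ => h x).trans (le_kyFan φ hS)

/-- The relative deviation of `z` from `w`, cut off at `ε`. -/
noncomputable def deviation (ε : ℝ) (w z : X → ℝ) (x : X) : ℝ := min |z x / w x - 1| ε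

/-- If `z / w ≤ 2`, a relative change of `z` is at most doubled when measured against `w`. If `z / w
> 2`, the deviation has already reached the cutoff `ε ≤ 1` and cannot grow. -/
theorem deviation_step {ε w z z' : ℝ} (hε1 : ε ≤ 1) (hw : 0 < w) (hz : 0 < z) :
    min |z' / w - 1| ε ≤ min |z / w - 1| ε + 2 * |(z' - z) / z| := by
  have hδ : 0 ≤ |(z' - z) / z| := abs_nonneg _
  have hq : 0 < z / w := by positivity
  rcases le_or_gt (z / w) 2 with h | h
  · have e : z' / w - 1 = (z / w - 1) + (z / w) * ((z' - z) / z) := by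
      field_simp
      ring
    have h1 : |z' / w - 1| ≤ |z / w - 1| + 2 * |(z' - z) / z| := by
      rw [e]
      refine (abs_add_le _ _).trans ?_
      rw [abs_mul, abs_of_pos hq]
      gcongr
    rcases min_cases |z / w - 1| ε with ⟨h2, _⟩ | ⟨h2, _⟩
    · rw [h2]; exact (min_le_left _ _).trans h1
    · rw [h2]; exact (min_le_right _ _).trans (by linarith)
  · have h2 : min |z / w - 1| ε = ε := min_eq_right (by
      rw [abs_of_pos (by linarith)]; linarith)
    rw [h2]
    exact (min_le_right _ _).trans (by linarith)

/-- Cauchy-Schwarz on at most `R` entries turns the `ℓ₂` bound `C` into the `ℓ₁` bound `√R C`. -/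
theorem kyFan_deviation_step {ε C : ℝ} {R : ℕ} {w z z' : X → ℝ} (hε1 : ε ≤ 1)
    (hw : ∀ x, 0 < w x) (hz : ∀ x, 0 < z x) (hC : 0 ≤ C)
    (h : ∑ x, ((z' x - z x) / z x) ^ 2 ≤ C ^ 2) :
    kyFan R (deviation ε w z') ≤ kyFan R (deviation ε w z) + 2 * (Real.sqrt R * C) := by
  refine kyFan_le fun S hS => ?_
  have h1 : ∑ x ∈ S, |(z' x - z x) / z x| ≤ Real.sqrt R * C := by
    refine abs_le_of_sq_le_sq' ?_ (by positivity) |>.2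
    rw [mul_pow, Real.sq_sqrt (by positivity)]
    refine (sq_sum_le_card_mul_sum_sq (s := S)).trans ?_
    have h2 : ∑ x ∈ S, |(z' x - z x) / z x| ^ 2 ≤ C ^ 2 := by
      simp only [sq_abs]
      exact (Finset.sum_le_sum_of_subset_of_nonneg (Finset.subset_univ S)
        fun _ _ _ => sq_nonneg _).trans h
    have h3 : (S.card : ℝ) ≤ R := by exact_mod_cast hS
    exact mul_le_mul h3 h2 (Finset.sum_nonneg fun _ _ => by positivity) (by positivity)
  calc ∑ x ∈ S, deviation ε w z' x
      ≤ ∑ x ∈ S, (deviation ε w z x + 2 * |(z' x - z x) / z x|) :=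
        Finset.sum_le_sum fun x _ => deviation_step hε1 (hw x) (hz x)
    _ = ∑ x ∈ S, deviation ε w z x + 2 * ∑ x ∈ S, |(z' x - z x) / z x| := by
        rw [Finset.sum_add_distrib, Finset.mul_sum]
    _ ≤ _ := by
        have := le_kyFan (deviation ε w z) hS
        linarith

/-- The stored vector `w` is replaced by `w'`: all entries with deviation more than `τ` are set to
the new values `z`, and at least `R` entries have deviation more than `τ + g`. -/
def Rebuild (R : ℕ) (ε g : ℝ) (w z w' : X → ℝ) : Prop :=
  ∃ (τ : ℝ) (S V : Finset X), 0 ≤ τ ∧ τ + g ≤ ε ∧ (∀ x ∈ S, w' x = z x) ∧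
    (∀ x ∉ S, w' x = w x ∧ |z x / w x - 1| ≤ τ) ∧ R ≤ V.card ∧
    ∀ x ∈ V, τ + g ≤ |z x / w x - 1|

variable {R R' : ℕ} {ε g : ℝ} {w z w' : X → ℝ}

/-- A rebuilt entry has deviation zero and the others do not change, so rebuilds at other levels
never hurt the potential for `R`. -/
theorem Rebuild.kyFan_le (h : Rebuild R' ε g w z w') (hε : 0 ≤ ε) (hz : ∀ x, 0 < z x) :
    kyFan R (deviation ε w' z) ≤ kyFan R (deviation ε w z) := by
  obtain ⟨τ, S, V, hτ, hτε, h1, h2, -, -⟩ := h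
  refine kyFan_mono fun x => ?_
  by_cases hx : x ∈ S
  · rw [deviation, h1 x hx, div_self (hz x).ne', sub_self, abs_zero, min_eq_left hε]
    exact le_min (abs_nonneg _) hε
  · rw [deviation, (h2 x hx).1]
    exact le_rfl

/-- Afterwards every deviation is at most `τ`, before it `R` of them were at least `τ + g`; both
remain below the cutoff since `τ + g ≤ ε`. -/
theorem Rebuild.kyFan_add_le (h : Rebuild R ε g w z w') (hε : 0 ≤ ε) (hz : ∀ x, 0 < z x) :
    kyFan R (deviation ε w' z) + R * g ≤ kyFan R (deviation ε w z) := by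
  obtain ⟨τ, S, V, hτ, hτε, h1, h2, hV, h3⟩ := h
  obtain ⟨V', hV', hcard⟩ := Finset.exists_subset_card_eq hV
  have e1 : kyFan R (deviation ε w' z) ≤ R * τ := by
    refine ProjMaint.kyFan_le fun U hU => ?_
    have : ∀ x ∈ U, deviation ε w' z x ≤ τ := by
      intro x _
      by_cases hx : x ∈ S
      · rw [deviation, h1 x hx, div_self (hz x).ne', sub_self, abs_zero, min_eq_left hε]
        exact hτ
      · rw [deviation, (h2 x hx).1]
        exact (min_le_left _ _).trans (h2 x hx).2
    refine (Finset.sum_le_card_nsmul U _ τ this).trans ?_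
    rw [nsmul_eq_mul]
    gcongr
  have e2 : R * (τ + g) ≤ kyFan R (deviation ε w z) := by
    refine le_trans ?_ (le_kyFan (R := R) (deviation ε w z) hcard.le)
    have := Finset.card_nsmul_le_sum V' (deviation ε w z) (τ + g)
      fun x hx => le_min (h3 x (hV' hx)) hτε
    rwa [hcard, nsmul_eq_mul] at this
  linarith

open Classical in
-- The potential starts at zero, stays nonnegative, rises by at most `2 √R C` per update and falls
-- by `R g` at every counted rebuild.
theorem card_rebuild_le {w z : ℕ → X → ℝ} {T : ℕ} {C : ℝ} (hR : 1 ≤ R) (hε : 0 ≤ ε) (hε1 : ε ≤ 1)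
    (hC : 0 ≤ C) (h0 : w 0 = z 0) (hw : ∀ k ≤ T, ∀ x, 0 < w k x) (hz : ∀ k ≤ T, ∀ x, 0 < z k x)
    (hstep : ∀ k < T, w (k + 1) = w k ∨ ∃ R', Rebuild R' ε g (w k) (z (k + 1)) (w (k + 1)))
    (hmove : ∀ k < T, ∑ x, ((z (k + 1) x - z k x) / z k x) ^ 2 ≤ C ^ 2) :
    (((Finset.range T).filter fun k => Rebuild R ε g (w k) (z (k + 1)) (w (k + 1))).card : ℝ) *
      (Real.sqrt R * g) ≤ 2 * T * C := by
  have main : ∀ t ≤ T, kyFan R (deviation ε (w t) (z t)) +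
      (((Finset.range t).filter fun k => Rebuild R ε g (w k) (z (k + 1)) (w (k + 1))).card : ℝ) *
      (R * g) ≤ t * (2 * (Real.sqrt R * C)) := by
    intro t
    induction t with
    | zero =>
      intro _
      have : kyFan R (deviation ε (w 0) (z 0)) ≤ 0 := by
        refine kyFan_le fun S _ => Finset.sum_nonpos fun x _ => ?_
        rw [deviation, h0, div_self (hz 0 (Nat.zero_le _) x).ne', sub_self, abs_zero]
        exact min_le_left _ _
      simpa using this
    | succ t ih =>
      intro ht
      have h1 := ih (by omega)
      have h2 := kyFan_deviation_step (R := R) hε1 (hw t (by omega)) (hz t (by omega)) hC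
        (hmove t (by omega))
      rw [Finset.range_add_one, Finset.filter_insert]
      push_cast
      split_ifs with hr
      · have h3 := hr.kyFan_add_le hε (hz (t + 1) ht)
        rw [Finset.card_insert_of_notMem (by simp)]
        push_cast
        linarith
      · have h3 : kyFan R (deviation ε (w (t + 1)) (z (t + 1))) ≤
            kyFan R (deviation ε (w t) (z (t + 1))) := by
          rcases hstep t (by omega) with h | ⟨R', h⟩
          · rw [h]
          · exact h.kyFan_le hε (hz (t + 1) ht)
        linarith
  have h1 := main T le_rfl
  have h2 := kyFan_nonneg R (deviation ε (w T) (z T))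
  have hR0 : (0 : ℝ) < R := by exact_mod_cast hR
  have hs : 0 < Real.sqrt R := Real.sqrt_pos.2 hR0
  have h3 : Real.sqrt R * Real.sqrt R = R := Real.mul_self_sqrt hR0.le
  generalize (((Finset.range T).filter fun k =>
    Rebuild R ε g (w k) (z (k + 1)) (w (k + 1))).card : ℝ) = E at h1 ⊢
  refine le_of_mul_le_mul_left ?_ hs
  calc Real.sqrt R * (E * (Real.sqrt R * g)) = E * ((Real.sqrt R * Real.sqrt R) * g) := by ring
    _ = E * (R * g) := by rw [h3]
    _ ≤ T * (2 * (Real.sqrt R * C)) := by linarith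
    _ = _ := by ring

/-- One update of the data structure: either the stored vector `w` is kept, or it is rebuilt at
some level `j`. -/
def UpdateStep (p r₀ : ℕ) (c₀ : ℝ) (cost : ℕ → ℝ) (ε : ℝ) (w z w' : X → ℝ) (t : ℝ) : Prop :=
  (w' = w ∧ t ≤ c₀) ∨ ∃ j ≤ p, r₀ < 2 ^ j ∧ Rebuild (2 ^ (j - 2)) ε (ε / (2 * p)) w z w' ∧
    t ≤ c₀ + cost j

/-- A separate potential counts the rebuilds of each level. The factor `8` is `2` from
`card_rebuild_le`, `2` from `√(2^(j-2)) = √(2^j) / 2` and `2` from `g = ε / (2 p)`. -/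
theorem sum_updateStep_le {p r₀ T : ℕ} {c₀ C : ℝ} {cost : ℕ → ℝ} {w z : ℕ → X → ℝ} {t : ℕ → ℝ}
    (hr₀ : 2 ≤ r₀) (hcost : ∀ j, 0 ≤ cost j) (hε : 0 < ε) (hε1 : ε ≤ 1)
    (hC : 0 ≤ C) (h0 : w 0 = z 0) (hw : ∀ k ≤ T, ∀ x, 0 < w k x) (hz : ∀ k ≤ T, ∀ x, 0 < z k x)
    (hstep : ∀ k < T, UpdateStep p r₀ c₀ cost ε (w k) (z (k + 1)) (w (k + 1)) (t k))
    (hmove : ∀ k < T, ∑ x, ((z (k + 1) x - z k x) / z k x) ^ 2 ≤ C ^ 2) :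
    ∑ k ∈ Finset.range T, t k ≤ T * c₀ + 8 * p * T * (C / ε) *
      ∑ j ∈ (Finset.range (p + 1)).filter (fun j => r₀ < 2 ^ j), cost j / Real.sqrt (2 ^ j) := by
  classical
  set g := ε / (2 * p) with hg
  set J := (Finset.range (p + 1)).filter (fun j => r₀ < 2 ^ j)
  let Ev : ℕ → ℕ → Prop := fun j k => Rebuild (2 ^ (j - 2)) ε g (w k) (z (k + 1)) (w (k + 1))
  have h1 : ∀ k ∈ Finset.range T, t k ≤ c₀ + ∑ j ∈ J, if Ev j k then cost j else 0 := by
    intro k hk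
    have hnn : ∀ j ∈ J, 0 ≤ if Ev j k then cost j else 0 := by
      intro j _
      split_ifs
      exacts [hcost j, le_rfl]
    rcases hstep k (Finset.mem_range.1 hk) with ⟨-, h⟩ | ⟨j, hj, hj', hev, h⟩
    · have := Finset.sum_nonneg hnn
      linarith
    · have hjJ : j ∈ J := by simp [J, hj']; omega
      have := Finset.single_le_sum hnn hjJ
      rw [if_pos hev] at this
      linarith
  have hstep' : ∀ k < T, w (k + 1) = w k ∨
      ∃ R', Rebuild R' ε g (w k) (z (k + 1)) (w (k + 1)) := by
    intro k hk
    rcases hstep k hk with ⟨h, -⟩ | ⟨j, -, -, h, -⟩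
    exacts [Or.inl h, Or.inr ⟨_, h⟩]
  refine (Finset.sum_le_sum h1).trans ?_
  rw [Finset.sum_add_distrib, Finset.sum_const, Finset.card_range, nsmul_eq_mul, Finset.sum_comm,
    Finset.mul_sum]
  refine add_le_add le_rfl (Finset.sum_le_sum fun j hj => ?_)
  obtain ⟨hjp, hjr⟩ := Finset.mem_filter.1 hj
  -- From `2^j > r₀ ≥ 2`; so `j - 2` is a genuine difference.
  have hj2 : 2 ≤ j := by
    by_contra! hc
    interval_cases j <;> omega
  have hp : (0 : ℝ) < p := by
    have : 0 < p := by have := Finset.mem_range.1 hjp; omega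
    exact_mod_cast this
  rw [← Finset.sum_filter, Finset.sum_const, nsmul_eq_mul]
  have h2 := card_rebuild_le (R := 2 ^ (j - 2)) (g := g) Nat.one_le_two_pow hε.le hε1 hC h0 hw hz
    hstep' hmove
  have h3 : Real.sqrt ((2 ^ (j - 2) : ℕ) : ℝ) = Real.sqrt (2 ^ j) / 2 := by
    have : ((2 ^ (j - 2) : ℕ) : ℝ) = 2 ^ j / 2 ^ 2 := by
      push_cast
      rw [pow_sub₀ _ (by norm_num) hj2]
      rfl
    rw [this, Real.sqrt_div (by positivity), Real.sqrt_sq (by norm_num)]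
  rw [h3] at h2
  have hs : 0 < Real.sqrt ((2 : ℝ) ^ j) := Real.sqrt_pos.2 (by positivity)
  change ((Finset.range T).filter fun k => Ev j k).card * cost j ≤ _
  change (((Finset.range T).filter fun k => Ev j k).card : ℝ) * (Real.sqrt (2 ^ j) / 2 * g) ≤ _ at h2
  generalize (((Finset.range T).filter fun k => Ev j k).card : ℝ) = E at h2 ⊢
  have h4 : E ≤ 8 * p * T * (C / ε) / Real.sqrt (2 ^ j) := by
    rw [le_div_iff₀ hs]
    have h5 : E * Real.sqrt (2 ^ j) * ε ≤ 8 * p * T * C := by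
      have : E * (Real.sqrt (2 ^ j) / 2 * g) * (4 * p) = E * Real.sqrt (2 ^ j) * ε := by
        rw [hg]; field_simp; ring
      rw [← this]
      calc E * (Real.sqrt (2 ^ j) / 2 * g) * (4 * p) ≤ 2 * T * C * (4 * p) := by gcongr
        _ = _ := by ring
    rw [← mul_div_assoc, le_div_iff₀ hε]
    exact h5
  calc E * cost j ≤ 8 * p * T * (C / ε) / Real.sqrt (2 ^ j) * cost j :=
        mul_le_mul_of_nonneg_right h4 (hcost j)
    _ = _ := by ring

end Amortization

end ProjMaint


/-! ### Initialization and update as programs on the stored numbers. -/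

namespace ProjMaint

/-! ### Low-rank updates as derivations -/

section LowRank

open Matrix

variable {Ω : Type} {n r : ℕ} {D : Set Ω} {A : Set (Ω → ℝ)}

theorem computes_updateKernel (M : Ω → Matrix (Fin n) (Fin n) ℝ) (e : Ω → Fin n → ℝ)
    (S : Finset (Fin n)) (hS : S.card ≤ r) (hM : ents M ⊆ A) (he : ∀ i, (fun s => e s i) ∈ A) :
    Computes D A (ents fun s => updateKernel (M s) S (e s)) (3 * r ^ 2) := by
  have h1 : Computes D A (ents fun s => updateKernel (M s) S (e s))
      (Fintype.card S * Fintype.card S * 3) := by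
    refine Computes.ents_of_entry fun i j => ?_
    have h2 := Computes.one (D := D) _
      (.mul (he (i : Fin n)) (hM (mem_ents M (i : Fin n) (j : Fin n))))
    have h3 := Computes.one (D := D) (A := A) _ (.const ((1 : Matrix S S ℝ) i j))
    have h4 := (h3.union h2).trans (.one _ (.add (Or.inr (Or.inl rfl)) (Or.inr (Or.inr rfl))))
    refine (h4.congr ?_).mono_cost (by norm_num)
    rintro _ rfl
    refine ⟨_, rfl, fun s _ => ?_⟩
    simp [updateKernel, diagonal_mul]
  refine h1.mono_cost ?_
  have : (Fintype.card S : ℝ) ≤ r := by simpa using hS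
  nlinarith [(Nat.cast_nonneg (Fintype.card S) : (0 : ℝ) ≤ _)]

/-- The correction acts on columns independently, so one derivation serves for `Y = M` (a rebuild,
`m = n`) and for a single column `Y = M h` (a lazy answer, `m = 1`). -/
theorem computes_woodbury {μ : Type} [Fintype μ] {m : ℕ} (hμ : Fintype.card μ = m)
    (M : Ω → Matrix (Fin n) (Fin n) ℝ) (e : Ω → Fin n → ℝ) (Y : Ω → Matrix (Fin n) μ ℝ)
    (S : Finset (Fin n)) (hS : S.card ≤ r) {t t₁ t₂ : ℝ} (ht : InvCost r t)
    (ht₁ : MulCost r r m t₁) (ht₂ : MulCost n r m t₂)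
    (hM : ents M ⊆ A) (he : ∀ i, (fun s => e s i) ∈ A) (hY : ents Y ⊆ A)
    (hdet : ∀ s ∈ D, IsUnit (updateKernel (M s) S (e s)).det) :
    Computes D A (ents fun s => Y s - (M s).submatrix id (Subtype.val : S → Fin n) *
      ((updateKernel (M s) S (e s))⁻¹ * (diagonal (fun i : S => e s i) *
        (Y s).submatrix (Subtype.val : S → Fin n) id)))
      (3 * r ^ 2 + t + r * m + t₁ + t₂ + n * m) := by
  have hS' : Fintype.card S ≤ r := by simpa using hS
  have h1 := computes_updateKernel (D := D) M e S hS hM he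
  have h2 := ht.apply hS' D (A ∪ ents fun s => updateKernel (M s) S (e s))
    (fun s => updateKernel (M s) S (e s)) hdet Set.subset_union_right
  have h12 := h1.trans h2
  have h3 : Computes D A (ents fun s => diagonal (fun i : S => e s i) *
      (Y s).submatrix (Subtype.val : S → Fin n) id) (Fintype.card S * Fintype.card μ * 1) := by
    refine Computes.ents_of_entry fun i j => ?_
    refine (Computes.one _ (.mul (he (i : Fin n)) (hY (mem_ents Y (i : Fin n) j)))).congr ?_
    rintro _ rfl
    exact ⟨_, rfl, fun s _ => by simp [diagonal_mul]⟩
  have h123 := h12.union h3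
  have h4 := ht₁.apply hS' hS' hμ.le D (A ∪ ((ents fun s => (updateKernel (M s) S (e s))⁻¹) ∪
      ents fun s => diagonal (fun i : S => e s i) *
        (Y s).submatrix (Subtype.val : S → Fin n) id))
    (fun s => (updateKernel (M s) S (e s))⁻¹) (fun s => diagonal (fun i : S => e s i) *
      (Y s).submatrix (Subtype.val : S → Fin n) id)
    (fun _ h => Or.inr (Or.inl h)) (fun _ h => Or.inr (Or.inr h))
  have h1234 := h123.trans h4
  have h5 := ht₂.apply (Fintype.card_fin n).le hS' hμ.le D
    (A ∪ ents fun s => (updateKernel (M s) S (e s))⁻¹ * (diagonal (fun i : S => e s i) *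
        (Y s).submatrix (Subtype.val : S → Fin n) id))
    (fun s => (M s).submatrix id (Subtype.val : S → Fin n)) _
    (fun _ h => Or.inl (hM (ents_submatrix_subset M _ _ h))) (fun _ h => Or.inr h)
  have h12345 := h1234.trans h5
  have h6 := Computes.ents_sub (D := D) (X := Y)
    (A := A ∪ ents fun s => (M s).submatrix id (Subtype.val : S → Fin n) *
      ((updateKernel (M s) S (e s))⁻¹ * (diagonal (fun i : S => e s i) *
        (Y s).submatrix (Subtype.val : S → Fin n) id)))
    (Y := fun s => (M s).submatrix id (Subtype.val : S → Fin n) *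
      ((updateKernel (M s) S (e s))⁻¹ * (diagonal (fun i : S => e s i) *
        (Y s).submatrix (Subtype.val : S → Fin n) id)))
    (hY.trans Set.subset_union_left) Set.subset_union_right
  refine (h12345.trans h6).mono_cost ?_
  rw [hμ, Fintype.card_fin]
  have : (Fintype.card S : ℝ) ≤ r := by exact_mod_cast hS'
  have := mul_le_mul_of_nonneg_right this (Nat.cast_nonneg m : (0 : ℝ) ≤ m)
  linarith

/-- Updating the product of a matrix with a vector that changes on a set of size at most `r`. -/
theorem computes_mul_of_change (M : Ω → Matrix (Fin n) (Fin n) ℝ)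
    (X X' : Ω → Matrix (Fin n) Unit ℝ) (Q : Finset (Fin n)) (hQ : Q.card ≤ r)
    (hM : ents M ⊆ A) (hX : ents X ⊆ A) (hX' : ents X' ⊆ A) (hMX : (ents fun s => M s * X s) ⊆ A)
    (h : ∀ s ∈ D, ∀ i ∉ Q, X' s i () = X s i ()) :
    Computes D A (ents fun s => M s * X' s) (2 * (n * r) + 3 * n) := by
  have h1 := Computes.ents_sub (D := D) hX' hX
  have h2 := (MulCost.naive n r 1).apply (Fintype.card_fin n).le (κ := Q) (by simpa using hQ)
    (by simp) D (A ∪ ents fun s => X' s - X s)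
    (fun s => (M s).submatrix id (Subtype.val : Q → Fin n))
    (fun s => (X' s - X s).submatrix (Subtype.val : Q → Fin n) id)
    (fun _ h => Or.inl (hM (ents_submatrix_subset M _ _ h)))
    (fun _ h => Or.inr (ents_submatrix_subset (fun s => X' s - X s) _ _ h))
  have h3 := (h1.trans h2).trans (Computes.ents_add (hMX.trans Set.subset_union_left)
    Set.subset_union_right)
  refine (h3.congr ?_).mono_cost ?_
  · rintro _ ⟨⟨i, j⟩, rfl⟩
    refine ⟨_, mem_ents _ i j, fun s hs => ?_⟩
    simp only [Matrix.add_apply, mul_apply, submatrix_apply, Matrix.sub_apply, id]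
    rw [Finset.sum_coe_sort Q fun k => M s i k * (X' s k j - X s k j),
      Finset.sum_subset (Finset.subset_univ Q) fun k _ hk => ?_, ← Finset.sum_add_distrib]
    · exact Finset.sum_congr rfl fun k _ => by ring
    · rw [h s hs k hk, sub_self, mul_zero]
  · simp only [Fintype.card_fin, Fintype.card_unit]
    push_cast
    linarith

end LowRank

section Write

variable {Ω ρ : Type} {E : Setting Ω ρ} {Post : Ω → (ρ → ℝ) → ℝ → Prop} {D : Set Ω}
  {A : Set (Ω → ℝ)} {c : ℝ}

theorem Runs.write {κ : Type} [Fintype κ] (loc : κ → ρ) (hinj : Function.Injective loc)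
    (hloc : ∀ k, loc k ∉ Set.range E.scratch) (val : κ → Ω → ℝ) (hval : ∀ k, val k ∈ A)
    (h : ∀ x ∈ D, ∀ s : ρ → ℝ, (∀ k, s (loc k) = val k x) →
      (∀ r, r ∉ Set.range loc → r ∉ Set.range E.scratch → s r = E.mem x r) →
      Post x s (c + 2 * Fintype.card κ)) :
    Runs E Post D A c := by
  classical
  refine .done (Finset.univ.image loc) (Function.extend loc val fun _ _ => 0) ?_ ?_
  · intro w hw
    obtain ⟨k, _, rfl⟩ := Finset.mem_image.1 hw
    rw [hinj.extend_apply]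
    exact ⟨hval k, hloc k⟩
  · intro x hx s hs hs'
    rw [Finset.card_image_of_injective _ hinj, Finset.card_univ]
    refine h x hx s (fun k => ?_) fun r hr => hs' r (by simpa using hr)
    rw [hs _ (Finset.mem_image_of_mem _ (Finset.mem_univ k)), hinj.extend_apply]

theorem Runs.of_eq_empty (hD : D = ∅) : Runs E Post D A c :=
  .done ∅ (fun _ _ => 0) (by simp) (by simp [hD])

/-- Continuing a derivation with any larger set of available quantities. -/
theorem Runs.bind {B : Set (Ω → ℝ)} {k : ℝ} (hk : Computes D A B k)
    (h : ∀ A', A ⊆ A' → B ⊆ A' → Runs E Post D A' (c + k)) : Runs E Post D A c :=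
  .computes hk (h _ Set.subset_union_left Set.subset_union_right)

end Write

end ProjMaint


namespace ProjMaint

/-! ### The memory layout -/

section Layout

variable {d n : ℕ}

/-- A call of one of the two programs: the function `f`, the memory on which it is started, the
matrix, the accuracy, the stored vectors `w` and the arguments `z`. -/
structure Situation (d n : ℕ) where
  f : ℝ → ℝ
  mem : Reg d n → ℝ
  A : Matrix (Fin d) (Fin n) ℝ
  ε : ℝ
  w : Fin n ⊕ Fin n → ℝ
  z : Fin n ⊕ Fin n → ℝ

/-- The programs use the working registers with odd numbers as scratch space. -/
def setting (d n : ℕ) : Setting (Situation d n) (Reg d n) where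
  mem x := x.mem
  fn x := x.f
  scratch l := .work (2 * l + 1)
  scratch_injective := fun l m h => by simpa using h

/-- Indices of the numbers that are stored between calls. -/
abbrev StoreIdx (n : ℕ) : Type := (Fin n ⊕ Fin n) ⊕ (Fin n × Fin n) ⊕ Fin n

/-- Indices of the numbers that are returned. -/
abbrev OutIdx (n : ℕ) : Type := Fin n ⊕ Fin n ⊕ Fin n ⊕ Fin n

/-- The registers of the stored numbers. -/
def storeReg (k : StoreIdx n) : Reg d n := .work (2 * Encodable.encode k)

/-- The registers of the returned numbers. -/
def outReg : OutIdx n → Reg d n :=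
  Sum.elim .outU (Sum.elim .outV (Sum.elim .outF .outP))

theorem storeReg_injective : Function.Injective (storeReg : StoreIdx n → Reg d n) := by
  intro a b h
  have h2 : 2 * Encodable.encode a = 2 * Encodable.encode b := Reg.work.inj h
  exact Encodable.encode_injective (by omega)

theorem outReg_injective : Function.Injective (outReg : OutIdx n → Reg d n) := by
  rintro (a | a | a | a) (b | b | b | b) h <;> simp_all [outReg]

theorem storeReg_notMem_scratch (k : StoreIdx n) :
    (storeReg k : Reg d n) ∉ Set.range (setting d n).scratch := by
  rintro ⟨l, h⟩
  have h2 : 2 * l + 1 = 2 * Encodable.encode k := Reg.work.inj h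
  omega

theorem outReg_notMem_scratch (k : OutIdx n) :
    (outReg k : Reg d n) ∉ Set.range (setting d n).scratch := by
  rintro ⟨l, h⟩
  rcases k with k | k | k | k <;> exact Reg.noConfusion rfl rfl (heq_of_eq h)

theorem outReg_ne_storeReg (k : OutIdx n) (l : StoreIdx n) :
    (outReg k : Reg d n) ≠ storeReg l := by
  rcases k with k | k | k | k <;> simp [outReg, storeReg]

/-- The column `√Ũ f(ṽ)` for `w = (ũ, ṽ)`. -/
noncomputable def scaledColumn (f : ℝ → ℝ) (w : Fin n ⊕ Fin n → ℝ) : Matrix (Fin n) Unit ℝ :=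
  Matrix.of fun i _ => Real.sqrt (w (.inl i)) * f (w (.inr i))

/-- The stored numbers. -/
noncomputable def storeValue (A : Matrix (Fin d) (Fin n) ℝ) (f : ℝ → ℝ) (w : Fin n ⊕ Fin n → ℝ) :
    StoreIdx n → ℝ :=
  Sum.elim w (Sum.elim (fun p => coreMatrix A (fun i => w (.inl i)) p.1 p.2)
    fun i => (coreMatrix A (fun i => w (.inl i)) * scaledColumn f w) i ())

/-- The returned numbers. -/
noncomputable def outValue (A : Matrix (Fin d) (Fin n) ℝ) (f : ℝ → ℝ) (w : Fin n ⊕ Fin n → ℝ) :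
    OutIdx n → ℝ :=
  Sum.elim (fun i => w (.inl i)) (Sum.elim (fun i => w (.inr i)) (Sum.elim (fun i => f (w (.inr i)))
    fun i => Real.sqrt (w (.inl i)) *
      (coreMatrix A (fun i => w (.inl i)) * scaledColumn f w) i ()))

theorem bounds_of_deviation {ε w z : ℝ} (hw : 0 < w) (h : |z / w - 1| ≤ ε) :
    (1 - ε) * w ≤ z ∧ z ≤ (1 + ε) * w := by
  obtain ⟨h1, h2⟩ := abs_le.1 h
  constructor
  · rw [← le_div_iff₀ hw]; linarith
  · rw [← div_le_iff₀ hw]; linarith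

theorem correctOutput_of_outValue {f : ℝ → ℝ} {A : Matrix (Fin d) (Fin n) ℝ} {ε : ℝ}
    {w z : Fin n ⊕ Fin n → ℝ} {s : Reg d n → ℝ} (hw : ∀ x, 0 < w x)
    (hz : ∀ x, |z x / w x - 1| ≤ ε) (hs : ∀ k, s (outReg k) = outValue A f w k) :
    CorrectOutput f A ε (fun i => z (.inl i)) (fun i => z (.inr i)) s := by
  refine ⟨fun i => w (.inl i), fun i => w (.inr i), fun i => bounds_of_deviation (hw _) (hz _),
    fun i => bounds_of_deviation (hw _) (hz _), fun i => hs (.inl i), fun i => hs (.inr (.inl i)),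
    fun i => hs (.inr (.inr (.inl i))), fun i => ?_⟩
  rw [projMatrix_mulVec]
  exact hs (.inr (.inr (.inr i)))

/-- Computing and writing all numbers that depend on given weights and their core matrix. -/
theorem Runs.finish {Post : Situation d n → (Reg d n → ℝ) → ℝ → Prop} {D : Set (Situation d n)}
    {A : Set (Situation d n → ℝ)} {c : ℝ} (w : Situation d n → Fin n ⊕ Fin n → ℝ)
    (hw : ∀ x, (fun s => w s x) ∈ A)
    (hM : (ents fun s => coreMatrix s.A fun i => w s (.inl i)) ⊆ A)
    (h : ∀ x ∈ D, ∀ s : Reg d n → ℝ, (∀ k, s (storeReg k) = storeValue x.A x.f (w x) k) →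
      (∀ k, s (outReg k) = outValue x.A x.f (w x) k) → s .eps = x.mem .eps →
      ∀ t ≤ c + 23 * n ^ 2, Post x s t) :
    Runs (setting d n) Post D A c := by
  refine .apply_range (fun (i : Fin n) s => w s (.inr i)) (fun i => hw _) ?_
  set A1 := A ∪ Set.range fun (i : Fin n) s => (setting d n).fn s (w s (.inr i)) with hA1
  have hf : ∀ i : Fin n, (fun s : Situation d n => s.f (w s (.inr i))) ∈ A1 :=
    fun i => Or.inr ⟨i, rfl⟩
  have hAA1 : A ⊆ A1 := Set.subset_union_left
  refine .bind (.range_one (fun (i : Fin n) s => Real.sqrt (w s (.inl i)))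
    fun i => .sqrt (hAA1 (hw _))) fun A2 h12 hsq => ?_
  have hcol : Computes D A2 (ents fun s => scaledColumn s.f (w s))
      (Fintype.card (Fin n) * Fintype.card Unit * 1) :=
    .ents_of_entry fun i _ => .one _ (.mul (hsq ⟨i, rfl⟩) (h12 (hf i)))
  refine .bind hcol fun A3 h23 hh => ?_
  have hM3 := hM.trans (hAA1.trans (h12.trans h23))
  refine .bind ((MulCost.naive n n 1).apply (Fintype.card_fin n).le (Fintype.card_fin n).le
    (by simp) D A3 _ _ hM3 hh) fun A4 h34 hβ => ?_
  refine .bind (.range_one (fun (i : Fin n) s => Real.sqrt (w s (.inl i)) *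
    (coreMatrix s.A (fun i => w s (.inl i)) * scaledColumn s.f (w s)) i ())
    fun i => .mul (h34 (h23 (hsq ⟨i, rfl⟩))) (hβ (mem_ents _ i ()))) fun A5 h45 hp => ?_
  have h5 : A1 ⊆ A5 := h12.trans (h23.trans (h34.trans h45))
  refine .write (Sum.elim storeReg outReg)
    (storeReg_injective.sumElim outReg_injective fun a b => (outReg_ne_storeReg b a).symm)
    (by rintro (k | k); exacts [storeReg_notMem_scratch k, outReg_notMem_scratch k])
    (Sum.elim (fun k s => storeValue s.A s.f (w s) k) fun k s => outValue s.A s.f (w s) k) ?_ ?_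
  · rintro ((x | ⟨i, j⟩ | i) | i | i | i | i)
    · exact h5 (hAA1 (hw x))
    · exact h5 (hAA1 (hM (mem_ents _ i j)))
    · exact h45 (hβ (mem_ents _ i ()))
    · exact h5 (hAA1 (hw _))
    · exact h5 (hAA1 (hw _))
    · exact h5 (hf i)
    · exact hp ⟨i, rfl⟩
  · intro x hx s hs hs'
    refine h x hx s (fun k => hs (.inl k)) (fun k => hs (.inr k)) (hs' .eps (by
      rintro ⟨k | k | k | k | k, hk⟩ <;> simp [storeReg, outReg] at hk) (by
      rintro ⟨l, hl⟩; exact Reg.noConfusion rfl rfl (heq_of_eq hl))) _ ?_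
    have hn : (n : ℝ) ≤ n ^ 2 := by exact_mod_cast Nat.le_self_pow two_ne_zero n
    simp only [Fintype.card_sum, Fintype.card_prod, Fintype.card_fin, Fintype.card_unit]
    push_cast
    linarith

/-- The quantities held by the non-scratch registers. -/
def memoryQuantities (d n : ℕ) : Set (Situation d n → ℝ) :=
  {q | ∃ r, r ∉ Set.range (setting d n).scratch ∧ q = fun x => (setting d n).mem x r}

/-- The product of the matrices that define the core matrix. -/
theorem computes_coreMatrix {Ω : Type} {D : Set Ω} {S : Set (Ω → ℝ)} {s : ℕ} {t t' : ℝ}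
    (hd : n ≤ s * d) (ht : MulCost d d d t) (ht' : InvCost d t')
    (A : Ω → Matrix (Fin d) (Fin n) ℝ) (u : Ω → Fin n → ℝ) (hA : ents A ⊆ S)
    (hu : ∀ i, (fun x => u x i) ∈ S) (hdet : ∀ x ∈ D, (A x).rank = d ∧ ∀ i, 0 < u x i) :
    Computes D S (ents fun x => coreMatrix (A x) (u x))
      (d * n + (s * (t + d * d) + 1) + t' + s * t + s * (s * t)) := by
  have h1 : Computes D S (ents fun x => A x * Matrix.diagonal (u x))
      (Fintype.card (Fin d) * Fintype.card (Fin n) * 1) := by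
    refine .ents_of_entry fun i j => (Computes.one _ (.mul (hA (mem_ents A i j)) (hu j))).congr ?_
    rintro _ rfl
    exact ⟨_, rfl, fun x _ => by simp [Matrix.mul_diagonal]⟩
  have hAt : (ents fun x => (A x).transpose) ⊆ S := by rwa [ents_transpose]
  have cd : Fintype.card (Fin d) ≤ d := by simp
  have cn : Fintype.card (Fin n) ≤ s * d := by simpa using hd
  have h2 := h1.trans ((ht.inner s).apply cd cn cd D _ _ (fun x => (A x).transpose)
    Set.subset_union_right (hAt.trans Set.subset_union_left))
  have h3 := h2.trans (ht'.apply cd D _ _ (fun x hx => by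
    obtain ⟨hr, hp⟩ := hdet x hx
    exact (Matrix.isUnit_iff_isUnit_det _).1 (posDef_gram hr hp).isUnit) Set.subset_union_right)
  have h4 := h3.trans ((ht.rows s).apply cn cd cd D _ (fun x => (A x).transpose) _
    (hAt.trans Set.subset_union_left) Set.subset_union_right)
  have h5 := h4.trans (((ht.rows s).cols s).apply cn cd cn D _ _ A
    Set.subset_union_right (hA.trans Set.subset_union_left))
  refine h5.mono_cost (le_of_eq ?_)
  simp only [Fintype.card_fin, mul_one]

/-- All large products are split into `d × d` ones, the long dimension `n` being covered by `s`
pieces; only one matrix, of size `d`, is inverted. -/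
theorem exists_initProg {s : ℕ} {t t' : ℝ} (hd : n ≤ s * d) (ht : MulCost d d d t)
    (ht' : InvCost d t') : ∃ P : Prog (Reg d n), ∀ (f : ℝ → ℝ) (A : Matrix (Fin d) (Fin n) ℝ)
      (ε : ℝ) (u v : Fin n → ℝ), A.rank = d → (∀ i, 0 < u i) →
      P.steps f (initMemory A ε u v) ≤ d * n + (s * (t + d * d) + 1) + t' + s * t + s * (s * t)
        + 23 * n ^ 2 ∧
      (∀ k, P.run f (initMemory A ε u v) (storeReg k) = storeValue A f (Sum.elim u v) k) ∧
      P.run f (initMemory A ε u v) .eps = ε := by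
  let D : Set (Situation d n) := {x | x.A.rank = d ∧ (∀ i, 0 < x.w (.inl i)) ∧
    x.mem = initMemory x.A x.ε (fun i => x.w (.inl i)) fun i => x.w (.inr i)}
  let Post : Situation d n → (Reg d n → ℝ) → ℝ → Prop := fun x m c =>
    c ≤ d * n + (s * (t + d * d) + 1) + t' + s * t + s * (s * t) + 23 * n ^ 2 ∧
      (∀ k, m (storeReg k) = storeValue x.A x.f x.w k) ∧ m .eps = x.ε
  have main : Runs (setting d n) Post D (memoryQuantities d n) 0 := by
    have hreg : ∀ (q : Situation d n → ℝ) (r : Reg d n), (∀ l, .work l ≠ r) →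
        (∀ x ∈ D, q x = x.mem r) → ∃ b ∈ memoryQuantities d n, ∀ x ∈ D, q x = b x := by
      intro q r hr hq
      exact ⟨_, ⟨r, by rintro ⟨l, hl⟩; exact hr _ hl, rfl⟩, hq⟩
    have h0 : Computes D (memoryQuantities d n)
        ((ents fun x : Situation d n => x.A) ∪ Set.range fun i (x : Situation d n) => x.w i) 0 := by
      refine (Computes.of_subset subset_rfl).congr ?_
      rintro _ (⟨⟨i, j⟩, rfl⟩ | ⟨i | i, rfl⟩)
      · exact hreg _ (.matA i j) (by simp) fun x hx => by rw [hx.2.2]; rfl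
      · exact hreg _ (.inU i) (by simp) fun x hx => by rw [hx.2.2]; rfl
      · exact hreg _ (.inV i) (by simp) fun x hx => by rw [hx.2.2]; rfl
    refine .bind h0 fun S1 _ h1 => ?_
    have hw : ∀ i, (fun x : Situation d n => x.w i) ∈ S1 := fun i => h1 (Or.inr ⟨i, rfl⟩)
    refine .bind (computes_coreMatrix hd ht ht' (fun x : Situation d n => x.A)
      (fun x i => x.w (.inl i)) (fun _ h => h1 (Or.inl h)) (fun i => hw _)
      fun x hx => ⟨hx.1, hx.2.1⟩) fun S2 h12 h2 => ?_
    refine .finish (fun x => x.w) (fun i => h12 (hw i)) h2 ?_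
    intro x hx m h3 _ h4 c hc
    refine ⟨by linarith, h3, ?_⟩
    rw [h4, hx.2.2]
    rfl
  have : Nonempty (Reg d n) := ⟨.eps⟩
  obtain ⟨P, hP⟩ := main.exists_prog
  refine ⟨P, fun f A ε u v hA hu => ?_⟩
  obtain ⟨c', h1, h2, h3, h4⟩ := hP ⟨f, initMemory A ε u v, A, ε, Sum.elim u v, Sum.elim u v⟩
    ⟨hA, hu, rfl⟩
  exact ⟨h1.trans h2, h3, h4⟩

end Layout

end ProjMaint


namespace ProjMaint

/-! ### The two ways of answering an update -/

section Update

variable {d n : ℕ}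

/-- The weights with the entries in `B` taken from the arguments and the others from the store. -/
noncomputable def Situation.blend (B : Finset (Fin n ⊕ Fin n)) (x : Situation d n) :
    Fin n ⊕ Fin n → ℝ :=
  fun i => if i ∈ B then x.z i else x.w i

/-- The situations in which an update is called. -/
def updateDomain (d n : ℕ) : Set (Situation d n) :=
  {x | x.A.rank = d ∧ (0 < x.ε ∧ x.ε < 1 / 4) ∧ (∀ i, 0 < x.w i) ∧ (∀ i, 0 < x.z i) ∧
    x.mem .eps = x.ε ∧ (∀ k, x.mem (storeReg k) = storeValue x.A x.f x.w k) ∧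
    (∀ i, x.mem (.inU i) = x.z (.inl i)) ∧ ∀ i, x.mem (.inV i) = x.z (.inr i)}

/-- The specification of an update in terms of the memory it ends with and the cost. -/
def UpdatePost (r₀ : ℕ) (c₀ : ℝ) (cost : ℕ → ℝ) (x : Situation d n) (m : Reg d n → ℝ)
    (t : ℝ) : Prop :=
  ∃ w' : Fin n ⊕ Fin n → ℝ, (∀ i, 0 < w' i) ∧
    UpdateStep (levels n) r₀ c₀ cost x.ε x.w x.z w' t ∧
    (∀ k, m (storeReg k) = storeValue x.A x.f w' k) ∧ m .eps = x.ε ∧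
    CorrectOutput x.f x.A x.ε (fun i => x.z (.inl i)) (fun i => x.z (.inr i)) m

theorem Situation.blend_pos {x : Situation d n} (hx : x ∈ updateDomain d n)
    (B : Finset (Fin n ⊕ Fin n)) (i : Fin n ⊕ Fin n) : 0 < x.blend B i := by
  unfold Situation.blend
  split_ifs
  exacts [hx.2.2.2.1 i, hx.2.2.1 i]

theorem Situation.deviation_blend {x : Situation d n} (hx : x ∈ updateDomain d n)
    {B : Finset (Fin n ⊕ Fin n)} (hB : ∀ i ∉ B, |x.z i / x.w i - 1| ≤ x.ε) (i : Fin n ⊕ Fin n) :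
    |x.z i / x.blend B i - 1| ≤ x.ε := by
  unfold Situation.blend
  split_ifs with h
  · rw [div_self (hx.2.2.2.1 i).ne', sub_self, abs_zero]
    exact hx.2.1.1.le
  · exact hB i h

theorem woodbury_mul {μ : Type} {A : Matrix (Fin d) (Fin n) ℝ} (hA : A.rank = d)
    {u u' : Fin n → ℝ} (hu : ∀ i, 0 < u i) (hu' : ∀ i, 0 < u' i) (S : Finset (Fin n))
    (hS : ∀ i ∉ S, u' i = u i) (H : Matrix (Fin n) μ ℝ) :
    coreMatrix A u' * H = coreMatrix A u * H -
      (coreMatrix A u).submatrix id (Subtype.val : S → Fin n) *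
      ((updateKernel (coreMatrix A u) S (u' - u))⁻¹ *
        (Matrix.diagonal (fun i : S => (u' - u) i) *
          (coreMatrix A u * H).submatrix (Subtype.val : S → Fin n) id)) := by
  rw [(woodbury hA hu hu' S hS).2, Matrix.sub_mul]
  simp only [Matrix.mul_assoc]
  rfl

variable {r₀ : ℕ} {c₀ c : ℝ} {cost : ℕ → ℝ} {D : Set (Situation d n)}
  {Q : Set (Situation d n → ℝ)}

/-- Answering without changing the stored numbers. -/
theorem runs_lazy (hD : D ⊆ updateDomain d n) (B : Finset (Fin n ⊕ Fin n)) (hB : B.card ≤ r₀)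
    (hdev : ∀ x ∈ D, ∀ i ∉ B, |x.z i / x.w i - 1| ≤ x.ε) {t : ℝ} (ht : InvCost r₀ t)
    (hw : ∀ i, (fun x : Situation d n => x.w i) ∈ Q)
    (hz : ∀ i, (fun x : Situation d n => x.z i) ∈ Q)
    (hM : (ents fun x : Situation d n => coreMatrix x.A fun i => x.w (.inl i)) ⊆ Q)
    (hβ : (ents fun x : Situation d n => (coreMatrix x.A fun i => x.w (.inl i)) *
      scaledColumn x.f x.w) ⊆ Q)
    (hc : c + (4 * n * r₀ + 5 * r₀ ^ 2 + 2 * r₀ + t + 25 * n) ≤ c₀) :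
    Runs (setting d n) (UpdatePost r₀ c₀ cost) D Q c := by
  have hb : ∀ i, (fun x : Situation d n => x.blend B i) ∈ Q := by
    intro i
    unfold Situation.blend
    split_ifs
    exacts [hz i, hw i]
  have hcard : B.toLeft.card + B.toRight.card ≤ r₀ := by
    rw [Finset.card_toLeft_add_card_toRight]; exact hB
  refine .apply_range (fun (i : Fin n) (s : Situation d n) => s.blend B (.inr i)) (fun i => hb _) ?_
  refine .apply_range (fun (i : Fin n) (s : Situation d n) => s.w (.inr i)) (fun i => Or.inl (hw _)) ?_
  generalize hQ1 : (Q ∪ Set.range fun (i : Fin n) s => (setting d n).fn s (s.blend B (.inr i))) ∪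
    (Set.range fun (i : Fin n) s => (setting d n).fn s (s.w (.inr i))) = Q1
  have h01 : Q ⊆ Q1 := by
    rw [← hQ1]; exact Set.subset_union_left.trans Set.subset_union_left
  have hfb : ∀ i : Fin n, (fun s : Situation d n => s.f (s.blend B (.inr i))) ∈ Q1 := by
    intro i; rw [← hQ1]; exact Or.inl (Or.inr ⟨i, rfl⟩)
  have hfw : ∀ i : Fin n, (fun s : Situation d n => s.f (s.w (.inr i))) ∈ Q1 := by
    intro i; rw [← hQ1]; exact Or.inr ⟨i, rfl⟩
  refine .bind (.range_one (fun (i : Fin n) (s : Situation d n) => Real.sqrt (s.blend B (.inl i)))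
    fun i => .sqrt (h01 (hb (.inl i)))) fun Q2 h12 hsb => ?_
  refine .bind (.range_one (fun (i : Fin n) (s : Situation d n) => Real.sqrt (s.w (.inl i)))
    fun i => .sqrt (h12 (h01 (hw (.inl i))))) fun Q3 h23 hsw => ?_
  have hcolb : Computes D Q3 (ents fun s => scaledColumn s.f (s.blend B))
      (Fintype.card (Fin n) * Fintype.card Unit * 1) :=
    .ents_of_entry fun i _ => .one _ (.mul (h23 (hsb ⟨i, rfl⟩)) (h23 (h12 (hfb i))))
  refine .bind hcolb fun Q4 h34 hxb => ?_
  have hcolw : Computes D Q4 (ents fun s => scaledColumn s.f s.w)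
      (Fintype.card (Fin n) * Fintype.card Unit * 1) :=
    .ents_of_entry fun i _ => .one _ (.mul (h34 (hsw ⟨i, rfl⟩)) (h34 (h23 (h12 (hfw i)))))
  refine .bind hcolw fun Q5 h45 hxw => ?_
  have h05 : Q ⊆ Q5 := h01.trans (h12.trans (h23.trans (h34.trans h45)))
  refine .bind (.range_one (fun (i : Fin n) (s : Situation d n) => s.blend B (.inl i) - s.w (.inl i))
    fun i => .sub (h05 (hb (.inl i))) (h05 (hw (.inl i)))) fun Q6 h56 he => ?_
  have h06 := h05.trans h56
  -- The column `√Ũ f(ṽ)` changes only at indices where `u` or `v` is replaced, at most `r₀` in all,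
  -- so the stored product with the old column is corrected in `O(n r₀)` steps; Woodbury then
  -- corrects the matrix.
  refine .bind (computes_mul_of_change _ (fun s => scaledColumn s.f s.w)
    (fun s => scaledColumn s.f (s.blend B)) (B.toLeft ∪ B.toRight)
    ((Finset.card_union_le _ _).trans hcard) (hM.trans h06) (hxw.trans h56)
    (hxb.trans (h45.trans h56)) (hβ.trans h06) ?_) fun Q7 h67 hy => ?_
  · intro s _ i hi
    simp only [Finset.mem_union, Finset.mem_toLeft, Finset.mem_toRight, not_or] at hi
    simp [scaledColumn, Situation.blend, hi.1, hi.2]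
  have hS : ∀ s : Situation d n, ∀ i ∉ B.toLeft, s.blend B (.inl i) = s.w (.inl i) := by
    intro s i hi
    rw [Finset.mem_toLeft] at hi
    simp [Situation.blend, hi]
  have hrb := fun s hs => woodbury_mul (hD hs).1 (fun i => (hD hs).2.2.1 (.inl i))
    (fun i => Situation.blend_pos (hD hs) B (.inl i)) B.toLeft (hS s)
    (scaledColumn s.f (s.blend B))
  have hlow := computes_woodbury (D := D) (μ := Unit) (m := 1) (by simp) _
    (fun s i => s.blend B (.inl i) - s.w (.inl i)) _ B.toLeft
    ((Nat.le_add_right _ _).trans hcard) ht (.naive r₀ r₀ 1) (.naive n r₀ 1)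
    (hM.trans (h06.trans h67)) (fun i => h67 (he ⟨i, rfl⟩)) hy
    (fun s hs => (woodbury (hD hs).1 (fun i => (hD hs).2.2.1 (.inl i))
    (fun i => Situation.blend_pos (hD hs) B (.inl i)) B.toLeft (hS s)).1)
  have hlow' : Computes D Q7 (ents fun s => (coreMatrix s.A fun i => s.blend B (.inl i)) *
      scaledColumn s.f (s.blend B)) _ := hlow.congr (by
    rintro _ ⟨⟨i, j⟩, rfl⟩
    exact ⟨_, mem_ents _ i j, fun s hs => congrFun₂ (hrb s hs) i j⟩)
  refine .bind hlow' fun Q8 h78 hy' => ?_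
  have h28 : Q2 ⊆ Q8 := h23.trans (h34.trans (h45.trans (h56.trans (h67.trans h78))))
  refine .bind (.range_one (fun (i : Fin n) (s : Situation d n) => Real.sqrt (s.blend B (.inl i)) *
    (coreMatrix s.A (fun i => s.blend B (.inl i)) * scaledColumn s.f (s.blend B)) i ())
    fun i => .mul (h28 (hsb ⟨i, rfl⟩)) (hy' (mem_ents _ i ()))) fun Q9 h89 hp => ?_
  have h19 : Q1 ⊆ Q9 := h12.trans (h28.trans h89)
  refine .write outReg outReg_injective outReg_notMem_scratch
    (fun k s => outValue s.A s.f (s.blend B) k) ?_ ?_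
  · rintro (i | i | i | i)
    · exact h19 (h01 (hb _))
    · exact h19 (h01 (hb _))
    · exact h19 (hfb i)
    · exact hp ⟨i, rfl⟩
  · intro x hx s hs hs'
    have hxD := hD hx
    refine ⟨x.w, hxD.2.2.1, Or.inl ⟨rfl, le_trans ?_ hc⟩, fun k => ?_, ?_,
      correctOutput_of_outValue (Situation.blend_pos hxD B)
        (Situation.deviation_blend hxD (hdev x hx)) hs⟩
    · simp only [Fintype.card_sum, Fintype.card_fin, Fintype.card_unit]
      push_cast
      linarith
    · rw [hs' _ (by rintro ⟨l, hl⟩; exact outReg_ne_storeReg l k hl) (storeReg_notMem_scratch k)]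
      exact hxD.2.2.2.2.2.1 k
    · rw [hs' _ (by rintro ⟨k | k | k | k, hk⟩ <;> simp [outReg] at hk)
        (by rintro ⟨l, hl⟩; exact Reg.noConfusion rfl rfl (heq_of_eq hl))]
      exact hxD.2.2.2.2.1

/-- Answering with new stored numbers. -/
theorem runs_rebuild (hD : D ⊆ updateDomain d n) (B : Finset (Fin n ⊕ Fin n)) {j r : ℕ}
    (hB : B.card ≤ r)
    (hdev : ∀ x ∈ D, ∀ i ∉ B, |x.z i / x.w i - 1| ≤ x.ε)
    (hstep : ∀ x ∈ D, ∀ t ≤ cost j,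
      UpdateStep (levels n) r₀ c₀ cost x.ε x.w x.z (x.blend B) t)
    {t t₁ t₂ : ℝ} (ht : InvCost r t) (ht₁ : MulCost r r n t₁) (ht₂ : MulCost n r n t₂)
    (hw : ∀ i, (fun x : Situation d n => x.w i) ∈ Q)
    (hz : ∀ i, (fun x : Situation d n => x.z i) ∈ Q)
    (hM : (ents fun x : Situation d n => coreMatrix x.A fun i => x.w (.inl i)) ⊆ Q)
    (hc : c + (n + (3 * r ^ 2 + t + r * n + t₁ + t₂ + n * n) + 23 * n ^ 2) ≤ cost j) :
    Runs (setting d n) (UpdatePost r₀ c₀ cost) D Q c := by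
  have hb : ∀ i, (fun x : Situation d n => x.blend B i) ∈ Q := by
    intro i
    unfold Situation.blend
    split_ifs
    exacts [hz i, hw i]
  refine .bind (.range_one (fun (i : Fin n) (s : Situation d n) => s.blend B (.inl i) - s.w (.inl i))
    fun i => .sub (hb (.inl i)) (hw (.inl i))) fun Q1 h01 he => ?_
  have hS : ∀ s : Situation d n, ∀ i ∉ B.toLeft, s.blend B (.inl i) = s.w (.inl i) := by
    intro s i hi
    rw [Finset.mem_toLeft] at hi
    simp [Situation.blend, hi]
  have hrb := fun s hs => woodbury (hD hs).1 (fun i => (hD hs).2.2.1 (.inl i))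
    (fun i => Situation.blend_pos (hD hs) B (.inl i)) B.toLeft (hS s)
  have hlow := computes_woodbury (D := D) (μ := Fin n) (m := n) (by simp) _
    (fun s i => s.blend B (.inl i) - s.w (.inl i)) _ B.toLeft
    (le_trans (by have := B.card_toLeft_add_card_toRight; omega) hB) ht ht₁ ht₂
    (hM.trans h01) (fun i => he ⟨i, rfl⟩) (hM.trans h01) fun s hs => (hrb s hs).1
  have hlow' : Computes D Q1 (ents fun s => coreMatrix s.A fun i => s.blend B (.inl i)) _ :=
    hlow.congr (by
      rintro _ ⟨⟨i, j⟩, rfl⟩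
      exact ⟨_, mem_ents _ i j, fun s hs => congrFun₂ (hrb s hs).2 i j⟩)
  refine .bind hlow' fun Q2 h12 hM' => ?_
  refine .finish (fun s => s.blend B) (fun i => h12 (h01 (hb i))) hM' ?_
  intro x hx m h1 h2 h3 t ht
  have hxD := hD hx
  refine ⟨x.blend B, Situation.blend_pos hxD B, hstep x hx t (ht.trans (le_trans ?_ hc)), h1,
    h3.trans hxD.2.2.2.2.1, correctOutput_of_outValue (Situation.blend_pos hxD B)
        (Situation.deviation_blend hxD (hdev x hx)) h2⟩
  simp only [Fintype.card_fin]
  linarith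

end Update

end ProjMaint


namespace ProjMaint

/-! ### The update program -/

/-- Otherwise `N` more than doubles `p` times, starting from `2`, and exceeds `2^p`. -/
theorem exists_lt_le_two_mul {N : ℕ → ℕ} {p : ℕ} (h0 : 2 ≤ N 0) (hp : N p ≤ 2 ^ p) :
    ∃ l < p, N (l + 1) ≤ 2 * N l := by
  by_contra! h
  have : ∀ l ≤ p, 2 ^ l * 2 ≤ N l := by
    intro l
    induction l with
    | zero => intro _; simpa using h0
    | succ l ih =>
      intro hl
      have h1 := ih (by omega)
      have h2 := h l (by omega)
      rw [pow_succ]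
      omega
  have h1 := this p le_rfl
  have := Nat.one_le_two_pow (n := p)
  omega

/-- Rounding `m` up to `2^j` leaves `2^(j-2)` below `m / 2`, hence below the size of any set at
least half as large as `m`. -/
theorem two_pow_clog_bounds {m : ℕ} (hm : 3 ≤ m) :
    m ≤ 2 ^ Nat.clog 2 m ∧ 2 * 2 ^ (Nat.clog 2 m - 2) < m := by
  refine ⟨Nat.le_pow_clog one_lt_two m, ?_⟩
  have h1 := Nat.pow_pred_clog_lt_self one_lt_two (by omega : 1 < m)
  have h2 : 2 ≤ Nat.clog 2 m := by
    rw [← Nat.lt_iff_add_one_le]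
    exact (Nat.lt_clog_iff_pow_lt one_lt_two).2 (by omega)
  change 2 ^ (Nat.clog 2 m - 1) < m at h1
  rw [← pow_succ']
  rwa [show Nat.clog 2 m - 2 + 1 = Nat.clog 2 m - 1 by omega]

theorem levels_pos {n : ℕ} (hn : 1 ≤ n) : 1 ≤ levels n :=
  Nat.clog_pos one_lt_two (by omega)

section Program

variable {d n : ℕ}

/-- The relative deviation of an argument from the stored number. -/
noncomputable def Situation.dev (x : Situation d n) (i : Fin n ⊕ Fin n) : ℝ :=
  |x.z i / x.w i - 1|

/-- The thresholds with which the deviations are compared. -/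
noncomputable def Situation.threshold (x : Situation d n) (l : ℕ) : ℝ :=
  x.ε * (1 - l / (2 * levels n))

theorem computes_dev {Q : Set (Situation d n → ℝ)} {D : Set (Situation d n)}
    (hw : ∀ i, (fun x : Situation d n => x.w i) ∈ Q)
    (hz : ∀ i, (fun x : Situation d n => x.z i) ∈ Q) :
    Computes D Q (Set.range fun i (x : Situation d n) => x.dev i) (10 * n) := by
  refine (Computes.range _ 5 fun i => ?_).mono_cost (c := Fintype.card (Fin n ⊕ Fin n) * 5) ?_
  · have h1 := (Computes.one (D := D) _ (.const 1)).union (.one _ (.div (hz i) (hw i)))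
    have h2 := h1.trans (.one _ (.sub (Or.inr (Or.inr rfl)) (Or.inr (Or.inl rfl))))
    have h3 := h2.trans (.one _ (.mul (Or.inr rfl) (Or.inr rfl)))
    have h4 := h3.trans (.one _ (.sqrt (Or.inr rfl)))
    refine (h4.congr ?_).mono_cost (by norm_num)
    -- The absolute value is obtained as the square root of the square.
    rintro _ rfl
    refine ⟨_, rfl, fun x _ => ?_⟩
    simp only [Pi.mul_apply, Pi.sub_apply, Pi.div_apply]
    rw [Real.sqrt_mul_self_eq_abs]
    rfl
  · simp only [Fintype.card_sum, Fintype.card_fin]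
    push_cast
    linarith

theorem computes_threshold {Q : Set (Situation d n → ℝ)} {D : Set (Situation d n)}
    (hε : (fun x : Situation d n => x.ε) ∈ Q) (p : ℕ) :
    Computes D Q (Set.range fun (l : Fin (p + 1)) (x : Situation d n) => x.threshold l)
      (2 * (p + 1)) := by
  refine (Computes.range _ 2 fun l => ?_).mono_cost (c := Fintype.card (Fin (p + 1)) * 2) ?_
  · refine (((Computes.one (D := D) _ (.const (1 - (l : ℕ) / (2 * levels n)))).trans
      (.one _ (.mul (Or.inl hε) (Or.inr rfl)))).congr ?_).mono_cost (by norm_num)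
    rintro _ rfl
    exact ⟨_, rfl, fun x _ => rfl⟩
  · simp only [Fintype.card_fin]
    push_cast
    linarith

variable {r₀ : ℕ} {c₀ : ℝ} {cost : ℕ → ℝ}

/-- The entries to be rebuilt when the comparisons of the deviations with the thresholds come out
as `S` says. -/
theorem exists_rebuild {D : Set (Situation d n)} (hn : 1 ≤ n) (hr₀ : 2 ≤ r₀) (hc₀ : 0 ≤ c₀)
    (hD : D ⊆ updateDomain d n) (hne : D.Nonempty)
    (S₀ : Finset (Fin n ⊕ Fin n)) (hS₀ : ∀ x ∈ D, ∀ i, i ∈ S₀ ↔ x.dev i ≤ x.ε)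
    (hcard : r₀ < S₀ᶜ.card) (S : Finset ((Fin n ⊕ Fin n) × Fin (levels n + 1)))
    (hS : ∀ x ∈ D, ∀ i, i ∈ S ↔ x.dev i.1 ≤ x.threshold i.2) :
    ∃ B : Finset (Fin n ⊕ Fin n), ∃ j ≤ levels n, r₀ < 2 ^ j ∧ B.card ≤ 2 ^ j ∧
      (∀ x ∈ D, ∀ i ∉ B, |x.z i / x.w i - 1| ≤ x.ε) ∧
      ∀ x ∈ D, ∀ t ≤ cost j, UpdateStep (levels n) r₀ c₀ cost x.ε x.w x.z (x.blend B) t := by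
  classical
  obtain ⟨x₀, hx₀⟩ := hne
  have hp : (1 : ℝ) ≤ levels n := by exact_mod_cast levels_pos hn
  have hp0 : (levels n : ℝ) ≠ 0 := by positivity
  -- All comparisons have the same outcome throughout `D`, so the sets seen at `x₀` are those of
  -- every situation in `D` and can be hard-wired into this branch.
  let V : ℕ → Finset (Fin n ⊕ Fin n) := fun l =>
    Finset.univ.filter fun i => ¬ x₀.dev i ≤ x₀.threshold l
  have hV : ∀ l ≤ levels n, ∀ x ∈ D, ∀ i, i ∈ V l ↔ ¬ x.dev i ≤ x.threshold l := by
    intro l hl x hx i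
    have h1 := hS x hx (i, ⟨l, by omega⟩)
    have h2 := hS x₀ hx₀ (i, ⟨l, by omega⟩)
    simp only [V, Finset.mem_filter, Finset.mem_univ, true_and]
    exact not_congr (h2.symm.trans h1)
  have hthr : ∀ x ∈ D, ∀ l : ℕ, x.threshold l ≤ x.ε := by
    intro x hx l
    have h1 := (hD hx).2.1.1
    have h2 : (0 : ℝ) ≤ l / (2 * levels n) := by positivity
    unfold Situation.threshold
    nlinarith
  have hsucc : ∀ (x : Situation d n) (l : ℕ),
      x.threshold (l + 1) + x.ε / (2 * levels n) = x.threshold l := by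
    intro x l
    unfold Situation.threshold
    push_cast
    field_simp
    ring
  have hSV : ∀ l, S₀ᶜ ⊆ V l := by
    intro l i hi
    rw [Finset.mem_compl, hS₀ x₀ hx₀] at hi
    simp only [V, Finset.mem_filter, Finset.mem_univ, true_and]
    exact fun h => hi (h.trans (hthr x₀ hx₀ l))
  have hlow : ∀ l, r₀ < (V l).card := fun l => hcard.trans_le (Finset.card_le_card (hSV l))
  have hup : ∀ l, (V l).card ≤ 2 ^ levels n := by
    intro l
    refine (Finset.card_le_univ _).trans ?_
    rw [Fintype.card_sum, Fintype.card_fin, ← two_mul]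
    exact two_mul_le_two_pow_levels n
  -- The set `V (l + 1)` is replaced, while `V l`, at least half as large, lies above the next
  -- higher threshold and pays for it.
  obtain ⟨l, hl, hle⟩ := exists_lt_le_two_mul (N := fun l => (V l).card)
    (hr₀.trans (hlow 0).le) (hup _)
  have hm := hlow (l + 1)
  obtain ⟨b1, b2⟩ := two_pow_clog_bounds (m := (V (l + 1)).card) (by omega)
  have hdev : ∀ x ∈ D, ∀ i ∉ V (l + 1), |x.z i / x.w i - 1| ≤ x.threshold (l + 1) := by
    intro x hx i hi
    rw [hV _ hl x hx] at hi
    exact not_not.1 hi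
  have hj : Nat.clog 2 (V (l + 1)).card ≤ levels n := Nat.clog_le_of_le_pow (hup _)
  refine ⟨V (l + 1), _, hj, hm.trans_le b1, b1,
    fun x hx i hi => (hdev x hx i hi).trans (hthr x hx _), fun x hx t ht =>
    Or.inr ⟨_, hj, hm.trans_le b1,
      ⟨x.threshold (l + 1), V (l + 1), V l, ?_, ?_, ?_, ?_, by omega, ?_⟩, by linarith⟩⟩
  all_goals have hε := (hD hx).2.1.1
  all_goals have e := hsucc x l
  · have h1 : ((l + 1 : ℕ) : ℝ) / (2 * levels n) ≤ 1 := by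
      rw [div_le_one (by positivity)]
      have : ((l + 1 : ℕ) : ℝ) ≤ levels n := by exact_mod_cast hl
      linarith
    exact mul_nonneg hε.le (by linarith)
  · rw [e]; exact hthr x hx l
  · intro i hi
    exact if_pos hi
  · intro i hi
    exact ⟨if_neg hi, hdev x hx i hi⟩
  · intro i hi
    rw [hV l hl.le x hx] at hi
    rw [e]
    exact (not_le.1 hi).le

/-- The tree branches on the outcomes of all comparisons; each leaf knows its index sets and
continues without branching, lazily or with a rebuild. -/
theorem exists_updateProg (hn : 1 ≤ n) (hr₀ : 2 ≤ r₀) {t₀ : ℝ} {t t₁ t₂ : ℕ → ℝ}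
    (ht₀ : InvCost r₀ t₀) (ht : ∀ j ≤ levels n, InvCost (2 ^ j) (t j))
    (ht₁ : ∀ j ≤ levels n, MulCost (2 ^ j) (2 ^ j) n (t₁ j))
    (ht₂ : ∀ j ≤ levels n, MulCost n (2 ^ j) n (t₂ j))
    (hc₀ : 4 * n * r₀ + 5 * r₀ ^ 2 + 2 * r₀ + t₀ + 39 * n + 2 * levels n ≤ c₀)
    (hcost : ∀ j ≤ levels n, 15 * n + 2 * levels n + 2 * n * levels n + 3 * (2 ^ j) ^ 2 + t j +
      2 ^ j * n + t₁ j + t₂ j + 24 * n ^ 2 + 2 ≤ cost j) :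
    ∃ P : Prog (Reg d n), ∀ x ∈ updateDomain d n, ∃ c' : ℝ, P.steps x.f x.mem ≤ c' ∧
      UpdatePost r₀ c₀ cost x (P.run x.f x.mem) c' := by
  classical
  have hn1 : (1 : ℝ) ≤ n := by exact_mod_cast hn
  have hc₀0 : 0 ≤ c₀ := by
    refine le_trans ?_ hc₀
    have : 0 ≤ t₀ := (ht₀.apply (Ω := Unit) (ι := Empty) (by simp) ∅ ∅
      (fun _ => 0) (by simp) (by rintro _ ⟨⟨i, _⟩, _⟩; exact i.elim)).nonneg
    positivity
  have : Nonempty (Reg d n) := ⟨.eps⟩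
  refine Runs.exists_prog (E := setting d n) (Post := UpdatePost r₀ c₀ cost) ?_
  change Runs _ _ _ (memoryQuantities d n) 0
  have hreg : ∀ (q : Situation d n → ℝ) (r : Reg d n), r ∉ Set.range (setting d n).scratch →
      (∀ x ∈ updateDomain d n, q x = x.mem r) →
      ∃ b ∈ memoryQuantities d n, ∀ x ∈ updateDomain d n, q x = b x :=
    fun q r hr hq => ⟨_, ⟨r, hr, rfl⟩, hq⟩
  have hnw : ∀ r : Reg d n, (∀ l, .work l ≠ r) → r ∉ Set.range (setting d n).scratch := by
    rintro r hr ⟨l, hl⟩; exact hr _ hl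
  have h0 : Computes (updateDomain d n) (memoryQuantities d n)
      (({fun x : Situation d n => x.ε} ∪ (Set.range fun i (x : Situation d n) => x.z i)) ∪
      Set.range fun k (x : Situation d n) => storeValue x.A x.f x.w k) 0 := by
    refine (Computes.of_subset subset_rfl).congr ?_
    rintro _ ((rfl | ⟨i | i, rfl⟩) | ⟨k, rfl⟩)
    · exact hreg _ .eps (hnw _ (by simp)) fun x hx => hx.2.2.2.2.1.symm
    · exact hreg _ (.inU i) (hnw _ (by simp)) fun x hx => (hx.2.2.2.2.2.2.1 i).symm
    · exact hreg _ (.inV i) (hnw _ (by simp)) fun x hx => (hx.2.2.2.2.2.2.2 i).symm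
    · exact hreg _ (storeReg k) (storeReg_notMem_scratch k) fun x hx => (hx.2.2.2.2.2.1 k).symm
  refine .bind h0 fun Q1 _ h1 => ?_
  have hε : (fun x : Situation d n => x.ε) ∈ Q1 := h1 (Or.inl (Or.inl rfl))
  have hz : ∀ i, (fun x : Situation d n => x.z i) ∈ Q1 :=
    fun i => h1 (Or.inl (Or.inr ⟨i, rfl⟩))
  have hst : ∀ k, (fun x : Situation d n => storeValue x.A x.f x.w k) ∈ Q1 :=
    fun k => h1 (Or.inr ⟨k, rfl⟩)
  have hw : ∀ i, (fun x : Situation d n => x.w i) ∈ Q1 := fun i => hst (.inl i)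
  have hM : (ents fun x : Situation d n => coreMatrix x.A fun i => x.w (.inl i)) ⊆ Q1 :=
    ents_subset.2 fun i j => hst (.inr (.inl (i, j)))
  have hβ : (ents fun x : Situation d n => (coreMatrix x.A fun i => x.w (.inl i)) *
      scaledColumn x.f x.w) ⊆ Q1 := ents_subset.2 fun i _ => hst (.inr (.inr i))
  refine .bind (computes_dev hw hz) fun Q2 h12 hdev => ?_
  refine .bind (computes_threshold (h12 hε) (levels n)) fun Q3 h23 hthr => ?_
  have h13 := h12.trans h23
  refine .branch (fun i (x : Situation d n) => x.dev i) (fun _ x => x.ε)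
    (fun i => h23 (hdev ⟨i, rfl⟩)) (fun _ => h13 hε) fun S₀ => ?_
  by_cases hS₀ : S₀ᶜ.card ≤ r₀
  · refine runs_lazy Set.inter_subset_left S₀ᶜ hS₀ ?_ ht₀ (fun i => h13 (hw i))
      (fun i => h13 (hz i)) (hM.trans h13) (hβ.trans h13) (le_trans ?_ hc₀)
    · intro x hx i hi
      exact (hx.2 i).1 (by simpa using hi)
    · simp only [Fintype.card_sum, Fintype.card_fin]
      push_cast
      linarith
  · rw [not_le] at hS₀
    -- The `2 n (p + 1)` finer comparisons happen only on this side, so they are charged to a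
    -- rebuild.
    refine .branch (fun i (x : Situation d n) => x.dev i.1)
      (fun (i : (Fin n ⊕ Fin n) × Fin (levels n + 1)) x => x.threshold i.2)
      (fun i => h23 (hdev ⟨i.1, rfl⟩)) (fun i => hthr ⟨i.2, rfl⟩) fun S => ?_
    set D := (updateDomain d n ∩ {s | ∀ i, i ∈ S₀ ↔ s.dev i ≤ s.ε}) ∩
      {s | ∀ i, i ∈ S ↔ s.dev i.1 ≤ s.threshold i.2} with hDdef
    -- Contradictory outcomes give unreachable leaves.
    rcases D.eq_empty_or_nonempty with hD | hD
    · exact .of_eq_empty hD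
    · have hsub : D ⊆ updateDomain d n := Set.inter_subset_left.trans Set.inter_subset_left
      obtain ⟨B, j, hj, hr, hB, hB1, hB2⟩ := exists_rebuild (cost := cost) hn hr₀ hc₀0 hsub hD S₀
        (fun x hx => hx.1.2) hS₀ S fun x hx => hx.2
      refine runs_rebuild hsub B hB hB1 hB2 (ht j hj) (ht₁ j hj) (ht₂ j hj) (fun i => h13 (hw i))
        (fun i => h13 (hz i)) (hM.trans h13) (le_trans ?_ (hcost j hj))
      simp only [Fintype.card_sum, Fintype.card_prod, Fintype.card_fin]
      push_cast
      linarith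

end Program

end ProjMaint


namespace ProjMaint

/-! ### The data structure -/

section Spec

variable {d n : ℕ}

/-- The data structure is correct, its initialization takes at most `I` steps, and `T` updates with
relative changes of at most `C` take at most `T * (C / ε * R + c)` steps. -/
def DataStructure.Spec (D : DataStructure d n) (I R c : ℝ) : Prop :=
  ∀ (A : Matrix (Fin d) (Fin n) ℝ), A.rank = d → ∀ (f : ℝ → ℝ) (ε : ℝ), 0 < ε → ε < 1 / 4 →
    (∀ u v : Fin n → ℝ, (∀ i, 0 < u i) → (∀ i, 0 < v i) → (D.initTime f A ε u v : ℝ) ≤ I) ∧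
    ∀ (T : ℕ) (u v : ℕ → Fin n → ℝ), (∀ k ≤ T, ∀ i, 0 < u k i) → (∀ k ≤ T, ∀ i, 0 < v k i) →
      (∀ k, 1 ≤ k → k ≤ T → CorrectOutput f A ε (u k) (v k) (D.memory f A ε u v k)) ∧
      ∀ C : ℝ, 0 ≤ C → SmallChange u T C → SmallChange v T C →
        ∑ k ∈ Finset.range T, (D.updateTime f A ε u v k : ℝ) ≤ T * (C / ε * R + c)

theorem DataStructure.Spec.mono {D : DataStructure d n} {I R c I' R' c' : ℝ} (h : D.Spec I R c)
    (hI : I ≤ I') (hR : R ≤ R') (hc : c ≤ c') : D.Spec I' R' c' := by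
  intro A hA f ε hε hε1
  obtain ⟨h1, h2⟩ := h A hA f ε hε hε1
  refine ⟨fun u v hu hv => (h1 u v hu hv).trans hI, fun T u v hu hv => ?_⟩
  obtain ⟨h3, h4⟩ := h2 T u v hu hv
  refine ⟨h3, fun C hC hcu hcv => (h4 C hC hcu hcv).trans ?_⟩
  gcongr

theorem UpdateStep.mono {X : Type} {p r₀ : ℕ} {c₀ : ℝ} {cost : ℕ → ℝ} {ε : ℝ} {w z w' : X → ℝ}
    {t t' : ℝ} (h : UpdateStep p r₀ c₀ cost ε w z w' t) (ht : t' ≤ t) :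
    UpdateStep p r₀ c₀ cost ε w z w' t' := by
  rcases h with ⟨h1, h2⟩ | ⟨j, h1, h2, h3, h4⟩
  exacts [Or.inl ⟨h1, ht.trans h2⟩, Or.inr ⟨j, h1, h2, h3, ht.trans h4⟩]

theorem loadInput_of_ne {u v : Fin n → ℝ} {s : Reg d n → ℝ} {r : Reg d n}
    (hu : ∀ i, r ≠ .inU i) (hv : ∀ i, r ≠ .inV i) : loadInput u v s r = s r := by
  cases r <;> simp_all [loadInput]

/-- The weights are read off the memory, so each update's witness is forced to be the next stored
vector and the invariant passes from call to call. -/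
theorem exists_spec {s r₀ : ℕ} {t t' c₀ : ℝ} {cost : ℕ → ℝ} (hd : n ≤ s * d)
    (ht : MulCost d d d t) (ht' : InvCost d t') (hr₀ : 2 ≤ r₀) (hcost : ∀ j, 0 ≤ cost j)
    (hP : ∃ P : Prog (Reg d n), ∀ x ∈ updateDomain d n, ∃ c' : ℝ, P.steps x.f x.mem ≤ c' ∧
      UpdatePost r₀ c₀ cost x (P.run x.f x.mem) c') :
    ∃ D : DataStructure d n, D.Spec
      (d * n + (s * (t + d * d) + 1) + t' + s * t + s * (s * t) + 23 * n ^ 2)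
      (16 * levels n * ∑ j ∈ (Finset.range (levels n + 1)).filter (fun j => r₀ < 2 ^ j),
        cost j / Real.sqrt (2 ^ j)) c₀ := by
  obtain ⟨P₀, hP₀⟩ := exists_initProg hd ht ht'
  obtain ⟨P, hP⟩ := hP
  refine ⟨⟨P₀, P⟩, fun A hA f ε hε hε1 => ⟨fun u v hu _ => (hP₀ f A ε u v hA hu).1,
    fun T u v hu hv => ?_⟩⟩
  set D : DataStructure d n := ⟨P₀, P⟩
  set mem := D.memory f A ε u v
  let w : ℕ → Fin n ⊕ Fin n → ℝ := fun k i => mem k (storeReg (.inl i))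
  let z : ℕ → Fin n ⊕ Fin n → ℝ := fun k => Sum.elim (u k) (v k)
  let Inv : ℕ → Prop := fun k => (∀ i, 0 < w k i) ∧
    (∀ j, mem k (storeReg j) = storeValue A f (w k) j) ∧ mem k .eps = ε
  have hz : ∀ k ≤ T, ∀ i, 0 < z k i := by
    rintro k hk (i | i)
    exacts [hu k hk i, hv k hk i]
  obtain ⟨-, i1, i2⟩ := hP₀ f A ε (u 0) (v 0) hA (hu 0 (Nat.zero_le _))
  have hw0 : w 0 = z 0 := by
    funext i
    exact i1 (.inl i)
  have inv0 : Inv 0 := by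
    refine ⟨fun i => ?_, fun j => ?_, i2⟩
    · rw [hw0]; exact hz 0 (Nat.zero_le _) i
    · rw [hw0]; exact i1 j
  have step : ∀ k < T, Inv k → Inv (k + 1) ∧
      UpdateStep (levels n) r₀ c₀ cost ε (w k) (z (k + 1)) (w (k + 1))
        (D.updateTime f A ε u v k) ∧
      CorrectOutput f A ε (u (k + 1)) (v (k + 1)) (mem (k + 1)) := by
    rintro k hk ⟨h1, h2, h3⟩
    obtain ⟨c', hc', w', p1, p2, p3, p4, p5⟩ := hP
      ⟨f, loadInput (u (k + 1)) (v (k + 1)) (mem k), A, ε, w k, z (k + 1)⟩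
      ⟨hA, ⟨hε, hε1⟩, h1, hz _ hk, h3, fun j => (loadInput_of_ne (u := u (k + 1)) (v := v (k + 1)) (s := mem k)
        (r := storeReg j) (by simp [storeReg]) (by simp [storeReg])).trans (h2 j), fun _ => rfl, fun _ => rfl⟩
    have e : w' = w (k + 1) := by
      funext i
      exact (p3 (.inl i)).symm
    subst e
    exact ⟨⟨p1, p3, p4⟩, p2.mono hc', p5⟩
  have inv : ∀ k ≤ T, Inv k := by
    intro k
    induction k with
    | zero => exact fun _ => inv0
    | succ k ih => exact fun hk => (step k hk (ih (by omega))).1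
  refine ⟨fun k hk1 hk => ?_, fun C hC hcu hcv => ?_⟩
  · obtain ⟨k, rfl⟩ := Nat.exists_eq_succ_of_ne_zero (by omega : k ≠ 0)
    exact (step k hk (inv k (by omega))).2.2
  -- The potential lives on the concatenation of `u` and `v`, whose squared change is at most `2 C²
  -- ≤ (2 C)²`.
  · refine (sum_updateStep_le (p := levels n) (C := 2 * C) hr₀ hcost hε (by linarith) (by linarith)
      hw0 (fun k hk => (inv k hk).1) hz (fun k hk => (step k hk (inv k hk.le)).2.1) ?_).trans
      (le_of_eq (by ring))
    intro k hk
    rw [Fintype.sum_sum_type]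
    have h1 := (hcu k hk).1
    have h2 := (hcv k hk).1
    simp only [z, Sum.elim_inl, Sum.elim_inr]
    nlinarith [sq_nonneg C]

end Spec

end ProjMaint


/-! ### Summing the costs and removing the loss in the exponent. -/

namespace ProjMaint

/-! ### Bounds on the costs -/

/-- With `s = n / d + 1` one has `s d ≤ 2 n`, so the dominant `s² d^w = (s d)² d^(w-2)` is at most
`4 n² d^(w-2)`. -/
theorem initCost_le {d n : ℕ} {w K K' : ℝ} (hd : 1 ≤ d) (hdn : d ≤ n) (hw : 2 ≤ w) (hK : 0 ≤ K)
    (hK' : 0 ≤ K') :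
    n ≤ (n / d + 1) * d ∧
    (d * n + ((n / d + 1 : ℕ) * (K * (d : ℝ) ^ w + d * d) + 1) + K' * (d : ℝ) ^ w +
      (n / d + 1 : ℕ) * (K * (d : ℝ) ^ w) +
      (n / d + 1 : ℕ) * ((n / d + 1 : ℕ) * (K * (d : ℝ) ^ w)) + 23 * (n : ℝ) ^ 2 : ℝ) ≤
      (29 + 12 * K + K') * ((n : ℝ) ^ 2 * (d : ℝ) ^ (w - 2)) := by
  have h1 : n ≤ (n / d + 1) * d := by
    have := Nat.lt_div_mul_add hd (a := n)
    rw [add_mul, one_mul]; omega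
  have h2 : (n / d + 1) * d ≤ 2 * n := by
    have := Nat.div_mul_le_self n d
    rw [add_mul, one_mul]; omega
  refine ⟨h1, ?_⟩
  generalize n / d + 1 = s at h1 h2
  have hd' : (1 : ℝ) ≤ d := by exact_mod_cast hd
  have hdn' : (d : ℝ) ≤ n := by exact_mod_cast hdn
  have hsd : (s * d : ℝ) ≤ 2 * n := by exact_mod_cast h2
  have hs : (1 : ℝ) ≤ s := by
    have : 1 ≤ s := by
      by_contra! h
      interval_cases s
      omega
    exact_mod_cast this
  set y := (d : ℝ) ^ (w - 2) with hy
  have hy1 : 1 ≤ y := Real.one_le_rpow hd' (by linarith)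
  have hdw : (d : ℝ) ^ w = d ^ 2 * y := by
    rw [hy, ← Real.rpow_natCast, ← Real.rpow_add (by linarith)]
    congr 1
    push_cast
    ring
  have e0 : (1 : ℝ) ≤ n ^ 2 := one_le_pow₀ (by linarith)
  have e1 : (d : ℝ) ^ 2 ≤ n ^ 2 := by gcongr
  have e2 : ((s : ℝ) * d) ^ 2 ≤ 4 * (n : ℝ) ^ 2 := by
    calc ((s : ℝ) * d) ^ 2 ≤ (2 * (n : ℝ)) ^ 2 := by gcongr
      _ = 4 * (n : ℝ) ^ 2 := by ring
  have e3 : (s : ℝ) * d ^ 2 ≤ 4 * n ^ 2 := by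
    refine le_trans ?_ e2
    rw [mul_pow]
    gcongr
    nlinarith
  have e4 : (d : ℝ) * n ≤ n ^ 2 := by nlinarith
  have e5 : (n : ℝ) ^ 2 ≤ n ^ 2 * y := le_mul_of_one_le_right (by positivity) hy1
  have e6 : s * (K * (d : ℝ) ^ w) ≤ 4 * K * (n ^ 2 * y) := by
    calc s * (K * (d : ℝ) ^ w) = K * y * (s * d ^ 2) := by rw [hdw]; ring
      _ ≤ K * y * (4 * n ^ 2) := by gcongr
      _ = _ := by ring
  have e7 : s * (s * (K * (d : ℝ) ^ w)) ≤ 4 * K * (n ^ 2 * y) := by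
    calc s * (s * (K * (d : ℝ) ^ w)) = K * y * ((s * d) ^ 2) := by rw [hdw]; ring
      _ ≤ K * y * (4 * n ^ 2) := by gcongr
      _ = _ := by ring
  have e8 : K' * (d : ℝ) ^ w ≤ K' * (n ^ 2 * y) := by
    rw [hdw]; gcongr
  have e9 : s * (d * d : ℝ) ≤ 4 * n ^ 2 := by rw [← pow_two]; exact e3
  rw [mul_add (s : ℝ)]
  nlinarith

theorem levels_le_log {n : ℕ} (hn : 2 ≤ n) : (levels n : ℝ) ≤ 6 * Real.log n := by
  have h1 : ((2 : ℝ) ^ levels n) ≤ 4 * n := by exact_mod_cast two_pow_levels_le (by omega : 1 ≤ n)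
  have hn' : (2 : ℝ) ≤ n := by exact_mod_cast hn
  have h2 := Real.log_le_log (by positivity) h1
  rw [Real.log_pow, Real.log_mul (by norm_num) (by positivity),
    show (4 : ℝ) = 2 ^ 2 by norm_num, Real.log_pow] at h2
  have h3 := Real.log_le_log (by norm_num) hn'
  have h4 : (1 / 2 : ℝ) < Real.log 2 := by linarith [Real.log_two_gt_d9]
  push_cast at h2
  have h5 : (0 : ℝ) ≤ levels n := by positivity
  nlinarith

theorem levels_one : levels 1 = 1 := by
  norm_num [levels, Nat.clog_eq_one]

/-- The bound on the number of entries treated lazily. -/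
noncomputable def lazySize (b : ℝ) (n : ℕ) : ℕ := 2 * ⌈(n : ℝ) ^ b⌉₊

theorem lazySize_bounds {b : ℝ} (hb : 0 ≤ b) {n : ℕ} (hn : 1 ≤ n) :
    2 ≤ lazySize b n ∧ (n : ℝ) ^ b ≤ lazySize b n ∧ (lazySize b n : ℝ) ≤ 4 * (n : ℝ) ^ b := by
  have hx : (1 : ℝ) ≤ (n : ℝ) ^ b := Real.one_le_rpow (by exact_mod_cast hn) hb
  have h1 := Nat.le_ceil ((n : ℝ) ^ b)
  have h2 := (Nat.ceil_lt_add_one (by linarith : 0 ≤ (n : ℝ) ^ b)).le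
  have h3 : 1 ≤ ⌈(n : ℝ) ^ b⌉₊ := by
    have : (1 : ℝ) ≤ ⌈(n : ℝ) ^ b⌉₊ := hx.trans h1
    exact_mod_cast this
  unfold lazySize
  push_cast
  exact ⟨by omega, by linarith, by linarith⟩

/-- The cost of answering without rebuilding. -/
theorem lazyCost_le {b K : ℝ} (hb0 : 0 ≤ b) (hb1 : b ≤ 1) (hK : 0 ≤ K) {n : ℕ} (hn : 1 ≤ n) :
    4 * n * (lazySize b n : ℝ) + 5 * (lazySize b n : ℝ) ^ 2 + 2 * lazySize b n +
      K * (lazySize b n : ℝ) ^ (3 - b) + 39 * n + 2 * levels n ≤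
      (151 + 64 * K) * (n : ℝ) ^ (1 + b) := by
  obtain ⟨h1, h2, h3⟩ := lazySize_bounds hb0 hn
  have hn' : (1 : ℝ) ≤ n := by exact_mod_cast hn
  have hn0 : (0 : ℝ) < n := by linarith
  set r := ((lazySize b n : ℕ) : ℝ)
  have hr0 : 0 ≤ r := Nat.cast_nonneg _
  set x := (n : ℝ) ^ b with hx
  have hx1 : 1 ≤ x := Real.one_le_rpow hn' hb0
  have hxn : x ≤ n := by
    simpa using Real.rpow_le_rpow_of_exponent_le hn' hb1
  have hnx : (n : ℝ) ^ (1 + b) = n * x := by rw [Real.rpow_add hn0, Real.rpow_one]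
  have h4 : r ^ (3 - b) ≤ 64 * (n * x) := by
    calc r ^ (3 - b) ≤ (4 * x) ^ (3 - b) := Real.rpow_le_rpow hr0 h3 (by linarith)
      _ = 4 ^ (3 - b) * x ^ (3 - b) := Real.mul_rpow (by norm_num) (by linarith)
      _ ≤ 4 ^ (3 : ℝ) * (n : ℝ) ^ (1 + b) := by
        gcongr
        · norm_num
        · linarith
        -- The comparison of exponents `b (3 - b) ≤ 1 + b` is `(1 - b)² ≥ 0`.
        · rw [hx, ← Real.rpow_mul hn0.le]
          refine Real.rpow_le_rpow_of_exponent_le hn' ?_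
          nlinarith [sq_nonneg (1 - b)]
      _ = 64 * (n * x) := by rw [hnx]; norm_num
  have h5 : (levels n : ℝ) ≤ 4 * n := by
    have h6 : levels n < 2 ^ levels n := Nat.lt_two_pow_self
    have h7 := two_pow_levels_le hn
    exact_mod_cast h6.le.trans h7
  have h6 := mul_le_mul_of_nonneg_left h4 hK
  rw [hnx]
  have e1 : n * r ≤ 4 * (n * x) := by nlinarith
  have e2 : r ^ 2 ≤ 16 * (n * x) := by
    calc r ^ 2 ≤ (4 * x) ^ 2 := by gcongr
      _ = 16 * (x * x) := by ring
      _ ≤ 16 * (n * x) := by gcongr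
  have e3 : (n : ℝ) ≤ n * x := le_mul_of_one_le_right hn0.le hx1
  nlinarith

/-- The cost of a rebuild at level `j`. -/
noncomputable def rebuildCost (K w : ℝ) (c : ℕ → ℝ) (n j : ℕ) : ℝ :=
  K * (max (c j) 0 + (2 ^ levels n) ^ 2 + 2 ^ (levels n - j) * ((2 : ℝ) ^ j) ^ w)

theorem le_rebuildCost {K K' w : ℝ} {c : ℕ → ℝ} {n j : ℕ} (hj : j ≤ levels n) (hK : 0 ≤ K)
    (hK' : 0 ≤ K') :
    15 * n + 2 * levels n + 2 * n * levels n + 3 * (2 ^ j) ^ 2 + K' * ((2 ^ j : ℕ) : ℝ) ^ w +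
      2 ^ j * n + (2 ^ (levels n - j) : ℕ) * (K * ((2 ^ j : ℕ) : ℝ) ^ w) + c j + 24 * n ^ 2 + 2 ≤
      rebuildCost (49 + K + K') w c n j := by
  have h1 : (2 * n : ℝ) ≤ 2 ^ levels n := by exact_mod_cast two_mul_le_two_pow_levels n
  have h2 : ((levels n : ℕ) : ℝ) ≤ 2 ^ levels n := by
    exact_mod_cast (Nat.lt_two_pow_self (n := levels n)).le
  have h3 : (2 : ℝ) ^ j ≤ 2 ^ levels n := by gcongr; norm_num
  have h4 : (1 : ℝ) ≤ 2 ^ levels n := one_le_pow₀ (by norm_num)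
  have h5 : (1 : ℝ) ≤ 2 ^ (levels n - j) := one_le_pow₀ (by norm_num)
  have hn0 : (0 : ℝ) ≤ n := Nat.cast_nonneg _
  have hp0 : (0 : ℝ) ≤ levels n := Nat.cast_nonneg _
  have hj0 : (0 : ℝ) ≤ 2 ^ j := by positivity
  have hX0 : 0 ≤ ((2 : ℝ) ^ j) ^ w := by positivity
  unfold rebuildCost
  push_cast
  generalize (2 : ℝ) ^ levels n = N at *
  generalize (2 : ℝ) ^ (levels n - j) = s at *
  generalize ((2 : ℝ) ^ j) ^ w = X at *
  generalize (2 : ℝ) ^ j = r at *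
  have e1 : N ≤ N ^ 2 := by nlinarith
  have e2 : n * (levels n : ℝ) ≤ N ^ 2 := by nlinarith
  have e3 : r ^ 2 ≤ N ^ 2 := by gcongr
  have e4 : r * n ≤ N ^ 2 := by nlinarith
  have e5 : (n : ℝ) ^ 2 ≤ N ^ 2 := by
    have : (n : ℝ) ≤ N := by linarith
    gcongr
  have e6 : X ≤ s * X := le_mul_of_one_le_left hX0 h5
  have e7 : c j ≤ max (c j) 0 := le_max_left _ _
  have e8 : 0 ≤ max (c j) 0 := le_max_right _ _
  have e9 := mul_le_mul_of_nonneg_left e6 hK'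
  have e10 : 0 ≤ N ^ 2 := by positivity
  have e11 : 0 ≤ s * X := by positivity
  have e12 : 0 ≤ (48 + K + K') * max (c j) 0 := by positivity
  have e13 : 0 ≤ (K + K') * N ^ 2 := by positivity
  nlinarith

end ProjMaint


namespace ProjMaint

/-! ### The data structure for a fixed loss in the exponent -/

theorem sum_rebuildCost_le {ω α a δ e : ℝ} (hω : IsMatMulExponent ω) (hα : IsDualExponent α)
    (ha0 : 0 < a) (ha : a ≤ α) (hδ0 : 0 < δ) (hδ1 : δ ≤ 1 / 2) (he0 : 0 < e) (he : e ≤ δ)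
    (hea : e < a) :
    ∃ L : ℝ, 0 ≤ L ∧ ∀ K : ℝ, 0 ≤ K → ∀ n : ℕ, 1 ≤ n → ∃ c : ℕ → ℝ,
      (∀ j ≤ levels n, MulCost n (2 ^ j) n (c j)) ∧
      16 * levels n * ∑ j ∈ (Finset.range (levels n + 1)).filter
        (fun j => lazySize (a - e) n < 2 ^ j), rebuildCost K ω c n j / Real.sqrt (2 ^ j) ≤
      96 * K * L * (((n : ℝ) ^ (ω - 1 / 2) + (n : ℝ) ^ (2 - a / 2 + 3 * δ)) * Real.log n) := by
  have hω2 := hω.two_le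
  have ha1 : a ≤ 1 := ha.trans hα.le_one
  obtain ⟨K₁, hK₁, h1⟩ := exists_levelCost hω hα ha0 ha hδ0 hδ1 he0 he hea
  obtain ⟨K₂, hK₂, h2⟩ := exists_sum_level_le (ω - 1 / 2) (2 - a / 2 + 2 * δ) (by linarith)
    (by linarith) hδ0
  refine ⟨K₁ * K₂, by positivity, fun K hK n hn => ?_⟩
  obtain ⟨c, hc, hlev⟩ := h1 n hn
  refine ⟨c, hc, ?_⟩
  have hl0 : 0 ≤ Real.log n := Real.log_natCast_nonneg n
  have hR : 0 ≤ (n : ℝ) ^ (ω - 1 / 2) + (n : ℝ) ^ (2 - a / 2 + 3 * δ) := by positivity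
  -- For `n = 1` the right side vanishes with `log n`; no level qualifies, as `2^j ≤ 2` never
  -- exceeds the lazy size `2`.
  rcases hn.eq_or_lt with rfl | hn2
  · rw [Finset.sum_eq_zero, mul_zero]
    · positivity
    · intro j hj
      obtain ⟨hj1, hj2⟩ := Finset.mem_filter.1 hj
      rw [Finset.mem_range, levels_one] at hj1
      simp only [lazySize, Nat.cast_one, Real.one_rpow, Nat.ceil_one] at hj2
      interval_cases j <;> omega
  have hterm : ∀ j ∈ (Finset.range (levels n + 1)).filter
      (fun j => lazySize (a - e) n < 2 ^ j), rebuildCost K ω c n j / Real.sqrt (2 ^ j) ≤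
      K * K₁ * ((2 : ℝ) ^ (levels n * (ω - 1 / 2) - δ * (levels n - j)) +
            2 ^ (levels n * (2 - a / 2 + 2 * δ))) := by
    intro j hj
    obtain ⟨hj1, hj2⟩ := Finset.mem_filter.1 hj
    have hjp : j ≤ levels n := Nat.lt_succ_iff.1 (Finset.mem_range.1 hj1)
    have h3 : (n : ℝ) ^ (a - e) ≤ 2 ^ j := by
      refine (lazySize_bounds (by linarith : 0 ≤ a - e) hn).2.1.trans ?_
      exact_mod_cast hj2.le
    have h4 := hlev j hjp h3
    rw [div_le_iff₀ (by positivity), rebuildCost, max_eq_left (hc j hjp).nonneg]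
    refine (mul_le_mul_of_nonneg_left h4 hK).trans (le_of_eq (by ring))
  have hsum := (Finset.sum_le_sum hterm).trans (Finset.sum_le_sum_of_subset_of_nonneg
    (Finset.filter_subset _ _) fun j _ _ => by positivity)
  rw [← Finset.mul_sum] at hsum
  have hsum2 := hsum.trans (mul_le_mul_of_nonneg_left (h2 n hn) (by positivity))
  have hlog := levels_le_log hn2
  rw [show 2 - a / 2 + 2 * δ + δ = 2 - a / 2 + 3 * δ by ring] at hsum2
  calc _ ≤ 16 * (levels n : ℝ) * (K * K₁ * (K₂ *
        ((n : ℝ) ^ (ω - 1 / 2) + (n : ℝ) ^ (2 - a / 2 + 3 * δ)))) := by gcongr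
    _ ≤ 16 * (6 * Real.log n) * (K * K₁ * (K₂ *
        ((n : ℝ) ^ (ω - 1 / 2) + (n : ℝ) ^ (2 - a / 2 + 3 * δ)))) := by gcongr
    _ = _ := by ring

/-- `K₀` precedes `δ` since initialization suffers no loss. `K` depends on `δ`; the spare factor
`n^(-e)` in the lazy cost, obtained from the threshold `n^(a-e)`, will absorb it. -/
theorem exists_spec_of_loss {ω α a : ℝ} (hω : IsMatMulExponent ω) (hα : IsDualExponent α)
    (ha0 : 0 < a) (ha : a ≤ α) :
    ∃ K₀ : ℝ, 0 ≤ K₀ ∧ ∀ δ : ℝ, 0 < δ → δ ≤ 1 / 2 → ∃ e > 0, ∃ K : ℝ, 0 ≤ K ∧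
      ∀ d n : ℕ, 1 ≤ d → d ≤ n → ∃ D : DataStructure d n,
        D.Spec (K₀ * ((n : ℝ) ^ 2 * (d : ℝ) ^ (ω - 2)))
          (K * (((n : ℝ) ^ (ω - 1 / 2) + (n : ℝ) ^ (2 - a / 2 + 3 * δ)) * Real.log n))
          (K * (n : ℝ) ^ (1 + a - e)) := by
  have hω2 := hω.two_le
  have ha1 : a ≤ 1 := ha.trans hα.le_one
  obtain ⟨K, hK0, hK⟩ := hω.mulCost
  set K' := (4 * K + 5) * 2 ^ ω
  have hK'0 : 0 ≤ K' := by positivity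
  have hinv : ∀ r : ℕ, 1 ≤ r → InvCost r (K' * (r : ℝ) ^ ω) := fun r hr =>
    InvCost.of_mulCost hω2 hK hr
  refine ⟨29 + 12 * K + K', by positivity, fun δ hδ0 hδ1 => ?_⟩
  -- The bound by `a / 2` keeps the lazy exponent `a - e` positive.
  set e := min δ (a / 2)
  have he0 : 0 < e := lt_min hδ0 (by linarith)
  have heδ : e ≤ δ := min_le_left _ _
  have hea : e < a := (min_le_right _ _).trans_lt (by linarith)
  obtain ⟨L, hL0, hL⟩ := sum_rebuildCost_le hω hα ha0 ha hδ0 hδ1 he0 heδ hea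
  obtain ⟨K₁, hK₁0, hK₁⟩ := hα.mulCost_square ha he0
  set K₂ := (4 * K₁ + 5) * 2 ^ (3 - a + e)
  have hK₂0 : 0 ≤ K₂ := by positivity
  have hinv' : ∀ r : ℕ, 1 ≤ r → InvCost r (K₂ * (r : ℝ) ^ (3 - (a - e))) := fun r hr => by
    rw [show 3 - (a - e) = 3 - a + e by ring]
    exact InvCost.of_mulCost (by linarith) hK₁ hr
  set M := max (96 * (49 + K + K') * L) (151 + 64 * K₂)
  refine ⟨e, he0, M, le_max_of_le_left (by positivity), fun d n hd hdn => ?_⟩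
  have hn : 1 ≤ n := hd.trans hdn
  obtain ⟨c, hc, hsum⟩ := hL (49 + K + K') (by positivity) n hn
  obtain ⟨hr2, -, -⟩ := lazySize_bounds (by linarith : 0 ≤ a - e) hn
  obtain ⟨hs, hI⟩ := initCost_le (w := ω) hd hdn hω2 hK0 hK'0
  have hR0 : 0 ≤ ((n : ℝ) ^ (ω - 1 / 2) + (n : ℝ) ^ (2 - a / 2 + 3 * δ)) * Real.log n :=
    mul_nonneg (by positivity) (Real.log_natCast_nonneg n)
  have hlazy := lazyCost_le (b := a - e) (by linarith) (by linarith) hK₂0 hn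
  obtain ⟨D, hD⟩ := exists_spec (cost := rebuildCost (49 + K + K') ω c n) hs (hK d hd)
    (hinv d hd) hr2 (fun j => by unfold rebuildCost; positivity)
    (exists_updateProg hn hr2 (t := fun j => K' * ((2 ^ j : ℕ) : ℝ) ^ ω)
      (t₁ := fun j => (2 ^ (levels n - j) : ℕ) * (K * ((2 ^ j : ℕ) : ℝ) ^ ω)) (t₂ := c)
      (hinv' _ (by omega)) (fun j _ => hinv _ Nat.one_le_two_pow) (fun j hj =>
        ((hK (2 ^ j) Nat.one_le_two_pow).cols (2 ^ (levels n - j))).mono le_rfl le_rfl (by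
          rw [← pow_add, Nat.sub_add_cancel hj]
          have := two_mul_le_two_pow_levels n
          omega) le_rfl) hc hlazy fun j hj => le_rebuildCost hj hK0 hK'0)
  refine ⟨D, hD.mono hI (hsum.trans ?_) ?_⟩
  · exact mul_le_mul_of_nonneg_right (le_max_left _ _) hR0
  · rw [show 1 + (a - e) = 1 + a - e by ring]
    exact mul_le_mul_of_nonneg_right (le_max_right _ _) (by positivity)

/-! ### Letting the loss tend to zero -/

/-- Take the largest `m ≤ n` with `P m n`; the default `0` of the search explains the first
alternative. -/
theorem exists_diagonal (P : ℕ → ℕ → Prop) (hP : ∀ m, ∀ᶠ n in atTop, P m n) :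
    ∃ m : ℕ → ℕ, Tendsto m atTop atTop ∧ ∀ n, m n = 0 ∨ P (m n) n := by
  classical
  refine ⟨fun n => Nat.findGreatest (fun m => P m n) n, ?_, fun n => ?_⟩
  · refine tendsto_atTop.2 fun M => ?_
    filter_upwards [hP M, eventually_ge_atTop M] with n h1 h2
    exact Nat.le_findGreatest h2 h1
  · by_cases h : Nat.findGreatest (fun m => P m n) n = 0
    · exact Or.inl h
    · exact Or.inr (Nat.findGreatest_of_ne_zero (P := fun m => P m n) (m := Nat.findGreatest _ n)
        rfl h)

theorem eventually_le_rpow (K : ℝ) {e : ℝ} (he : 0 < e) : ∀ᶠ n : ℕ in atTop, K ≤ (n : ℝ) ^ e :=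
  ((tendsto_rpow_atTop he).comp tendsto_natCast_atTop_atTop).eventually_ge_atTop K

theorem exists_spec_vanishing_loss {ω α a : ℝ} (hω : IsMatMulExponent ω) (hα : IsDualExponent α)
    (ha0 : 0 < a) (ha : a ≤ α) :
    ∃ (K : ℝ) (g : ℕ → ℝ), Tendsto g atTop (𝓝 0) ∧
      ∀ d n : ℕ, 1 ≤ d → d ≤ n → ∃ D : DataStructure d n,
        D.Spec (K * ((n : ℝ) ^ 2 * (d : ℝ) ^ (ω - 2)))
          (K * (((n : ℝ) ^ (ω - 1 / 2) + (n : ℝ) ^ (2 - a / 2 + g n)) * Real.log n))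
          (K * (n : ℝ) ^ (1 + a)) := by
  obtain ⟨K₀, hK₀, hloss⟩ := exists_spec_of_loss hω hα ha0 ha
  -- If `ω - 1/2` dominates strictly, a fixed small `δ` is harmless, and indeed a growing constant
  -- in front of `n^(ω-1/2)` could not be absorbed. Otherwise `n^(2-a/2+o(1))` absorbs both the
  -- other power and the growing constants.
  rcases lt_or_ge (2 - a / 2) (ω - 1 / 2) with hlt | hge
  · obtain ⟨δ, hδ0, hδ1, hδ2⟩ : ∃ δ : ℝ, 0 < δ ∧ δ ≤ 1 / 2 ∧ 2 - a / 2 + 3 * δ ≤ ω - 1 / 2 :=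
      ⟨min (1 / 2) ((ω - 1 / 2 - (2 - a / 2)) / 3), lt_min (by norm_num) (by linarith),
        min_le_left _ _, by
          have := min_le_right (1 / 2 : ℝ) ((ω - 1 / 2 - (2 - a / 2)) / 3)
          linarith⟩
    obtain ⟨e, he, K, hK, h⟩ := hloss δ hδ0 hδ1
    refine ⟨max K₀ (2 * K), fun _ => 0, tendsto_const_nhds, fun d n hd hdn => ?_⟩
    obtain ⟨D, hD⟩ := h d n hd hdn
    have hn : (1 : ℝ) ≤ n := by exact_mod_cast hd.trans hdn
    have hl : 0 ≤ Real.log n := Real.log_natCast_nonneg n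
    refine ⟨D, hD.mono ?_ ?_ ?_⟩
    · gcongr
      exact le_max_left _ _
    · have h1 := Real.rpow_le_rpow_of_exponent_le hn hδ2
      have h2 : (0 : ℝ) ≤ (n : ℝ) ^ (2 - a / 2 + 0) := by positivity
      calc _ ≤ K * ((2 * ((n : ℝ) ^ (ω - 1 / 2) + (n : ℝ) ^ (2 - a / 2 + 0))) * Real.log n) := by
            gcongr
            linarith
        _ = 2 * K * (((n : ℝ) ^ (ω - 1 / 2) + (n : ℝ) ^ (2 - a / 2 + 0)) * Real.log n) := by ring
        _ ≤ _ := by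
            gcongr
            exact le_max_right _ _
    · calc _ ≤ 2 * K * (n : ℝ) ^ (1 + a) := by
            gcongr
            · linarith
            · linarith
        _ ≤ _ := by
            gcongr
            exact le_max_right _ _
  · have hδ0 : ∀ m : ℕ, (0 : ℝ) < 1 / (2 * (m + 1)) := fun m => by positivity
    have hδ1 : ∀ m : ℕ, (1 : ℝ) / (2 * (m + 1)) ≤ 1 / 2 := fun m => by
      gcongr
      have : (0 : ℝ) ≤ m := Nat.cast_nonneg m
      linarith
    choose e he K hK h using fun m : ℕ => hloss _ (hδ0 m) (hδ1 m)
    obtain ⟨m, hm, hm'⟩ := exists_diagonal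
      (fun m n => K m ≤ (n : ℝ) ^ ((1 : ℝ) / (2 * (m + 1))) ∧ K m ≤ (n : ℝ) ^ (e m))
      fun m => (eventually_le_rpow _ (hδ0 m)).and (eventually_le_rpow _ (he m))
    -- Three units of `δ` come from the loss, and the fourth absorbs `K (m n)`.
    have hg : Tendsto (fun n => 4 * (1 / (2 * ((m n : ℝ) + 1)))) atTop (𝓝 0) := by
      have h1 : Tendsto (fun k : ℕ => 2 * (1 / ((k : ℝ) + 1))) atTop (𝓝 (2 * 0)) :=
        tendsto_one_div_add_atTop_nhds_zero_nat.const_mul 2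
      rw [mul_zero] at h1
      refine (h1.comp hm).congr fun n => ?_
      simp only [Function.comp_apply]
      field_simp
      norm_num
    refine ⟨max K₀ (2 * max 1 (K 0)), _, hg, fun d n hd hdn => ?_⟩
    obtain ⟨D, hD⟩ := h (m n) d n hd hdn
    have hn : (1 : ℝ) ≤ n := by exact_mod_cast hd.trans hdn
    have hn0 : (0 : ℝ) < n := by linarith
    have hl : 0 ≤ Real.log n := Real.log_natCast_nonneg n
    set δ : ℝ := 1 / (2 * ((m n : ℝ) + 1))
    have hδ : 0 < δ := hδ0 (m n)
    have hM1 : 1 ≤ max 1 (K 0) := le_max_left _ _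
    have habs : K (m n) ≤ max 1 (K 0) * (n : ℝ) ^ δ ∧
        K (m n) ≤ max 1 (K 0) * (n : ℝ) ^ (e (m n)) := by
      have h1 : 1 ≤ (n : ℝ) ^ δ := Real.one_le_rpow hn hδ.le
      have h2 : 1 ≤ (n : ℝ) ^ (e (m n)) := Real.one_le_rpow hn (he _).le
      rcases hm' n with h3 | ⟨h3, h4⟩
      · have h4 : K (m n) ≤ max 1 (K 0) := by rw [h3]; exact le_max_right _ _
        exact ⟨h4.trans (le_mul_of_one_le_right (by linarith) h1),
          h4.trans (le_mul_of_one_le_right (by linarith) h2)⟩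
      · exact ⟨h3.trans (le_mul_of_one_le_left (by linarith) hM1),
          h4.trans (le_mul_of_one_le_left (by linarith) hM1)⟩
    refine ⟨D, hD.mono ?_ ?_ ?_⟩
    · gcongr
      exact le_max_left _ _
    · have h1 : (n : ℝ) ^ (ω - 1 / 2) ≤ (n : ℝ) ^ (2 - a / 2 + 3 * δ) :=
        Real.rpow_le_rpow_of_exponent_le hn (by linarith)
      have h2 : (n : ℝ) ^ (2 - a / 2 + 4 * δ) = (n : ℝ) ^ δ * (n : ℝ) ^ (2 - a / 2 + 3 * δ) := by
        rw [← Real.rpow_add hn0]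
        congr 1
        ring
      have h3 : (0 : ℝ) ≤ (n : ℝ) ^ (ω - 1 / 2) := by positivity
      calc _ ≤ (max 1 (K 0) * (n : ℝ) ^ δ) *
            ((2 * (n : ℝ) ^ (2 - a / 2 + 3 * δ)) * Real.log n) := by
            gcongr
            · exact habs.1
            · linarith
        _ = 2 * max 1 (K 0) * ((0 + (n : ℝ) ^ (2 - a / 2 + 4 * δ)) * Real.log n) := by
            rw [h2]; ring
        _ ≤ _ := by
            gcongr
            exact le_max_right _ _
    · calc _ ≤ (max 1 (K 0) * (n : ℝ) ^ (e (m n))) * (n : ℝ) ^ (1 + a - e (m n)) := by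
            gcongr
            exact habs.2
        _ = max 1 (K 0) * (n : ℝ) ^ (1 + a) := by
            rw [mul_assoc, ← Real.rpow_add hn0]
            congr 2
            ring
        _ ≤ _ := mul_le_mul_of_nonneg_right (le_max_of_le_right (by linarith)) (by positivity)

end ProjMaint


theorem theorem2 (ω α a : ℝ) (hω : ProjMaint.IsMatMulExponent ω)
    (hα : ProjMaint.IsDualExponent α) (ha_pos : 0 < a) (ha : a ≤ α) :
    ∃ (D : ∀ d n : ℕ, ProjMaint.DataStructure d n) (K : ℝ) (g : ℕ → ℝ),
      Filter.Tendsto g Filter.atTop (nhds 0) ∧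
      ∀ (d n : ℕ), 1 ≤ d → d ≤ n →
      ∀ (A : Matrix (Fin d) (Fin n) ℝ), A.rank = d →
      ∀ (f : ℝ → ℝ) (ε : ℝ), 0 < ε → ε < 1 / 4 →
        (∀ u v : Fin n → ℝ, (∀ i, 0 < u i) → (∀ i, 0 < v i) →
          ((D d n).initTime f A ε u v : ℝ) ≤ K * ((n : ℝ) ^ 2 * (d : ℝ) ^ (ω - 2))) ∧
        (∀ (T : ℕ) (u v : ℕ → Fin n → ℝ),
          (∀ k ≤ T, ∀ i, 0 < u k i) → (∀ k ≤ T, ∀ i, 0 < v k i) →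
          (∀ k, 1 ≤ k → k ≤ T →
            ProjMaint.CorrectOutput f A ε (u k) (v k) ((D d n).memory f A ε u v k)) ∧
          (∀ C : ℝ, 0 ≤ C → ProjMaint.SmallChange u T C → ProjMaint.SmallChange v T C →
            ∑ k ∈ Finset.range T, ((D d n).updateTime f A ε u v k : ℝ) ≤
              K * (T * (C / ε * ((n : ℝ) ^ (ω - 1 / 2) + (n : ℝ) ^ (2 - a / 2 + g n)) *
                Real.log n + (n : ℝ) ^ (1 + a))))) := by
  obtain ⟨K, g, hg, h⟩ := ProjMaint.exists_spec_vanishing_loss hω hα ha_pos ha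
  -- A default for pairs outside `1 ≤ d ≤ n`, so that one family `D` can be chosen.
  have : ∀ d n, Nonempty (ProjMaint.DataStructure d n) := fun d n => ⟨⟨.halt, .halt⟩⟩
  choose! D hD using h
  refine ⟨D, K, g, hg, fun d n hd hdn A hA f ε hε hε1 => ?_⟩
  obtain ⟨h1, h2⟩ := hD d n hd hdn A hA f ε hε hε1
  refine ⟨h1, fun T u v hu hv => ⟨(h2 T u v hu hv).1, fun C hC hcu hcv => ?_⟩⟩
  refine ((h2 T u v hu hv).2 C hC hcu hcv).trans (le_of_eq ?_)
  ring
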